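/- Let $G=(V,E)$ be a finite simple graph with edge weights $w:E\to\mathbb N$. For $v\in V$ let $d_w(v)=\sum_{uv\in E}w(uv)$. A cut is a partition of $V$ into two (possibly empty) sets $V_0,V_1$. It is stable if, for each $i\in\{0,1\}$ and each $v\in V_i$, $\sum_{vu\in E,\,u\in V_{1-i}}w(vu)\ge d_w(v)/2$. Its weight is the sum of $w(uv)$ over all edges $uv$ with endpoints on both sides. In Min Stable Cut one is given $(G,w)$ and has to find a stable cut of minimum weight among all stable cuts. **Theorem.** There is an algorithm which, given an instance of Min Stable Cut with $n$ vertices, maximum edge weight $W$ and maximum degree $\Delta$, together with a tree decomposition of $G$ of width $\mathrm{tw}$, finds an optimal solution (a stable cut of minimum weight) in time $$2^{O(\Delta\cdot\mathrm{tw})}\,(n+\log W)^{O(1)}.$$ Here the algorithm is a fixed program of a random access machine with logarithmic cost (each elementary step costs one plus the binary lengths of all numbers involved, addresses included), and weights are integers given in binary. As usual the given tree decomposition is assumed to have a number $N$ of nodes polynomial in $n$; precisely, a single algorithm correctly solves all instances and satisfies both of the following. 1. There is a constant $c$ such that on every instance, with any tree decomposition of width $\mathrm{tw}$ with $N$ nodes,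 the running time is at most $2^{c\Delta\mathrm{tw}}\,(n+N+\lfloor\log_2 W\rfloor+2)^{c}$. 2. For every $d$ there is a constant $c$ such that on every instance with a tree decomposition of width $\mathrm{tw}$ with $N\le (n+2)^d$ nodes, the running time is at most $2^{c\Delta\mathrm{tw}}\,(n+\lfloor\log_2 W\rfloor+2)^{c}$. (For $W=0$ or $E=\emptyset$, read $\lfloor\log_2 W\rfloor$ as $0$; if $n=0$, the width is read as $0$.) -/

import Mathlib

namespace MinStableCut

/-! ### Random access machine with logarithmic cost -/

/-- Arithmetic operations and comparisons of the machine. -/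
inductive Op where
  | add
  | sub
  | mul
  | div
  | lt
  | eq

/-- Value of an operation: `sub` is truncated subtraction, `div` is integer division
(with value `0` for the divisor `0`), `lt` and `eq` return `1` for true and `0` for false. -/
def Op.eval : Op → ℕ → ℕ → ℕ
  | .add, x, y => x + y
  | .sub, x, y => x - y
  | .mul, x, y => x * y
  | .div, x, y => x / y
  | .lt, x, y => if x < y then 1 else 0
  | .eq, x, y => if x = y then 1 else 0

/-- The memory: arrays numbered by naturals, each with cells numbered by naturals, each cell
holding a natural number. A program refers to arrays by constants only, so that it uses
finitely many of them. -/
abbrev Memory := ℕ → ℕ → ℕ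

/-- Expressions: constants, indirect reads `A[e]` and operations. -/
inductive Expr where
  | const (k : ℕ)
  | read (A : ℕ) (e : Expr)
  | op (o : Op) (e₁ e₂ : Expr)

/-- Value of an expression. -/
def Expr.eval (σ : Memory) : Expr → ℕ
  | .const k => k
  | .read A e => σ A (e.eval σ)
  | .op o e₁ e₂ => o.eval (e₁.eval σ) (e₂.eval σ)

/-- Cost of evaluating an expression: each elementary step costs one plus the lengths in binary
(`Nat.size`) of all numbers that it touches, addresses included. -/
def Expr.cost (σ : Memory) : Expr → ℕ
  | .const k => k.size + 1
  | .read A e => e.cost σ + (e.eval σ).size + (σ A (e.eval σ)).size + 1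
  | .op _ e₁ e₂ => e₁.cost σ + e₂.cost σ + (e₁.eval σ).size + (e₂.eval σ).size + 1

/-- Programs. A condition counts as true when its value is not `0`. -/
inductive Program where
  | skip
  | assign (A : ℕ) (i e : Expr)
  | seq (p q : Program)
  | ite (e : Expr) (p q : Program)
  | loop (e : Expr) (p : Program)

/-- `σ.write A i x` is the memory `σ` after `A[i] := x`. -/
def Memory.write (σ : Memory) (A i x : ℕ) : Memory :=
  fun B j => if B = A ∧ j = i then x else σ B j

/-- `Exec p σ τ t`: started in memory `σ`, the program `p` halts in memory `τ`, and the run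
has (logarithmic) cost exactly `t`. -/
inductive Exec : Program → Memory → Memory → ℕ → Prop where
  | skip (σ : Memory) : Exec .skip σ σ 1
  | assign (σ : Memory) (A : ℕ) (i e : Expr) :
      Exec (.assign A i e) σ (σ.write A (i.eval σ) (e.eval σ))
        (i.cost σ + e.cost σ + (i.eval σ).size + (e.eval σ).size + 1)
  | seq {p q : Program} {σ τ υ : Memory} {s t : ℕ} :
      Exec p σ τ s → Exec q τ υ t → Exec (.seq p q) σ υ (s + t)
  | ite_true {e : Expr} {p q : Program} {σ τ : Memory} {t : ℕ} :
      e.eval σ ≠ 0 → Exec p σ τ t →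
        Exec (.ite e p q) σ τ (e.cost σ + (e.eval σ).size + 1 + t)
  | ite_false {e : Expr} {p q : Program} {σ τ : Memory} {t : ℕ} :
      e.eval σ = 0 → Exec q σ τ t →
        Exec (.ite e p q) σ τ (e.cost σ + (e.eval σ).size + 1 + t)
  | loop_stop {e : Expr} {p : Program} {σ : Memory} :
      e.eval σ = 0 → Exec (.loop e p) σ σ (e.cost σ + (e.eval σ).size + 1)
  | loop_step {e : Expr} {p : Program} {σ τ υ : Memory} {s t : ℕ} :
      e.eval σ ≠ 0 → Exec p σ τ s → Exec (.loop e p) τ υ t →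
        Exec (.loop e p) σ υ (e.cost σ + (e.eval σ).size + 1 + s + t)

/-- The final memory and the running time are determined by the program and the input. -/
theorem Exec.det {p : Program} {σ τ τ' : Memory} {t t' : ℕ}
    (h : Exec p σ τ t) (h' : Exec p σ τ' t') : τ = τ' ∧ t = t' := by
  induction h generalizing τ' t' with
  | skip => cases h'; exact ⟨rfl, rfl⟩
  | assign => cases h'; exact ⟨rfl, rfl⟩
  | seq _ _ ih₁ ih₂ =>
    cases h' with
    | seq a b =>
      obtain ⟨rfl, rfl⟩ := ih₁ a
      obtain ⟨rfl, rfl⟩ := ih₂ b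
      exact ⟨rfl, rfl⟩
  | ite_true hc _ ih =>
    cases h' with
    | ite_true _ a => obtain ⟨rfl, rfl⟩ := ih a; exact ⟨rfl, rfl⟩
    | ite_false hc' _ => exact absurd hc' hc
  | ite_false hc _ ih =>
    cases h' with
    | ite_true hc' _ => exact absurd hc hc'
    | ite_false _ a => obtain ⟨rfl, rfl⟩ := ih a; exact ⟨rfl, rfl⟩
  | loop_stop hc =>
    cases h' with
    | loop_stop _ => exact ⟨rfl, rfl⟩
    | loop_step hc' _ _ => exact absurd hc hc'
  | loop_step hc _ _ ih₁ ih₂ =>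
    cases h' with
    | loop_stop hc' => exact absurd hc' hc
    | loop_step _ a b =>
      obtain ⟨rfl, rfl⟩ := ih₁ a
      obtain ⟨rfl, rfl⟩ := ih₂ b
      exact ⟨rfl, rfl⟩

/-! ### The problem -/

/-- An edge-weighted graph on the vertices `0, …, n - 1`. Only the values of `weight` on
edges of the graph are ever used. -/
structure Instance where
  n : ℕ
  graph : SimpleGraph (Fin n)
  weight : Sym2 (Fin n) → ℕ

namespace Instance

variable (I : Instance)

open scoped Classical in
/-- The weight of the edge `uv`, and `0` if `uv` is not an edge. -/
noncomputable def wt (u v : Fin I.n) : ℕ :=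
  if I.graph.Adj u v then I.weight s(u, v) else 0

/-- The weighted degree of `v`. -/
noncomputable def weightedDegree (v : Fin I.n) : ℕ :=
  ∑ u, I.wt v u

/-- A cut is given by its side `V₁ = S`; the other side is `V₀ = Sᶜ`. This is the total weight
of the edges at `v` whose other endpoint is on the side that does not contain `v`. -/
noncomputable def crossingWeight (S : Finset (Fin I.n)) (v : Fin I.n) : ℕ :=
  ∑ u with ¬ (u ∈ S ↔ v ∈ S), I.wt v u

/-- At every vertex, at least half of the weighted degree crosses the cut. -/
def IsStable (S : Finset (Fin I.n)) : Prop :=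
  ∀ v, I.weightedDegree v ≤ 2 * I.crossingWeight S v

/-- The total weight of the cut edges; each of them has exactly one endpoint in `S`. -/
noncomputable def cutWeight (S : Finset (Fin I.n)) : ℕ :=
  ∑ u ∈ S, ∑ v ∈ Sᶜ, I.wt u v

/-- An optimal solution: a stable cut of minimum weight among all stable cuts. -/
def IsMinStableCut (S : Finset (Fin I.n)) : Prop :=
  I.IsStable S ∧ ∀ S', I.IsStable S' → I.cutWeight S ≤ I.cutWeight S'

open scoped Classical in
/-- The maximum weight of an edge (`0` if there are no edges). -/
noncomputable def maxWeight : ℕ :=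
  I.graph.edgeFinset.sup I.weight

open scoped Classical in
/-- The maximum degree (number of neighbours), `0` for the empty graph. -/
noncomputable def maxDegree : ℕ :=
  I.graph.maxDegree

end Instance

/-- A tree decomposition of a graph, with the nodes `0, …, nodes - 1`. -/
structure TreeDecomposition {n : ℕ} (G : SimpleGraph (Fin n)) where
  nodes : ℕ
  tree : SimpleGraph (Fin nodes)
  isTree : tree.IsTree
  bag : Fin nodes → Finset (Fin n)
  vertex_mem : ∀ v, ∃ t, v ∈ bag t
  edge_mem : ∀ u v, G.Adj u v → ∃ t, u ∈ bag t ∧ v ∈ bag t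
  connected : ∀ v, (tree.induce {t | v ∈ bag t}).Connected

/-- The width: the maximum size of a bag, minus one (`0` if all bags are empty, which happens
only for the graph without vertices). -/
def TreeDecomposition.width {n : ℕ} {G : SimpleGraph (Fin n)} (D : TreeDecomposition G) : ℕ :=
  (Finset.univ.sup fun t => (D.bag t).card) - 1

/-! ### Input and output conventions -/

/-- The 0/1 value of a proposition. -/
noncomputable def bit (p : Prop) : ℕ :=
  open scoped Classical in if p then 1 else 0

/-- A matrix as an array, row by row, followed by zeros. -/
def matrixCells {a b : ℕ} (M : Fin a → Fin b → ℕ) (k : ℕ) : ℕ :=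
  if h : k / b < a ∧ 0 < b then M ⟨k / b, h.1⟩ ⟨k % b, Nat.mod_lt k h.2⟩ else 0

/-- The initial memory. Array `0` holds the number of vertices and the number of nodes of the
decomposition; arrays `1` to `4` hold the adjacency matrix of the graph, the matrix of its
weights, the adjacency matrix of the tree and the incidence matrix of nodes and vertices that
describes the bags. Everything else is `0`. -/
noncomputable def inputMemory (I : Instance) (D : TreeDecomposition I.graph) : Memory
  | 0, 0 => I.n
  | 0, 1 => D.nodes
  | 1, k => matrixCells (fun u v => bit (I.graph.Adj u v)) k
  | 2, k => matrixCells I.wt k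
  | 3, k => matrixCells (fun s t => bit (D.tree.Adj s t)) k
  | 4, k => matrixCells (fun t v => bit (v ∈ D.bag t)) k
  | _, _ => 0

/-- The memory holds the cut `S` as output: cell `v` of array `5` is the side of `v`. -/
def Outputs {n : ℕ} (σ : Memory) (S : Finset (Fin n)) : Prop :=
  ∀ v : Fin n, σ 5 v = if v ∈ S then 1 else 0

/-- On every instance with a tree decomposition, the program halts with an optimal solution as
its output. -/
def Solves (p : Program) : Prop :=
  ∀ (I : Instance) (D : TreeDecomposition I.graph),
    ∃ (σ : Memory) (t : ℕ), Exec p (inputMemory I D) σ t ∧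
      ∃ S, I.IsMinStableCut S ∧ Outputs σ S

end MinStableCut

/-! A cut of maximum weight is stable, because moving a vertex at which less than half of the
weighted degree crosses would increase the weight. Stability can therefore be turned into a cost.
Charge every vertex the crossing weight at it, plus a penalty exceeding the sum of all weighted
degrees if it violates stability (`localCost`). The charges of a stable cut add up to twice its
weight, and a violated vertex alone costs more than that, so a cut of minimum total charge is a
minimum stable cut (`isMinStableCut_of_localCost`).

The charge at v depends only on the sides of v and of its neighbours. Replace each bag B by its
closed neighbourhood N[B]. The nodes whose new bag contains v form the union of the subtrees of the
vertices in N[v], each of which meets the subtree of v, so this union is again a subtree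
(`preconnected_closedNeighbourhood`). A node with v ∈ B now sees all of N[v]. If the graph has an
edge, a new bag has at most (tw+1)(Δ+1) ≤ 4Δ·tw vertices, hence at most 2^(4Δ·tw) assignments
(`prepared_counts_le`). Without edges Δ·tw is 0 although bags may be large; the dynamic programming
is then skipped and the empty cut is the output.

The dynamic programming stores, for each node and each assignment to the intersection with the
parent bag, the least cost and a choice attaining it. Optimality is only asserted locally, relative
to the tables of the children. Summed over the tree, the local recursions telescope
(`sum_joinCost`), which yields optimality of the assembled cut (`assemble_optimal`) without any
reasoning about subtrees.

For the running time, the algorithm is written in a language `Prog` of counted loops in which stored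
values are computed without multiplication. Each assignment then lengthens numbers by at most a
constant. If all loops have at most L rounds, a quantity `work` polynomial in L bounds both the
steps and the growth of lengths, so the logarithmic cost from numbers of b digits is at most `work *
(b + work + 1)` (`exec_run`). Here L is n + N + 2^(4Δ·tw). Tables are addressed by vertex sets coded
as numbers below 2^n; most cells are never touched, and the addresses have polynomial length. -/

namespace MinStableCut

/-! ### Structured programs: bounded loops over arrays -/

/-- Every number in the memory has at most `b` binary digits. -/
def Memory.SizeLe (b : ℕ) (σ : Memory) : Prop :=
  ∀ A i, (σ A i).size ≤ b

/-! ### Lengths of values and costs of expressions -/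

namespace Expr

/-- The arrays that occur in an expression. -/
def arrays : Expr → List ℕ
  | const _ => []
  | read A e => A :: e.arrays
  | op _ e₁ e₂ => e₁.arrays ++ e₂.arrays

/-- Factor by which the expression can exceed the length of the numbers in the memory. -/
def sizeFactor : Expr → ℕ
  | const k => k.size
  | read _ _ => 1
  | op _ e₁ e₂ => e₁.sizeFactor + e₂.sizeFactor + 1

/-- Factor by which the cost of the expression can exceed the length of the numbers in the
memory. -/
def costFactor : Expr → ℕ
  | const k => k.size + 1
  | read _ e => e.costFactor + e.sizeFactor + 2
  | op _ e₁ e₂ => e₁.costFactor + e₂.costFactor + e₁.sizeFactor + e₂.sizeFactor + 1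

/-- Multiplication occurs inside addresses only, so that the length of the value exceeds the
lengths of the numbers in the memory by a constant. -/
def Additive : Expr → Bool
  | const _ => true
  | read _ _ => true
  | op .mul _ _ => false
  | op _ e₁ e₂ => e₁.Additive && e₂.Additive

theorem eval_congr {σ τ : Memory} : ∀ {e : Expr}, (∀ A ∈ e.arrays, τ A = σ A) →
    e.eval τ = e.eval σ
  | const _, _ => rfl
  | read A e, h => by
    have := eval_congr (e := e) fun B hB => h B (by simp [arrays, hB])
    simp [eval, this, h A (by simp [arrays])]
  | op o e₁ e₂, h => by
    have h₁ := eval_congr (e := e₁) fun B hB => h B (by simp [arrays, hB])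
    have h₂ := eval_congr (e := e₂) fun B hB => h B (by simp [arrays, hB])
    simp [eval, h₁, h₂]

theorem size_add_le (x y : ℕ) : (x + y).size ≤ max x.size y.size + 1 := by
  rw [Nat.size_le, pow_succ]
  have hx : x < 2 ^ max x.size y.size :=
    (Nat.lt_size_self x).trans_le (Nat.pow_le_pow_right (by norm_num) (le_max_left _ _))
  have hy : y < 2 ^ max x.size y.size :=
    (Nat.lt_size_self y).trans_le (Nat.pow_le_pow_right (by norm_num) (le_max_right _ _))
  omega

theorem size_mul_le (x y : ℕ) : (x * y).size ≤ x.size + y.size := by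
  rw [Nat.size_le, pow_add]
  exact Nat.mul_lt_mul'' (Nat.lt_size_self x) (Nat.lt_size_self y)

theorem size_op_le (o : Op) (x y : ℕ) : (o.eval x y).size ≤ x.size + y.size + 1 := by
  cases o with
  | add => exact (size_add_le x y).trans (by omega)
  | sub => exact (Nat.size_le_size (Nat.sub_le x y)).trans (by omega)
  | mul => exact (size_mul_le x y).trans (by omega)
  | div => exact (Nat.size_le_size (Nat.div_le_self x y)).trans (by omega)
  | lt => simp only [Op.eval]; split_ifs <;> simp
  | eq => simp only [Op.eval]; split_ifs <;> simp

/-- This cruder bound serves conditions and addresses, where products are allowed: their length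
enters the cost but is not passed on to stored values. -/
theorem size_eval_le {σ : Memory} {b : ℕ} (hσ : σ.SizeLe b) :
    ∀ e : Expr, (e.eval σ).size ≤ e.sizeFactor * (b + 1)
  | const k => by
    simp only [eval, sizeFactor]; nlinarith [Nat.zero_le (k.size * b)]
  | read A e => by
    have := hσ A (e.eval σ)
    simp only [eval, sizeFactor]; omega
  | op o e₁ e₂ => by
    have h₁ := size_eval_le hσ e₁
    have h₂ := size_eval_le hσ e₂
    have := size_op_le o (e₁.eval σ) (e₂.eval σ)
    simp only [eval, sizeFactor]; nlinarith

/-- A product may have the combined length of its factors, so storing products could double lengths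
in every step. The other operations exceed the longer operand by at most one digit, and a read has
length at most `b` whatever its address is. -/
theorem size_eval_le_of_additive {σ : Memory} {b : ℕ} (hσ : σ.SizeLe b) :
    ∀ e : Expr, e.Additive = true → (e.eval σ).size ≤ b + e.sizeFactor
  | const k, _ => by simp [eval, sizeFactor]
  | read A e, _ => by
    have := hσ A (e.eval σ)
    simp only [eval, sizeFactor]; omega
  | op o e₁ e₂, h => by
    have hh : e₁.Additive = true ∧ e₂.Additive = true ∧ o ≠ .mul := by
      cases o <;> simp_all [Additive]
    have h₁ := size_eval_le_of_additive hσ e₁ hh.1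
    have h₂ := size_eval_le_of_additive hσ e₂ hh.2.1
    simp only [eval, sizeFactor]
    cases o with
    | add => exact (size_add_le _ _).trans (by omega)
    | sub => exact (Nat.size_le_size (Nat.sub_le _ _)).trans (by omega)
    | mul => exact absurd rfl hh.2.2
    | div => exact (Nat.size_le_size (Nat.div_le_self _ _)).trans (by omega)
    | lt => simp only [Op.eval]; split_ifs <;> simp; omega
    | eq => simp only [Op.eval]; split_ifs <;> simp; omega

theorem cost_le {σ : Memory} {b : ℕ} (hσ : σ.SizeLe b) :
    ∀ e : Expr, e.cost σ ≤ e.costFactor * (b + 1)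
  | const k => by
    simp only [cost, costFactor]; nlinarith [Nat.zero_le ((k.size + 1) * b)]
  | read A e => by
    have h₁ := cost_le hσ e
    have h₂ := size_eval_le hσ e
    have := hσ A (e.eval σ)
    simp only [cost, costFactor]; nlinarith
  | op o e₁ e₂ => by
    have h₁ := cost_le hσ e₁
    have h₂ := cost_le hσ e₂
    have h₃ := size_eval_le hσ e₁
    have h₄ := size_eval_le hσ e₂
    simp only [cost, costFactor]; nlinarith

end Expr

/-- Programs whose loops are of the form `for A[0] := 0, …, B[e] - 1 do p`. -/
inductive Prog where
  | assign (A : ℕ) (i e : Expr)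
  | seq (p q : Prog)
  | when (e : Expr) (p : Prog)
  | loop (A B : ℕ) (e : Expr) (p : Prog)

/-- The memory after `k` rounds of a loop with counter `A[0]` whose body acts as `f`. -/
def iterateCounter (f : Memory → Memory) (A : ℕ) (σ : Memory) : ℕ → Memory
  | 0 => σ.write A 0 0
  | k + 1 => (f (iterateCounter f A σ k)).write A 0 (k + 1)

namespace Prog

/-- The loop condition of `loop A B e p`. -/
def condition (A B : ℕ) (e : Expr) : Expr :=
  .op .lt (.read A (.const 0)) (.read B e)

/-- The new value of the counter in a loop. -/
def increment (A : ℕ) : Expr :=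
  .op .add (.read A (.const 0)) (.const 1)

/-- Translation to programs of the random access machine. -/
def toProgram : Prog → Program
  | assign A i e => .assign A i e
  | seq p q => .seq p.toProgram q.toProgram
  | when e p => .ite e p.toProgram .skip
  | .loop A B e p => .seq (.assign A (.const 0) (.const 0))
      (.loop (condition A B e) (.seq p.toProgram (.assign A (.const 0) (increment A))))

/-- The effect of a program on the memory. -/
def run : Prog → Memory → Memory
  | assign A i e, σ => σ.write A (i.eval σ) (e.eval σ)
  | seq p q, σ => q.run (p.run σ)
  | when e p, σ => if e.eval σ = 0 then σ else p.run σ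
  | .loop A B e p, σ => iterateCounter p.run A σ (σ B (e.eval σ))

/-- The arrays to which a program writes. -/
def writes : Prog → List ℕ
  | assign A _ _ => [A]
  | seq p q => p.writes ++ q.writes
  | when _ p => p.writes
  | .loop A _ _ p => A :: p.writes

/-- The arrays that hold the bounds of the loops. -/
def boundArrays : Prog → List ℕ
  | assign _ _ _ => []
  | seq p q => p.boundArrays ++ q.boundArrays
  | when _ p => p.boundArrays
  | .loop _ B _ p => B :: p.boundArrays

/-- Loop counters and loop bounds do not change within the loop, and no value that is stored
is computed by multiplication. -/
def Valid : Prog → Prop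
  | assign _ _ e => e.Additive = true
  | seq p q => p.Valid ∧ q.Valid
  | when _ p => p.Valid
  | .loop A B e p => p.Valid ∧ A ∉ p.writes ∧ B ∉ A :: p.writes ∧
      ∀ D ∈ e.arrays, D ∉ A :: p.writes

/-- Decidability allows the syntactic conditions on the concrete programs to be checked by `decide`.
-/
instance decidableValid : (p : Prog) → Decidable p.Valid
  | assign _ _ e => inferInstanceAs (Decidable (e.Additive = true))
  | seq p q =>
    have := decidableValid p
    have := decidableValid q
    inferInstanceAs (Decidable (p.Valid ∧ q.Valid))
  | when _ p => decidableValid p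
  | .loop A B e p =>
    have := decidableValid p
    inferInstanceAs (Decidable (p.Valid ∧ A ∉ p.writes ∧ B ∉ A :: p.writes ∧
      ∀ D ∈ e.arrays, D ∉ A :: p.writes))

/-! ### Frame rule and loop invariants -/

theorem write_of_ne {σ : Memory} {A D : ℕ} (h : D ≠ A) (i x : ℕ) : σ.write A i x D = σ D := by
  funext j; simp [Memory.write, h]

theorem iterateCounter_frame {f : Memory → Memory} {A D : ℕ} (hA : D ≠ A)
    (hf : ∀ τ, f τ D = τ D) (σ : Memory) : ∀ k, iterateCounter f A σ k D = σ D
  | 0 => write_of_ne hA _ _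
  | k + 1 => by rw [iterateCounter, write_of_ne hA, hf, iterateCounter_frame hA hf σ k]

theorem iterateCounter_counter (f : Memory → Memory) (A : ℕ) (σ : Memory) (k : ℕ) :
    iterateCounter f A σ k A 0 = k := by
  cases k <;> simp [iterateCounter, Memory.write]

/-- A program changes only the arrays to which it writes. -/
theorem run_frame {D : ℕ} : ∀ {p : Prog}, D ∉ p.writes → ∀ σ : Memory, p.run σ D = σ D
  | assign A i e, h, σ => write_of_ne (by simpa [writes] using h) _ _
  | seq p q, h, σ => by
    simp only [writes, List.mem_append, not_or] at h
    rw [run, run_frame h.2, run_frame h.1]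
  | when e p, h, σ => by
    rw [run]; split_ifs
    · rfl
    · exact run_frame (p := p) h σ
  | .loop A B e p, h, σ => by
    simp only [writes, List.mem_cons, not_or] at h
    exact iterateCounter_frame h.1 (run_frame h.2) σ _

/-- Invariants of loops. -/
theorem run_loop {A B : ℕ} {e : Expr} {p : Prog} {σ : Memory} (Inv : ℕ → Memory → Prop)
    (zero : Inv 0 (σ.write A 0 0))
    (succ : ∀ k < σ B (e.eval σ), ∀ τ : Memory, τ A 0 = k →
      (∀ D, D ∉ A :: p.writes → τ D = σ D) → Inv k τ → Inv (k + 1) ((p.run τ).write A 0 (k + 1))) :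
    Inv (σ B (e.eval σ)) ((Prog.loop A B e p).run σ) := by
  have key : ∀ k ≤ σ B (e.eval σ), Inv k (iterateCounter p.run A σ k) := by
    intro k
    induction k with
    | zero => intro _; exact zero
    | succ k ih =>
      intro hk
      refine succ k hk _ (iterateCounter_counter _ _ _ _) (fun D hD => ?_) (ih (by omega))
      simp only [List.mem_cons, not_or] at hD
      exact iterateCounter_frame hD.1 (run_frame hD.2) σ k
  exact key _ le_rfl

/-! ### Running times -/

/-- Bound for the cost of `assign A i e`. -/
def assignWork (i e : Expr) : ℕ :=
  i.costFactor + e.costFactor + i.sizeFactor + e.sizeFactor + 1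

/-- Bound for the cost of evaluating a condition. -/
def testWork (e : Expr) : ℕ :=
  e.costFactor + e.sizeFactor + 2

/-- Bound for the number of steps of a program all of whose loops have at most `L` rounds. -/
def work (L : ℕ) : Prog → ℕ
  | assign _ i e => assignWork i e
  | seq p q => p.work L + q.work L
  | when e p => testWork e + p.work L
  | .loop A B e p => 3 + (L + 1) *
      (testWork (condition A B e) + p.work L + assignWork (.const 0) (increment A))

theorem sizeLe_mono {σ : Memory} {b c : ℕ} (h : σ.SizeLe b) (hbc : b ≤ c) : σ.SizeLe c :=
  fun A i => (h A i).trans hbc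

theorem sizeLe_write {σ : Memory} {b x : ℕ} (h : σ.SizeLe b) (hx : x.size ≤ b) (A i : ℕ) :
    (σ.write A i x).SizeLe b := by
  intro B j
  simp only [Memory.write]
  split_ifs
  · exact hx
  · exact h B j

theorem sizeLe_assign {σ : Memory} {b : ℕ} (h : σ.SizeLe b) (A : ℕ) (i : Expr) {e : Expr}
    (he : e.Additive = true) :
    (σ.write A (i.eval σ) (e.eval σ)).SizeLe (b + assignWork i e) := by
  have := Expr.size_eval_le_of_additive h e he
  exact sizeLe_write (sizeLe_mono h (by omega)) (by unfold assignWork; omega) _ _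

theorem cost_assign_le {σ : Memory} {b : ℕ} (h : σ.SizeLe b) (i e : Expr) :
    i.cost σ + e.cost σ + (i.eval σ).size + (e.eval σ).size + 1 ≤ assignWork i e * (b + 1) := by
  have h₁ := Expr.cost_le h i
  have h₂ := Expr.cost_le h e
  have h₃ := Expr.size_eval_le h i
  have h₄ := Expr.size_eval_le h e
  unfold assignWork
  nlinarith

theorem cost_test_le {σ : Memory} {b : ℕ} (h : σ.SizeLe b) (e : Expr) :
    e.cost σ + (e.eval σ).size + 2 ≤ testWork e * (b + 1) := by
  have h₁ := Expr.cost_le h e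
  have h₂ := Expr.size_eval_le h e
  unfold testWork
  nlinarith

theorem eval_condition {σ : Memory} {A B : ℕ} {e : Expr} :
    (condition A B e).eval σ = if σ A 0 < σ B (e.eval σ) then 1 else 0 := rfl

/-- With `round` bounding a test, the body and an increment, numbers gain at most `round` digits per
round. They stay within `b + W` digits throughout the at most `L` rounds, so every round can be
charged at this length. -/
theorem exec_loop {A B : ℕ} {e : Expr} {p : Prog} {σ : Memory} {L b : ℕ}
    (hL : σ B (e.eval σ) ≤ L) (hAp : A ∉ p.writes) (hB : B ∉ A :: p.writes)
    (he : ∀ D ∈ e.arrays, D ∉ A :: p.writes) (hσ : σ.SizeLe b)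
    (body : ∀ k ≤ L, ∀ c, (iterateCounter p.run A σ k).SizeLe c →
      (p.run (iterateCounter p.run A σ k)).SizeLe (c + p.work L) ∧
      ∃ t ≤ p.work L * (c + p.work L + 1), Exec p.toProgram (iterateCounter p.run A σ k)
        (p.run (iterateCounter p.run A σ k)) t) :
    ((Prog.loop A B e p).run σ).SizeLe (b + (Prog.loop A B e p).work L) ∧
      ∃ t ≤ (Prog.loop A B e p).work L * (b + (Prog.loop A B e p).work L + 1),
        Exec (Prog.loop A B e p).toProgram σ ((Prog.loop A B e p).run σ) t := by
  set s : ℕ → Memory := iterateCounter p.run A σ with hs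
  set m := σ B (e.eval σ) with hm
  set round := testWork (condition A B e) + p.work L + assignWork (.const 0) (increment A)
    with hround
  have hW : (Prog.loop A B e p).work L = 3 + (L + 1) * round := rfl
  set W := (Prog.loop A B e p).work L with hWdef
  have frame : ∀ k D, D ∉ A :: p.writes → s k D = σ D := fun k D hD => by
    simp only [List.mem_cons, not_or] at hD
    exact iterateCounter_frame hD.1 (run_frame hD.2) σ k
  -- The loop writes neither to the array of the bound nor to the arrays in its index, so the bound
  -- evaluates to `m` before every round.
  have bound : ∀ k, s k B (e.eval (s k)) = m := fun k => by
    rw [Expr.eval_congr fun D hD => frame k D (he D hD), frame k B hB]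
  have inc : ∀ k, (increment A).eval (p.run (s k)) = k + 1 := fun k => by
    have : p.run (s k) A 0 = k := by
      rw [run_frame hAp]; exact iterateCounter_counter _ _ _ _
    simp [increment, Expr.eval, Op.eval, this]
  have next : ∀ k, s (k + 1) = (p.run (s k)).write A ((Expr.const 0).eval (p.run (s k)))
      ((increment A).eval (p.run (s k))) := fun k => by
    rw [inc]; rfl
  have size : ∀ k ≤ L, (s k).SizeLe (b + k * round) := by
    intro k
    induction k with
    | zero =>
      intro _
      simpa [hs, iterateCounter] using sizeLe_write hσ (x := 0) (by simp) A 0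
    | succ k ih =>
      intro hk
      rw [next]
      refine sizeLe_mono (sizeLe_assign (body k (by omega) _ (ih (by omega))).1 A _ rfl) ?_
      rw [Nat.add_mul, hround]; omega
  -- Induction on the number `r` of remaining rounds; the additional `round` pays for the last test,
  -- which fails.
  have exec : ∀ r k, k + r = m → ∃ t ≤ (r + 1) * round * (b + W + 1),
      Exec (.loop (condition A B e) (.seq p.toProgram (.assign A (.const 0) (increment A))))
        (s k) (s m) t := by
    intro r
    induction r with
    | zero =>
      intro k hk
      have hk' : k = m := by omega
      rw [hk']
      have h0 : (condition A B e).eval (s m) = 0 := by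
        rw [eval_condition, bound]
        simp [hs, iterateCounter_counter]
      refine ⟨_, ?_, Exec.loop_stop h0⟩
      have h1 := cost_test_le (size m hL) (condition A B e)
      have h2 : testWork (condition A B e) * (b + m * round + 1) ≤ round * (b + W + 1) := by
        refine Nat.mul_le_mul (by omega) ?_
        have : m * round ≤ (L + 1) * round := Nat.mul_le_mul (by omega) le_rfl
        omega
      simp only [zero_add, one_mul]
      omega
    | succ r ih =>
      intro k hk
      obtain ⟨t, ht, hexec⟩ := ih (k + 1) (by omega)
      have h0 : (condition A B e).eval (s k) ≠ 0 := by
        rw [eval_condition, bound]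
        simp [hs, iterateCounter_counter]
        omega
      have hkL : k ≤ L := by omega
      obtain ⟨hsz, t', ht', hexec'⟩ := body k hkL _ (size k hkL)
      refine ⟨_, ?_, Exec.loop_step h0 (Exec.seq hexec' (Exec.assign _ _ _ _))
        (by rw [next] at hexec; exact hexec)⟩
      have h1 := cost_test_le (size k hkL) (condition A B e)
      have h2 := cost_assign_le hsz (.const 0) (increment A)
      have hkr : (k + 1) * round ≤ (L + 1) * round := Nat.mul_le_mul (by omega) le_rfl
      rw [Nat.add_mul, one_mul] at hkr
      have h3 : testWork (condition A B e) * (b + k * round + 1) ≤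
          testWork (condition A B e) * (b + W + 1) := Nat.mul_le_mul le_rfl (by omega)
      have h4 : p.work L * (b + k * round + p.work L + 1) ≤ p.work L * (b + W + 1) :=
        Nat.mul_le_mul le_rfl (by omega)
      have h5 : assignWork (.const 0) (increment A) * (b + k * round + p.work L + 1) ≤
          assignWork (.const 0) (increment A) * (b + W + 1) := Nat.mul_le_mul le_rfl (by omega)
      have h6 : (r + 1 + 1) * round * (b + W + 1) = (r + 1) * round * (b + W + 1) +
          (testWork (condition A B e) * (b + W + 1) + p.work L * (b + W + 1) +
            assignWork (.const 0) (increment A) * (b + W + 1)) := by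
        rw [hround]; ring
      omega
  refine ⟨sizeLe_mono (size m hL) ?_, ?_⟩
  · have : m * round ≤ (L + 1) * round := Nat.mul_le_mul (by omega) le_rfl
    omega
  · obtain ⟨t, ht, hexec⟩ := exec m 0 (by omega)
    -- The summand 3 in `work` is the exact cost of resetting the counter: one for each of the two
    -- constants and one for the assignment.
    refine ⟨_, ?_, Exec.seq (Exec.assign _ _ _ _) hexec⟩
    have h1 : (m + 1) * round * (b + W + 1) ≤ (L + 1) * round * (b + W + 1) :=
      Nat.mul_le_mul (Nat.mul_le_mul (by omega) le_rfl) le_rfl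
    have h2 : W * (b + W + 1) = 3 * (b + W + 1) + (L + 1) * round * (b + W + 1) := by
      rw [← Nat.add_mul, ← hW]
    simp only [Expr.cost, Expr.eval, Nat.size_zero]
    omega

/-- Execution and running time of a program whose loops have at most `L` rounds. -/
theorem exec_run (𝔅 : List ℕ) (L : ℕ) : ∀ (p : Prog), p.Valid → (∀ B ∈ p.boundArrays, B ∈ 𝔅) →
    (∀ B ∈ 𝔅, B ∉ p.writes) → ∀ (σ : Memory) (b : ℕ), (∀ B ∈ 𝔅, ∀ j, σ B j ≤ L) → σ.SizeLe b →
    (p.run σ).SizeLe (b + p.work L) ∧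
      ∃ t ≤ p.work L * (b + p.work L + 1), Exec p.toProgram σ (p.run σ) t := by
  intro p
  induction p with
  | assign A i e =>
    intro hv _ _ σ b _ hσ
    refine ⟨sizeLe_assign hσ A i hv, _, ?_, Exec.assign σ A i e⟩
    exact (cost_assign_le hσ i e).trans (Nat.mul_le_mul le_rfl (by omega))
  | seq p q ihp ihq =>
    intro hv h𝔅 hw σ b hL hσ
    simp only [boundArrays, writes, List.mem_append, not_or] at h𝔅 hw
    obtain ⟨h₁, t, ht, e₁⟩ := ihp hv.1 (fun B h => h𝔅 B (.inl h)) (fun B h => (hw B h).1) σ b hL hσ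
    -- The bound arrays survive `p`, so `L` still limits the loops of `q`, which starts with the
    -- lengths that `p` left behind.
    obtain ⟨h₂, t', ht', e₂⟩ := ihq hv.2 (fun B h => h𝔅 B (.inr h)) (fun B h => (hw B h).2)
      (p.run σ) _ (fun B h j => by rw [run_frame (hw B h).1]; exact hL B h j) h₁
    refine ⟨sizeLe_mono h₂ (by simp only [work]; omega), _, ?_, Exec.seq e₁ e₂⟩
    simp only [work]
    have h₃ : p.work L * (b + p.work L + 1) ≤ p.work L * (b + (p.work L + q.work L) + 1) :=
      Nat.mul_le_mul le_rfl (by omega)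
    rw [Nat.add_mul]
    have h₄ : b + p.work L + q.work L + 1 = b + (p.work L + q.work L) + 1 := by omega
    rw [h₄] at ht'
    omega
  | when e p ih =>
    intro hv h𝔅 hw σ b hL hσ
    obtain ⟨h₁, t, ht, e₁⟩ := ih hv h𝔅 hw σ b hL hσ
    have h₂ := cost_test_le hσ e
    have h₃ : testWork e * (b + 1) ≤ testWork e * (b + (testWork e + p.work L) + 1) :=
      Nat.mul_le_mul le_rfl (by omega)
    have h₄ : p.work L * (b + p.work L + 1) ≤ p.work L * (b + (testWork e + p.work L) + 1) :=
      Nat.mul_le_mul le_rfl (by omega)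
    by_cases h : e.eval σ = 0
    · simp only [run, h, if_true, work, toProgram, Nat.add_mul]
      refine ⟨sizeLe_mono hσ (by omega), _, ?_, Exec.ite_false h (Exec.skip σ)⟩
      omega
    · simp only [run, h, if_false, work, toProgram, Nat.add_mul]
      refine ⟨sizeLe_mono h₁ (by omega), _, ?_, Exec.ite_true h e₁⟩
      omega
  | loop A B e p ih =>
    intro hv h𝔅 hw σ b hL hσ
    obtain ⟨hp, hAp, hB, he⟩ := hv
    simp only [boundArrays, writes, List.mem_cons, not_or] at h𝔅 hw
    refine exec_loop (hL B (h𝔅 B (.inl rfl)) _) hAp hB he hσ fun k _ c hc =>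
      ih hp (fun D h => h𝔅 D (.inr h)) (fun D h => (hw D h).2) _ c (fun D h j => ?_) hc
    rw [iterateCounter_frame (hw D h).1 (run_frame (hw D h).2)]
    exact hL D h j

/-- The number of steps is polynomial in the number of rounds of the loops. -/
theorem exists_work_le : ∀ p : Prog, ∃ c, ∀ L, p.work L ≤ c * (L + 1) ^ c
  | assign _ i e => ⟨assignWork i e, fun L =>
      Nat.le_mul_of_pos_right _ (Nat.pow_pos (Nat.succ_pos L))⟩
  | seq p q => by
    obtain ⟨c, hc⟩ := exists_work_le p
    obtain ⟨d, hd⟩ := exists_work_le q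
    refine ⟨c + d, fun L => ?_⟩
    have h₁ : (L + 1) ^ c ≤ (L + 1) ^ (c + d) := Nat.pow_le_pow_right (Nat.succ_pos L) (by omega)
    have h₂ : (L + 1) ^ d ≤ (L + 1) ^ (c + d) := Nat.pow_le_pow_right (Nat.succ_pos L) (by omega)
    have := hc L
    have := hd L
    simp only [work]
    nlinarith [Nat.mul_le_mul (le_refl c) h₁, Nat.mul_le_mul (le_refl d) h₂]
  | when e p => by
    obtain ⟨c, hc⟩ := exists_work_le p
    refine ⟨testWork e + c, fun L => ?_⟩
    have h₁ : (L + 1) ^ c ≤ (L + 1) ^ (testWork e + c) :=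
      Nat.pow_le_pow_right (Nat.succ_pos L) (by omega)
    have h₂ : 1 ≤ (L + 1) ^ (testWork e + c) := Nat.pow_pos (Nat.succ_pos L)
    have := hc L
    simp only [work]
    nlinarith [Nat.mul_le_mul (le_refl c) h₁, Nat.mul_le_mul (le_refl (testWork e)) h₂]
  | .loop A B e p => by
    obtain ⟨c, hc⟩ := exists_work_le p
    set x := testWork (condition A B e) + assignWork (.const 0) (increment A)
    refine ⟨3 + x + c, fun L => ?_⟩
    have hx : (Prog.loop A B e p).work L = 3 + (L + 1) * (x + p.work L) := by
      simp only [work, x]; ring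
    have h₁ : (L + 1) ^ (c + 1) ≤ (L + 1) ^ (3 + x + c) :=
      Nat.pow_le_pow_right (Nat.succ_pos L) (by omega)
    have h₂ : (L + 1) ^ 1 ≤ (L + 1) ^ (3 + x + c) :=
      Nat.pow_le_pow_right (Nat.succ_pos L) (by omega)
    have h₃ : 1 ≤ (L + 1) ^ (3 + x + c) := Nat.pow_pos (Nat.succ_pos L)
    have h₄ : (L + 1) * p.work L ≤ c * (L + 1) ^ (3 + x + c) :=
      calc (L + 1) * p.work L ≤ (L + 1) * (c * (L + 1) ^ c) := Nat.mul_le_mul le_rfl (hc L)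
        _ = c * (L + 1) ^ (c + 1) := by ring
        _ ≤ _ := Nat.mul_le_mul le_rfl h₁
    have h₅ : (L + 1) * x ≤ x * (L + 1) ^ (3 + x + c) := by
      rw [mul_comm]; exact Nat.mul_le_mul le_rfl (by simpa using h₂)
    rw [hx, Nat.mul_add, Nat.add_mul (3 + x), Nat.add_mul 3 x]
    omega

end Prog

/-! ### Dynamic programming over a join tree -/

/-- The number whose binary digits below `n` are given by `f`. -/
def mask (f : ℕ → Bool) : ℕ → ℕ
  | 0 => 0
  | n + 1 => mask f n + if f n then 2 ^ n else 0

theorem mask_lt (f : ℕ → Bool) : ∀ n, mask f n < 2 ^ n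
  | 0 => by simp [mask]
  | n + 1 => by
    have := mask_lt f n
    simp only [mask, pow_succ]
    split_ifs <;> omega

theorem testBit_mask (f : ℕ → Bool) (n v : ℕ) :
    (mask f n).testBit v = (decide (v < n) && f v) := by
  induction n with
  | zero => simp [mask]
  | succ n ih =>
    have hlt := mask_lt f n
    rcases lt_trichotomy v n with h | rfl | h
    · have h1 : v < n + 1 := by omega
      simp only [mask]
      split_ifs
      · rw [add_comm, Nat.testBit_two_pow_add_gt h, ih]; simp [h, h1]
      · simp [ih, h, h1]
    · simp only [mask]
      split_ifs with hf
      · rw [add_comm, Nat.testBit_two_pow_add_eq, ih]; simp [hf]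
      · simp [ih, hf]
    · have h1 : ¬ v < n + 1 := by omega
      rw [Nat.testBit_lt_two_pow ((mask_lt f (n + 1)).trans_le
        (Nat.pow_le_pow_right (by norm_num) (by omega)))]
      simp [h1]

theorem eq_mask {m n : ℕ} (h : m < 2 ^ n) : m = mask m.testBit n := by
  refine Nat.eq_of_testBit_eq fun v => ?_
  rw [testBit_mask]
  by_cases hv : v < n
  · simp [hv]
  · have := Nat.testBit_lt_two_pow (h.trans_le (Nat.pow_le_pow_right (by norm_num) (not_lt.1 hv)))
    simp [hv, this]

theorem lt_two_pow_of_and_eq {m n x : ℕ} (hx : x < 2 ^ n) (h : m &&& x = m) : m < 2 ^ n :=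
  h ▸ Nat.and_lt_two_pow m hx

section JoinTree

variable (N : ℕ) (X par : ℕ → ℕ) (own val choice : ℕ → ℕ → ℕ)

/-- The cost of the assignment `A` to the bag `X i`, where `val j` describes the optimal costs
at the children `j` of `i`. -/
def joinCost (i A : ℕ) : ℕ :=
  own i A + ∑ j ∈ Finset.range N with par j = i, val j (A &&& X j)

/-- `val i K` is the optimal cost of an assignment to the bag `X i` that extends the assignment
`K` to the intersection with the parent bag, and `choice i K` is such an assignment. -/
structure IsOptimal (i : ℕ) : Prop where
  le : ∀ A, A &&& X i = A → val i (A &&& X (par i)) ≤ joinCost N X par own val i A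
  sub : ∀ A, A &&& X i = A →
    choice i (A &&& X (par i)) &&& X i = choice i (A &&& X (par i))
  agree : ∀ A, A &&& X i = A → choice i (A &&& X (par i)) &&& X (par i) = A &&& X (par i)
  eq : ∀ A, A &&& X i = A →
    val i (A &&& X (par i)) = joinCost N X par own val i (choice i (A &&& X (par i)))

/-- The assignment obtained from the choices, from the root to the leaves. -/
def assemble : ℕ → ℕ
  | 0 => 0
  | k + 1 => assemble k ||| choice k (assemble k &&& X k)

/-- The bags form a join tree in which parents precede their children; the parent of the root
`0` is a dummy node `N` with an empty bag. -/
structure IsJoinTree : Prop where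
  pos : 0 < N
  par_zero : par 0 = N
  par_lt : ∀ i, 0 < i → i < N → par i < i
  dummy : X N = 0
  running : ∀ i < N, ∀ j < i, ∀ v, (X i).testBit v → (X j).testBit v → (X (par i)).testBit v

variable {N X par own val choice}

/-- Each table entry is read exactly once, at the parent, except that of the root. Up to the entry
of the root, the sum of the costs is thus the sum of the own costs plus the sum of all table
entries. -/
theorem sum_joinCost (hT : IsJoinTree N X par) (hown : ∀ i S, own i (S &&& X i) = own i S)
    (S : ℕ) :
    ∑ i ∈ Finset.range N, joinCost N X par own val i (S &&& X i) + val 0 0 =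
      ∑ i ∈ Finset.range N, own i S +
        ∑ i ∈ Finset.range N, val i (S &&& X i &&& X (par i)) := by
  have h1 : ∑ i ∈ Finset.range N, ∑ j ∈ Finset.range N with par j = i,
      val j (S &&& X i &&& X j) + val 0 0 =
      ∑ j ∈ Finset.range N, val j (S &&& X j &&& X (par j)) := by
    simp only [Finset.sum_filter]
    rw [Finset.sum_comm]
    simp only [Finset.sum_ite_eq, Finset.mem_range]
    -- Split off the root. Its parent `N` is outside the range, so nobody reads its table; the term
    -- `val 0 0` compensates for this, since the dummy bag is empty.
    obtain ⟨m, rfl⟩ := Nat.exists_eq_succ_of_ne_zero hT.pos.ne'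
    rw [Finset.sum_range_succ', Finset.sum_range_succ', hT.par_zero, hT.dummy]
    simp only [lt_irrefl, if_false, add_zero, Nat.and_zero]
    congr 1
    refine Finset.sum_congr rfl fun j hj => ?_
    have hj' : j + 1 < m + 1 := by simpa using hj
    rw [if_pos ((hT.par_lt _ (Nat.succ_pos j) hj').trans hj')]
    congr 1
    rw [Nat.and_assoc, Nat.and_assoc, Nat.and_comm (X (par (j + 1)))]
  simp only [joinCost, Finset.sum_add_distrib, hown]
  rw [add_assoc, h1]

/-- Restrict `S` to all bags and add up the inequalities of local optimality; after telescoping only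
the entry of the root remains on the left. -/
theorem val_root_le (hT : IsJoinTree N X par) (hown : ∀ i S, own i (S &&& X i) = own i S)
    (hopt : ∀ i < N, IsOptimal N X par own val choice i) (S : ℕ) :
    val 0 0 ≤ ∑ i ∈ Finset.range N, own i S := by
  have h1 := sum_joinCost (val := val) hT hown S
  have h2 : ∑ i ∈ Finset.range N, val i (S &&& X i &&& X (par i)) ≤
      ∑ i ∈ Finset.range N, joinCost N X par own val i (S &&& X i) :=
    Finset.sum_le_sum fun i hi => (hopt i (Finset.mem_range.1 hi)).le _
      (by rw [Nat.and_assoc, Nat.and_self])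
  omega

theorem testBit_of_and_eq {a b v : ℕ} (h : a &&& b = a) (ha : a.testBit v) : b.testBit v := by
  rw [← h, Nat.testBit_and, Bool.and_eq_true] at ha
  exact ha.2

/-- The choices are consistent: the union, restricted to any bag already treated, is the choice made
there. Each new choice agrees with the earlier ones on the parent bag, and the running intersection
property excludes other overlaps. -/
theorem assemble_spec (hT : IsJoinTree N X par)
    (hopt : ∀ i < N, IsOptimal N X par own val choice i) :
    ∀ k ≤ N, (∀ v, (assemble X choice k).testBit v → ∃ j < k, (X j).testBit v) ∧
      ∀ i < k, assemble X choice k &&& X i = choice i (assemble X choice i &&& X i) ∧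
        choice i (assemble X choice i &&& X i) &&& X (par i) = assemble X choice i &&& X i := by
  intro k
  induction k with
  | zero => intro _; exact ⟨by simp [assemble], by simp⟩
  | succ k ih =>
    intro hk
    obtain ⟨hsupp, hrec⟩ := ih (by omega)
    set R := assemble X choice k with hR
    -- A vertex of `R` in `X k` lies in an earlier bag too, hence in the parent bag. So `R &&& X k`
    -- is a legitimate key for the table of `k`.
    have hK : R &&& X k &&& X (par k) = R &&& X k := by
      refine Nat.eq_of_testBit_eq fun v => ?_
      by_cases h1 : R.testBit v <;> by_cases h2 : (X k).testBit v <;> simp [h1, h2]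
      obtain ⟨j, hj, hjv⟩ := hsupp v h1
      exact hT.running k (by omega) j hj v h2 hjv
    have ho := hopt k (by omega)
    have hKX : R &&& X k &&& X k = R &&& X k := by rw [Nat.and_assoc, Nat.and_self]
    have hsub := ho.sub _ hKX
    have hagree := ho.agree _ hKX
    rw [hK] at hsub hagree
    set c := choice k (R &&& X k) with hc
    have hnext : assemble X choice (k + 1) = R ||| c := rfl
    rw [hnext]
    refine ⟨fun v hv => ?_, fun i hi => ?_⟩
    · rw [Nat.testBit_or, Bool.or_eq_true] at hv
      rcases hv with hv | hv
      · obtain ⟨j, hj, hjv⟩ := hsupp v hv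
        exact ⟨j, by omega, hjv⟩
      · exact ⟨k, by omega, testBit_of_and_eq hsub hv⟩
    · rcases Nat.lt_succ_iff_lt_or_eq.1 hi with hi | rfl
      · refine ⟨?_, (hrec i hi).2⟩
        rw [← (hrec i hi).1]
        refine Nat.eq_of_testBit_eq fun v => ?_
        by_cases h1 : (X i).testBit v <;> by_cases h2 : c.testBit v <;> simp [h1, h2]
        -- A vertex of the new choice that lies in an earlier bag lies in the parent bag, where the
        -- choice agrees with `R`; the earlier bag therefore sees nothing new.
        have h3 := hT.running k (by omega) i hi v (testBit_of_and_eq hsub h2) h1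
        have h4 := congrArg (·.testBit v) hagree
        simp [h2, h3] at h4
        exact h4.1
      · rw [← hR, ← hc]
        -- On the new bag, `R` contributes nothing beyond `c`, by `hagree`, and `c` is contained in
        -- the bag.
        refine ⟨?_, hagree⟩
        refine Nat.eq_of_testBit_eq fun v => ?_
        have h1 := congrArg (·.testBit v) hagree
        have h2 := congrArg (·.testBit v) hsub
        simp only [Nat.testBit_and, Nat.testBit_or] at h1 h2 ⊢
        revert h1 h2
        cases R.testBit v <;> cases (X i).testBit v <;> cases c.testBit v <;>
          cases (X (par i)).testBit v <;> decide

/-- The assembled assignment has minimum total cost. -/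
theorem assemble_optimal (hT : IsJoinTree N X par) (hown : ∀ i S, own i (S &&& X i) = own i S)
    (hopt : ∀ i < N, IsOptimal N X par own val choice i) (S : ℕ) :
    ∑ i ∈ Finset.range N, own i (assemble X choice N) ≤ ∑ i ∈ Finset.range N, own i S := by
  refine le_trans (le_of_eq ?_) (val_root_le hT hown hopt S)
  set R := assemble X choice N
  have h1 := sum_joinCost (val := val) hT hown R
  -- For the assembled assignment all inequalities used in `val_root_le` are equalities.
  have h2 : ∑ i ∈ Finset.range N, val i (R &&& X i &&& X (par i)) =
      ∑ i ∈ Finset.range N, joinCost N X par own val i (R &&& X i) := by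
    refine Finset.sum_congr rfl fun i hi => ?_
    have hi := Finset.mem_range.1 hi
    obtain ⟨h3, h4⟩ := (assemble_spec hT hopt N le_rfl).2 i hi
    have h5 := (hopt i hi).eq (R &&& X i) (by rw [Nat.and_assoc, Nat.and_self])
    rw [h5]
    congr 1
    rw [h3, h4]
  omega

end JoinTree

/-! ### Orderings of the nodes of a tree -/

/-- In an ordering of a tree in which every node is adjacent to an earlier one, a connected set
that contains a node and an earlier one contains the parent of the node. -/
theorem parent_mem_of_preconnected {N : ℕ} {T : SimpleGraph (Fin N)} (hT : T.IsAcyclic)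
    {C : Set (Fin N)} (hC : (T.induce C).Preconnected) {ord : ℕ → Fin N} {par : ℕ → ℕ}
    (hord : ∀ i < N, ∀ j < N, ord i = ord j → i = j)
    (hpar : ∀ i, 0 < i → i < N → par i < i ∧ T.Adj (ord (par i)) (ord i))
    {i j : ℕ} (hi : i < N) (hj : j < i) (hiC : ord i ∈ C) (hjC : ord j ∈ C) :
    ord (par i) ∈ C := by
  by_contra hp
  obtain ⟨hlt, hadj⟩ := hpar i (by omega) hi
  have hbridge := (SimpleGraph.isAcyclic_iff_forall_adj_isBridge.1 hT) hadj
  rw [SimpleGraph.isBridge_iff] at hbridge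
  set T' := T.deleteEdges {s(ord (par i), ord i)} with hT'
  -- After deletion of the edge from `i` to its parent, the earlier nodes still reach the root along
  -- parents, because those steps do not involve `i`.
  have hroot : ∀ k < i, T'.Reachable (ord k) (ord 0) := by
    intro k
    induction k using Nat.strong_induction_on with
    | _ k ih =>
      intro hk
      rcases Nat.eq_zero_or_pos k with rfl | hk0
      · exact SimpleGraph.Reachable.refl _
      · obtain ⟨h1, h2⟩ := hpar k hk0 (by omega)
        refine SimpleGraph.Reachable.trans (SimpleGraph.Adj.reachable ?_) (ih _ h1 (by omega))
        rw [hT', SimpleGraph.deleteEdges_adj]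
        refine ⟨h2.symm, fun h => ?_⟩
        rw [Set.mem_singleton_iff, Sym2.eq_iff] at h
        rcases h with ⟨_, h⟩ | ⟨h, _⟩
        · have := hord _ (by omega) _ hi h; omega
        · have := hord _ (by omega) _ hi h; omega
  -- If the parent is outside `C`, paths within `C` avoid the deleted edge. Then `i` reaches `j`,
  -- the root and its own parent without this edge, although an edge of an acyclic graph is a
  -- bridge.
  let f : T.induce C →g T' :=
    { toFun := Subtype.val
      map_rel' := by
        rintro ⟨a, ha⟩ ⟨b, hb⟩ h
        rw [hT', SimpleGraph.deleteEdges_adj]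
        refine ⟨h, fun h => ?_⟩
        rw [Set.mem_singleton_iff, Sym2.eq_iff] at h
        rcases h with ⟨h, _⟩ | ⟨_, h⟩
        · exact hp (h ▸ ha)
        · exact hp (h ▸ hb) }
  have h1 : T'.Reachable (ord i) (ord j) := (hC ⟨_, hiC⟩ ⟨_, hjC⟩).map f
  exact hbridge (((hroot _ hlt).trans (hroot _ hj).symm).trans h1.symm)

/-- The nodes whose bags meet the closed neighbourhood of a vertex form a subtree. -/
theorem preconnected_closedNeighbourhood {n : ℕ} {G : SimpleGraph (Fin n)}
    (D : TreeDecomposition G) (v : Fin n) :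
    (D.tree.induce {t | ∃ u, (u = v ∨ G.Adj u v) ∧ u ∈ D.bag t}).Preconnected := by
  set C := {t | ∃ u, (u = v ∨ G.Adj u v) ∧ u ∈ D.bag t}
  have hsub : ∀ u, (u = v ∨ G.Adj u v) → {t | u ∈ D.bag t} ≤ C := fun u hu t ht => ⟨u, hu, ht⟩
  have hreach : ∀ u (hu : u = v ∨ G.Adj u v) s t (hs : u ∈ D.bag s) (ht : u ∈ D.bag t),
      (D.tree.induce C).Reachable ⟨s, u, hu, hs⟩ ⟨t, u, hu, ht⟩ := fun u hu s t hs ht =>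
    ((D.connected u).preconnected ⟨s, hs⟩ ⟨t, ht⟩).map
      (SimpleGraph.induceHomOfLE D.tree (hsub u hu)).toHom
  -- The subtree of a neighbour `u` contains a node whose bag covers the edge `uv`, so every node of
  -- the set is joined within it to the subtree of `v`.
  have hv : ∀ s : C, ∃ t, ∃ ht : v ∈ D.bag t,
      (D.tree.induce C).Reachable s ⟨t, v, .inl rfl, ht⟩ := by
    rintro ⟨s, u, hu, hs⟩
    obtain ⟨t, hut, hvt⟩ : ∃ t, u ∈ D.bag t ∧ v ∈ D.bag t := by
      rcases hu with rfl | hu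
      · exact ⟨s, hs, hs⟩
      · exact D.edge_mem u v hu
    exact ⟨t, hvt, hreach u hu s t hs hut⟩
  intro s t
  obtain ⟨s', hs', h1⟩ := hv s
  obtain ⟨t', ht', h2⟩ := hv t
  exact (h1.trans (hreach v (.inl rfl) s' t' hs' ht')).trans h2.symm

/-! ### Stable cuts as minimizers of a sum of local costs -/

namespace Instance

variable (I : Instance)

theorem wt_self (v : Fin I.n) : I.wt v v = 0 := by simp [wt]

theorem wt_comm (u v : Fin I.n) : I.wt u v = I.wt v u := by
  by_cases h : I.graph.Adj u v
  · rw [wt, wt, if_pos h, if_pos h.symm, Sym2.eq_swap]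
  · rw [wt, wt, if_neg h, if_neg fun h' => h h'.symm]

theorem crossingWeight_eq (S : Finset (Fin I.n)) (v : Fin I.n) :
    I.crossingWeight S v = ∑ u, if (u ∈ S ↔ v ∈ S) then 0 else I.wt v u := by
  rw [crossingWeight, Finset.sum_filter]
  exact Finset.sum_congr rfl fun u _ => by split_ifs <;> simp_all

theorem crossingWeight_le (S : Finset (Fin I.n)) (v : Fin I.n) :
    I.crossingWeight S v ≤ I.weightedDegree v :=
  Finset.sum_le_sum_of_subset (Finset.filter_subset _ _)

/-- Every cut edge is counted at both of its endpoints, one in `S` and one in the complement. -/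
theorem sum_crossingWeight (S : Finset (Fin I.n)) :
    ∑ v, I.crossingWeight S v = 2 * I.cutWeight S := by
  have h : ∀ v, I.crossingWeight S v =
      if v ∈ S then ∑ u ∈ Sᶜ, I.wt v u else ∑ u ∈ S, I.wt u v := by
    intro v
    rw [crossingWeight]
    split_ifs with hv
    · exact Finset.sum_congr (by ext u; simp [hv]) fun _ _ => rfl
    · exact Finset.sum_congr (by ext u; simp [hv]) fun u _ => I.wt_comm v u
  have hc : ∑ v ∈ Sᶜ, I.crossingWeight S v = I.cutWeight S := by
    rw [cutWeight, Finset.sum_comm]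
    exact Finset.sum_congr rfl fun v hv => by rw [h, if_neg (Finset.mem_compl.1 hv)]
  have hs : ∑ v ∈ S, I.crossingWeight S v = I.cutWeight S :=
    Finset.sum_congr rfl fun v hv => by rw [h, if_pos hv]
  rw [← Finset.sum_add_sum_compl S, hc, hs, two_mul]

/-- Moving a vertex to the other side. -/
theorem sum_crossingWeight_symmDiff (S : Finset (Fin I.n)) (x : Fin I.n) :
    ∑ v, I.crossingWeight (symmDiff S {x}) v + 4 * I.crossingWeight S x =
      ∑ v, I.crossingWeight S v + 2 * I.weightedDegree x := by
  set S' := symmDiff S {x} with hS'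
  have mem : ∀ v, v ≠ x → (v ∈ S' ↔ v ∈ S) := fun v hv => by
    simp [hS', Finset.mem_symmDiff, hv]
  have memx : x ∈ S' ↔ x ∉ S := by simp [hS', Finset.mem_symmDiff]
  -- After the move, exactly the edges at `x` that did not cross before are crossing.
  have hx : I.crossingWeight S' x + I.crossingWeight S x = I.weightedDegree x := by
    rw [crossingWeight_eq, crossingWeight_eq, weightedDegree, ← Finset.sum_add_distrib]
    refine Finset.sum_congr rfl fun u _ => ?_
    by_cases hu : u = x
    · subst hu; simp [wt_self]
    · simp only [mem u hu, memx]
      by_cases h1 : u ∈ S <;> by_cases h2 : x ∈ S <;> simp [h1, h2]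
  have hv : ∀ v, v ≠ x → I.crossingWeight S' v + (if (x ∈ S ↔ v ∈ S) then 0 else I.wt v x) =
      I.crossingWeight S v + (if (x ∈ S' ↔ v ∈ S') then 0 else I.wt v x) := by
    intro v hv
    rw [crossingWeight_eq, crossingWeight_eq, ← Finset.add_sum_erase _ _ (Finset.mem_univ x),
      ← Finset.add_sum_erase (a := x) Finset.univ
        (fun u => if (u ∈ S ↔ v ∈ S) then 0 else I.wt v u) (Finset.mem_univ x)]
    have : ∑ u ∈ Finset.univ.erase x, (if (u ∈ S' ↔ v ∈ S') then 0 else I.wt v u) =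
        ∑ u ∈ Finset.univ.erase x, if (u ∈ S ↔ v ∈ S) then 0 else I.wt v u :=
      Finset.sum_congr rfl fun u hu => by
        simp only [mem u (Finset.ne_of_mem_erase hu), mem v hv]
    rw [this]
    ring
  -- By symmetry of the weights, the terms of the other vertices for their edges to `x` add up to
  -- the crossing weight at `x`. The move thus changes the total by twice the change at `x`.
  have hcol : ∀ R : Finset (Fin I.n), ∑ v ∈ Finset.univ.erase x,
      (if (x ∈ R ↔ v ∈ R) then 0 else I.wt v x) = I.crossingWeight R x := by
    intro R
    rw [crossingWeight_eq, ← Finset.add_sum_erase _ _ (Finset.mem_univ x)]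
    simp only [wt_self, ite_self, zero_add]
    exact Finset.sum_congr rfl fun v _ => by rw [I.wt_comm v x]; simp only [iff_comm]
  have hsum : ∑ v ∈ Finset.univ.erase x, I.crossingWeight S' v + I.crossingWeight S x =
      ∑ v ∈ Finset.univ.erase x, I.crossingWeight S v + I.crossingWeight S' x := by
    rw [← hcol S, ← hcol S', ← Finset.sum_add_distrib, ← Finset.sum_add_distrib]
    exact Finset.sum_congr rfl fun v h => hv v (Finset.ne_of_mem_erase h)
  rw [← Finset.add_sum_erase _ (I.crossingWeight S') (Finset.mem_univ x),
    ← Finset.add_sum_erase _ (I.crossingWeight S) (Finset.mem_univ x)]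
  omega

/-- A maximum cut is stable. -/
theorem exists_isStable : ∃ S, I.IsStable S := by
  obtain ⟨S, _, hS⟩ := Finset.exists_max_image Finset.univ
    (fun S : Finset (Fin I.n) => ∑ v, I.crossingWeight S v) Finset.univ_nonempty
  refine ⟨S, fun x => ?_⟩
  -- Maximality in the identity for the move gives 2d ≤ 4c, for the weighted degree d and the
  -- crossing weight c at `x`.
  have h1 := hS (symmDiff S {x}) (Finset.mem_univ _)
  have h2 := I.sum_crossingWeight_symmDiff S x
  omega

/-- The weight of the cut edges at `v`, plus a penalty `M` if `v` violates stability. -/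
noncomputable def localCost (M : ℕ) (S : Finset (Fin I.n)) (v : Fin I.n) : ℕ :=
  I.crossingWeight S v + if 2 * I.crossingWeight S v < I.weightedDegree v then M else 0

theorem isMinStableCut_of_localCost {M : ℕ} (hM : ∑ v, I.weightedDegree v < M)
    {S : Finset (Fin I.n)} (h : ∀ S', ∑ v, I.localCost M S v ≤ ∑ v, I.localCost M S' v) :
    I.IsMinStableCut S := by
  have hstable : ∀ S', I.IsStable S' → ∑ v, I.localCost M S' v = 2 * I.cutWeight S' := by
    intro S' hS'
    rw [← sum_crossingWeight]
    exact Finset.sum_congr rfl fun v _ => by rw [localCost, if_neg (not_lt.2 (hS' v)), add_zero]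
  have hS : I.IsStable S := by
    obtain ⟨S', hS'⟩ := I.exists_isStable
    intro v
    -- One violated vertex already costs `M`, which exceeds the total cost of any stable cut, and a
    -- stable cut exists.
    by_contra hv
    have h1 := h S'
    rw [hstable S' hS', ← sum_crossingWeight] at h1
    have h2 : ∑ v, I.crossingWeight S' v ≤ ∑ v, I.weightedDegree v :=
      Finset.sum_le_sum fun v _ => I.crossingWeight_le S' v
    have h3 : I.localCost M S v ≤ ∑ v, I.localCost M S v :=
      Finset.single_le_sum (f := I.localCost M S) (fun _ _ => Nat.zero_le _) (Finset.mem_univ v)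
    have h4 : M ≤ I.localCost M S v := by
      rw [localCost, if_pos (not_le.1 hv)]; omega
    omega
  refine ⟨hS, fun S' hS' => ?_⟩
  have := h S'
  rw [hstable S hS, hstable S' hS'] at this
  omega

end Instance

/-! ### The program -/

namespace Expr

instance (k : ℕ) : OfNat Expr k := ⟨.const k⟩
instance : Add Expr := ⟨.op .add⟩
instance : Sub Expr := ⟨.op .sub⟩
instance : Mul Expr := ⟨.op .mul⟩
instance : Div Expr := ⟨.op .div⟩

/-- The comparison `e < f`. -/
def isLt (e f : Expr) : Expr := .op .lt e f

/-- The comparison `e = f`. -/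
def isEq (e f : Expr) : Expr := .op .eq e f

/-- The scalar variable stored in cell `0` of an array. -/
def var (A : ℕ) : Expr := .read A 0

@[simp] theorem eval_zero (σ : Memory) : (0 : Expr).eval σ = 0 := rfl
@[simp] theorem eval_one (σ : Memory) : (1 : Expr).eval σ = 1 := rfl
@[simp] theorem eval_two (σ : Memory) : (2 : Expr).eval σ = 2 := rfl
@[simp] theorem eval_add (σ : Memory) (e f : Expr) : (e + f).eval σ = e.eval σ + f.eval σ := rfl
@[simp] theorem eval_sub (σ : Memory) (e f : Expr) : (e - f).eval σ = e.eval σ - f.eval σ := rfl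
@[simp] theorem eval_mul (σ : Memory) (e f : Expr) : (e * f).eval σ = e.eval σ * f.eval σ := rfl
@[simp] theorem eval_div (σ : Memory) (e f : Expr) : (e / f).eval σ = e.eval σ / f.eval σ := rfl
@[simp] theorem eval_var (σ : Memory) (A : ℕ) : (var A).eval σ = σ A 0 := rfl
@[simp] theorem eval_read (σ : Memory) (A : ℕ) (e : Expr) :
    (read A e).eval σ = σ A (e.eval σ) := rfl
@[simp] theorem eval_isLt (σ : Memory) (e f : Expr) :
    (isLt e f).eval σ = if e.eval σ < f.eval σ then 1 else 0 := rfl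
@[simp] theorem eval_isEq (σ : Memory) (e f : Expr) :
    (isEq e f).eval σ = if e.eval σ = f.eval σ then 1 else 0 := rfl

end Expr

open MinStableCut.Expr (var isLt isEq)

infixr:60 " ;; " => Prog.seq

/-! The arrays of the program: input and output, results of the preparation and tables, loop
counters, and scalar variables. -/

notation "inSize" => 0
notation "inAdj" => 1
notation "inWt" => 2
notation "inTree" => 3
notation "inBag" => 4
notation "outSide" => 5
notation "arrPow" => 6
notation "arrMem" => 7
notation "arrOrd" => 8
notation "arrPos" => 9
notation "arrPar" => 10
notation "arrVis" => 11
notation "arrOwn" => 12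
notation "arrPen" => 13
notation "arrEdge" => 14
notation "arrCount" => 15
notation "arrVal" => 16
notation "arrChoice" => 17
notation "cntI" => 20
notation "cntA" => 21
notation "cntV" => 22
notation "cntU" => 23
notation "cntJ" => 24
notation "varI" => 30
notation "varA" => 31
notation "varB" => 32
notation "varVal" => 33
notation "varC" => 34
notation "varD" => 35
notation "varKey" => 36
notation "varS" => 37
notation "varT" => 38

namespace Prog

/-- Number of vertices. -/
def sizeV : Expr := .read inSize 0

/-- Number of nodes of the tree. -/
def sizeT : Expr := .read inSize 1

/-- The loop over all vertices. -/
def forV (C : ℕ) (p : Prog) : Prog := .loop C inSize 0 p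

/-- The loop over all nodes of the tree. -/
def forT (C : ℕ) (p : Prog) : Prog := .loop C inSize 1 p

/-- The binary digit `v` of `m`. -/
def digit (m v : Expr) : Expr :=
  m / .read arrPow v - 2 * (m / .read arrPow v / 2)

/-- `arrPow[v] := 2 ^ v`. -/
def powers : Prog :=
  .assign arrPow 0 1 ;;
  forV cntV (.assign arrPow (var cntV + 1) (.read arrPow (var cntV) + .read arrPow (var cntV)))

/-- `arrPen` exceeds the sum of all weighted degrees; `arrEdge` is nonzero if there are
edges. -/
def penalty : Prog :=
  .assign arrPen 0 1 ;;
  forV cntU (forV cntV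
    (.assign arrPen 0 (var arrPen + .read inWt (var cntU * sizeV + var cntV)) ;;
      .assign arrEdge 0 (var arrEdge + .read inAdj (var cntU * sizeV + var cntV))))

/-- The edge of the tree from `cntU` to `cntV` leaves the set of visited nodes. In the first
round every pair is accepted. -/
def leaving : Expr :=
  (1 - .read arrVis (var cntV)) * (isEq (var cntI) 0 +
    .read arrVis (var cntU) * .read inTree (var cntU * sizeT + var cntV))

/-- Finds an edge from `varS` to `varT` that leaves the set of visited nodes. -/
def search : Prog :=
  forT cntU (forT cntV (.when leaving
    (.assign varS 0 (var cntU) ;; .assign varT 0 (var cntV))))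

/-- Numbers the nodes of the tree such that the parent of a node precedes it. -/
def order : Prog :=
  forT cntI (search ;;
    .assign arrOrd (var cntI) (var varT) ;;
    .assign arrPar (var cntI) (.read arrPos (var varS)) ;;
    .assign arrPos (var varT) (var cntI) ;;
    .assign arrVis (var varT) 1) ;;
  .assign arrPar 0 sizeT

/-- Incidence matrix of the closed neighbourhoods of the bags. -/
def closedBags : Prog :=
  forT cntI (forV cntU (forV cntV
    (.when (.read inBag (.read arrOrd (var cntI) * sizeV + var cntU) *
        (.read inAdj (var cntU * sizeV + var cntV) + isEq (var cntU) (var cntV)))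
      (.assign arrMem (var cntI * sizeV + var cntV) 1))))

/-- For each vertex a node whose bag contains it. -/
def owners : Prog :=
  forT cntI (forV cntV
    (.when (.read inBag (.read arrOrd (var cntI) * sizeV + var cntV))
      (.assign arrOwn (var cntV) (var cntI))))

/-- For each node the number of assignments to the closed neighbourhood of its bag. -/
def counts : Prog :=
  forT cntI (.assign arrCount (var cntI) 1 ;;
    forV cntV (.when (.read arrMem (var cntI * sizeV + var cntV))
      (.assign arrCount (var cntI)
        (.read arrCount (var cntI) + .read arrCount (var cntI)))))

/-- The part of the algorithm that prepares the dynamic programming. -/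
def prepare : Prog :=
  powers ;; penalty ;; order ;; closedBags ;; owners ;; counts

/-- `varKey` becomes the set of all vertices `cntV` that satisfy `c`. -/
def collect (c : Expr) : Prog :=
  .assign varKey 0 0 ;;
  forV cntV (.when c (.assign varKey 0 (var varKey + .read arrPow (var cntV))))

/-- The condition `cntV ∈ varA ∩ bag p`. -/
def inBagOf (p : Expr) : Expr :=
  digit (var varA) (var cntV) * .read arrMem (p * sizeV + var cntV)

/-- Distributes the digits of `cntA` over the bag `varI`. -/
def decode : Prog :=
  .assign varA 0 0 ;; .assign varB 0 (var cntA) ;;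
  forV cntV (.when (.read arrMem (var varI * sizeV + var cntV))
    (.when (var varB - 2 * (var varB / 2))
        (.assign varA 0 (var varA + .read arrPow (var cntV))) ;;
      .assign varB 0 (var varB / 2)))

/-- The weight of the edges at `cntV` that cross the cut, and of all edges at `cntV`. -/
def crossing : Prog :=
  .assign varC 0 0 ;; .assign varD 0 0 ;;
  forV cntU (.assign varD 0 (var varD + .read inWt (var cntV * sizeV + var cntU)) ;;
    .when (1 - isEq (digit (var varA) (var cntU)) (digit (var varA) (var cntV)))
      (.assign varC 0 (var varC + .read inWt (var cntV * sizeV + var cntU))))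

/-- The costs of the assignment `varA` at the vertices that belong to the node `varI`. -/
def ownCost : Prog :=
  .assign varVal 0 1 ;;
  forV cntV (.when (isEq (.read arrOwn (var cntV)) (var varI))
    (crossing ;; .assign varVal 0 (var varVal + var varC) ;;
      .when (isLt (var varC + var varC) (var varD))
        (.assign varVal 0 (var varVal + var arrPen))))

/-- Adds the costs at the children of the node `varI`. -/
def childCost : Prog :=
  forT cntJ (.when (isEq (.read arrPar (var cntJ)) (var varI))
    (collect (inBagOf (var cntJ)) ;;
      .assign varVal 0 (var varVal + .read arrVal (var varKey * sizeT + var cntJ))))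

/-- Updates the table of the node `varI`. -/
def update : Prog :=
  collect (inBagOf (.read arrPar (var varI))) ;;
  .when (isEq (.read arrVal (var varKey * sizeT + var varI)) 0 +
      isLt (var varVal) (.read arrVal (var varKey * sizeT + var varI)))
    (.assign arrVal (var varKey * sizeT + var varI) (var varVal) ;;
      .assign arrChoice (var varKey * sizeT + var varI) (var varA))

/-- Computes the table of the node `varI`. -/
def table : Prog :=
  .loop cntA arrCount (var varI) (decode ;; ownCost ;; childCost ;; update)

/-- Computes all tables, from the leaves to the root. -/
def tables : Prog :=
  forT cntI (.assign varI 0 (sizeT - 1 - var cntI) ;; table)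

/-- Assembles the solution from the root to the leaves. -/
def output : Prog :=
  forT cntI
    (collect (.read outSide (var cntV) * .read arrMem (var cntI * sizeV + var cntV)) ;;
      forV cntV (.when (digit (.read arrChoice (var varKey * sizeT + var cntI)) (var cntV))
        (.assign outSide (var cntV) 1)))

/-- The dynamic programming. -/
def solve : Prog :=
  tables ;; output

theorem valid_prepare : prepare.Valid := by decide

theorem valid_solve : solve.Valid := by decide

/-! ### Correctness of the preparation -/

@[simp] theorem write_apply (σ : Memory) (A i x D j : ℕ) :
    σ.write A i x D j = if D = A ∧ j = i then x else σ D j := rfl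

@[simp] theorem run_assign_apply (A : ℕ) (i e : Expr) (σ : Memory) (D j : ℕ) :
    (Prog.assign A i e).run σ D j = if D = A ∧ j = i.eval σ then e.eval σ else σ D j := rfl

@[simp] theorem run_seq (p q : Prog) (σ : Memory) : (p ;; q).run σ = q.run (p.run σ) := rfl

@[simp] theorem run_when_apply (e : Expr) (p : Prog) (σ : Memory) (D j : ℕ) :
    (Prog.when e p).run σ D j = if e.eval σ = 0 then σ D j else p.run σ D j := by
  rw [run]; split_ifs <;> rfl

@[simp] theorem eval_sizeV (σ : Memory) : sizeV.eval σ = σ inSize 0 := rfl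
@[simp] theorem eval_sizeT (σ : Memory) : sizeT.eval σ = σ inSize 1 := rfl

/-- `run_loop` for a quantity that grows in each round. -/
theorem run_loop_sum {C B R : ℕ} {e : Expr} {p : Prog} {σ : Memory} (f : ℕ → ℕ) (hR : R ≠ C)
    (h : ∀ k < σ B (e.eval σ), ∀ τ : Memory, τ C 0 = k →
      (∀ D, D ∉ C :: p.writes → τ D = σ D) → p.run τ R 0 = τ R 0 + f k) :
    (Prog.loop C B e p).run σ R 0 = σ R 0 + ∑ k ∈ Finset.range (σ B (e.eval σ)), f k := by
  refine run_loop (Inv := fun m τ => τ R 0 = σ R 0 + ∑ k ∈ Finset.range m, f k) ?_ ?_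
  · simp [hR]
  · intro k hk τ hτ hframe ih
    rw [write_of_ne hR, h k hk τ hτ hframe, ih, Finset.sum_range_succ, add_assoc]

/-- `run_loop` for a property that is established in some round and then persists. -/
theorem run_loop_attain {C B : ℕ} {e : Expr} {p : Prog} {σ : Memory} (P : Memory → Prop)
    (Q : ℕ → Prop) (hP : ∀ τ k, P τ → P (Memory.write τ C 0 k))
    (h : ∀ k < σ B (e.eval σ), ∀ τ : Memory, τ C 0 = k →
      (∀ D, D ∉ C :: p.writes → τ D = σ D) → P τ ∨ Q k → P (p.run τ))
    (hQ : P σ ∨ ∃ k < σ B (e.eval σ), Q k) : P ((Prog.loop C B e p).run σ) := by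
  have := run_loop (A := C) (B := B) (e := e) (p := p) (σ := σ)
    (Inv := fun m τ => (P σ ∨ ∃ k < m, Q k) → P τ) ?_ ?_
  · exact this hQ
  · rintro (h | ⟨k, hk, _⟩)
    · exact hP _ _ h
    · omega
  · rintro k hk τ hτ hframe ih hPQ
    refine hP _ _ (h k hk τ hτ hframe ?_)
    rcases hPQ with h | ⟨j, hj, hQj⟩
    · exact .inl (ih (.inl h))
    · rcases Nat.lt_succ_iff_lt_or_eq.1 hj with hj | rfl
      · exact .inl (ih (.inr ⟨j, hj, hQj⟩))
      · exact .inr hQj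

/-- `run_loop` for a cell that is marked in some round. -/
theorem run_loop_mark {C B R a : ℕ} {e : Expr} {p : Prog} {σ : Memory} (Q : ℕ → Prop)
    (hR : R ≠ C) (h : ∀ k < σ B (e.eval σ), ∀ τ : Memory, τ C 0 = k →
      (∀ D, D ∉ C :: p.writes → τ D = σ D) → (p.run τ R a ≠ 0 ↔ τ R a ≠ 0 ∨ Q k)) :
    (Prog.loop C B e p).run σ R a ≠ 0 ↔ σ R a ≠ 0 ∨ ∃ k < σ B (e.eval σ), Q k := by
  refine run_loop (Inv := fun m τ => τ R a ≠ 0 ↔ σ R a ≠ 0 ∨ ∃ k < m, Q k) ?_ ?_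
  · simp [hR]
  · intro k hk τ hτ hframe ih
    rw [write_of_ne hR, h k hk τ hτ hframe, ih, or_assoc]
    refine or_congr Iff.rfl ⟨?_, ?_⟩
    · rintro (⟨j, hj, hQ⟩ | hQ)
      · exact ⟨j, by omega, hQ⟩
      · exact ⟨k, by omega, hQ⟩
    · rintro ⟨j, hj, hQ⟩
      rcases Nat.lt_succ_iff_lt_or_eq.1 hj with hj | rfl
      · exact .inl ⟨j, hj, hQ⟩
      · exact .inr hQ

theorem run_powers (σ : Memory) (v : ℕ) (hv : v ≤ σ inSize 0) :
    powers.run σ arrPow v = 2 ^ v := by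
  set σ' := (Prog.assign arrPow 0 1).run σ with hσ'
  have h0 : σ' inSize = σ inSize := run_frame (by decide) σ
  have := run_loop (A := cntV) (B := inSize) (e := 0) (σ := σ')
    (p := .assign arrPow (var cntV + 1) (.read arrPow (var cntV) + .read arrPow (var cntV)))
    (Inv := fun k τ => ∀ v ≤ k, τ arrPow v = 2 ^ v) ?_ ?_
  · exact this v (by simpa [h0] using hv)
  · simp [hσ']
  · intro k hk τ hτ _ ih v hv
    simp only [write_apply, run_assign_apply, Expr.eval_add, Expr.eval_var, Expr.eval_one, Expr.eval_read, hτ]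
    rcases Nat.lt_or_ge k v with h | h
    · obtain rfl : v = k + 1 := by omega
      simp [ih k le_rfl, pow_succ, mul_two]
    · have : v ≠ k + 1 := by omega
      simp [this, ih v h]

theorem run_penalty (σ : Memory) :
    penalty.run σ arrPen 0 = 1 + ∑ u ∈ Finset.range (σ inSize 0), ∑ v ∈ Finset.range (σ inSize 0),
        σ inWt (u * σ inSize 0 + v) ∧
      penalty.run σ arrEdge 0 = σ arrEdge 0 + ∑ u ∈ Finset.range (σ inSize 0),
        ∑ v ∈ Finset.range (σ inSize 0), σ inAdj (u * σ inSize 0 + v) := by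
  set σ' := (Prog.assign arrPen 0 1).run σ with hσ'
  have h0 : ∀ D, D ≠ arrPen → σ' D = σ D := fun D hD => run_frame (by simpa [writes] using hD) σ
  have h1 : σ' arrPen 0 = 1 := by simp [hσ']
  constructor
  · change (Prog.loop cntU inSize 0 _).run σ' arrPen 0 = _
    refine (run_loop_sum (fun u => ∑ v ∈ Finset.range (σ inSize 0), σ inWt (u * σ inSize 0 + v))
      (by decide) fun u hu τ hτ hframe => ?_).trans (by simp [h1, h0])
    have h2 : ∀ D, D ∉ [arrPen, arrEdge, cntU, cntV] → τ D = σ D := fun D hD => by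
      rw [hframe D (by simp [writes, forV] at hD ⊢; tauto), h0 D (by simp at hD; tauto)]
    refine (run_loop_sum (fun v => σ inWt (u * σ inSize 0 + v))
      (by decide) fun v hv ρ hρ hframe' => ?_).trans (by simp [h2])
    have h3 : ∀ D, D ∉ [arrPen, arrEdge, cntU, cntV] → ρ D = σ D := fun D hD => by
      rw [hframe' D (by simp [writes] at hD ⊢; tauto), h2 D hD]
    have h4 : ρ cntU 0 = u := by rw [hframe' _ (by decide), hτ]
    simp [h3, h4, hρ]
  · change (Prog.loop cntU inSize 0 _).run σ' arrEdge 0 = _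
    refine (run_loop_sum (fun u => ∑ v ∈ Finset.range (σ inSize 0), σ inAdj (u * σ inSize 0 + v))
      (by decide) fun u hu τ hτ hframe => ?_).trans (by simp [h0])
    have h2 : ∀ D, D ∉ [arrPen, arrEdge, cntU, cntV] → τ D = σ D := fun D hD => by
      rw [hframe D (by simp [writes, forV] at hD ⊢; tauto), h0 D (by simp at hD; tauto)]
    refine (run_loop_sum (fun v => σ inAdj (u * σ inSize 0 + v))
      (by decide) fun v hv ρ hρ hframe' => ?_).trans (by simp [h2])
    have h3 : ∀ D, D ∉ [arrPen, arrEdge, cntU, cntV] → ρ D = σ D := fun D hD => by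
      rw [hframe' D (by simp [writes] at hD ⊢; tauto), h2 D hD]
    have h4 : ρ cntU 0 = u := by rw [hframe' _ (by decide), hτ]
    simp [h3, h4, hρ]

theorem add_mul_inj {n a b c d : ℕ} (hb : b < n) (hd : d < n) :
    a * n + b = c * n + d ↔ a = c ∧ b = d := by
  refine ⟨fun h => ?_, by rintro ⟨rfl, rfl⟩; rfl⟩
  have hn : 0 < n := by omega
  have h1 : (a * n + b) / n = a := by
    rw [mul_comm, Nat.mul_add_div hn, Nat.div_eq_of_lt hb, add_zero]
  have h2 : (c * n + d) / n = c := by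
    rw [mul_comm, Nat.mul_add_div hn, Nat.div_eq_of_lt hd, add_zero]
  have h3 : a = c := by rw [← h1, h, h2]
  subst h3
  exact ⟨rfl, by omega⟩

theorem run_closedBags (σ : Memory) (a : ℕ) :
    closedBags.run σ arrMem a ≠ 0 ↔ σ arrMem a ≠ 0 ∨
      ∃ i < σ inSize 1, ∃ u < σ inSize 0, ∃ v < σ inSize 0,
        σ inBag (σ arrOrd i * σ inSize 0 + u) ≠ 0 ∧
        (σ inAdj (u * σ inSize 0 + v) ≠ 0 ∨ u = v) ∧ a = i * σ inSize 0 + v := by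
  refine run_loop_mark _ (by decide) fun i hi τ hτ hframe => ?_
  have h1 : ∀ D, D ∉ [arrMem, cntI, cntU, cntV] → τ D = σ D := fun D hD =>
    hframe D (by simp [writes, forV] at hD ⊢; tauto)
  refine (run_loop_mark (fun u => ∃ v < σ inSize 0,
      σ inBag (σ arrOrd i * σ inSize 0 + u) ≠ 0 ∧
      (σ inAdj (u * σ inSize 0 + v) ≠ 0 ∨ u = v) ∧ a = i * σ inSize 0 + v)
    (by decide) fun u hu ρ hρ hframe' => ?_).trans (by simp [h1])
  have h2 : ∀ D, D ∉ [arrMem, cntI, cntU, cntV] → ρ D = σ D := fun D hD => by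
    rw [hframe' D (by simp [writes, forV] at hD ⊢; tauto), h1 D hD]
  have h3 : ρ cntI 0 = i := by rw [hframe' _ (by decide), hτ]
  refine (run_loop_mark (fun v => σ inBag (σ arrOrd i * σ inSize 0 + u) ≠ 0 ∧
      (σ inAdj (u * σ inSize 0 + v) ≠ 0 ∨ u = v) ∧ a = i * σ inSize 0 + v)
    (by decide) fun v hv π hπ hframe'' => ?_).trans (by simp [h2])
  have h4 : ∀ D, D ∉ [arrMem, cntI, cntU, cntV] → π D = σ D := fun D hD => by
    rw [hframe'' D (by simp [writes] at hD ⊢; tauto), h2 D hD]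
  have h5 : π cntI 0 = i := by rw [hframe'' _ (by decide), h3]
  have h6 : π cntU 0 = u := by rw [hframe'' _ (by decide), hρ]
  simp only [run_when_apply, run_assign_apply, eval_sizeV, Expr.eval_add, Expr.eval_var,
    Expr.eval_read, Expr.eval_mul, Expr.eval_isEq, Expr.eval_one, hπ, h5, h6, h4 inSize (by decide),
    h4 inBag (by decide), h4 arrOrd (by decide), h4 inAdj (by decide)]
  by_cases hbag : σ inBag (σ arrOrd i * σ inSize 0 + u) = 0
  · simp [hbag]
  · by_cases huv : u = v
    · subst huv
      by_cases ha : a = i * σ inSize 0 + u <;> simp [hbag, ha]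
    · by_cases hadj : σ inAdj (u * σ inSize 0 + v) = 0
      · simp [hbag, huv, hadj]
      · by_cases ha : a = i * σ inSize 0 + v <;> simp [hbag, huv, ha, hadj]

/-- An entry may be overwritten, but only by another node whose bag contains `v`. The initial entry
need not be such a node, so the property has to be attained before it persists. -/
theorem run_owners (σ : Memory) (v : ℕ) (hv : v < σ inSize 0)
    (h : ∃ i < σ inSize 1, σ inBag (σ arrOrd i * σ inSize 0 + v) ≠ 0) :
    owners.run σ arrOwn v < σ inSize 1 ∧
      σ inBag (σ arrOrd (owners.run σ arrOwn v) * σ inSize 0 + v) ≠ 0 := by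
  set P : Memory → Prop := fun τ => τ arrOwn v < σ inSize 1 ∧
    σ inBag (σ arrOrd (τ arrOwn v) * σ inSize 0 + v) ≠ 0 with hP
  refine run_loop_attain P (fun i => σ inBag (σ arrOrd i * σ inSize 0 + v) ≠ 0)
    (fun τ k hτ => by simpa [hP, Memory.write] using hτ) (fun i hi τ hτ hframe hor => ?_) (.inr h)
  have h1 : ∀ D, D ∉ [arrOwn, cntI, cntV] → τ D = σ D := fun D hD =>
    hframe D (by simp [writes, forV] at hD ⊢; tauto)
  refine run_loop_attain P (fun u => u = v ∧ σ inBag (σ arrOrd i * σ inSize 0 + v) ≠ 0)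
    (fun τ k hτ => by simpa [hP, Memory.write] using hτ) (fun u hu ρ hρ hframe' hor' => ?_)
    (hor.imp id fun h => ⟨v, by simpa [h1] using hv, rfl, h⟩)
  have h2 : ∀ D, D ∉ [arrOwn, cntI, cntV] → ρ D = σ D := fun D hD => by
    rw [hframe' D (by simp [writes] at hD ⊢; tauto), h1 D hD]
  have h3 : ρ cntI 0 = i := by rw [hframe' _ (by decide), hτ]
  simp only [hP, run_when_apply, run_assign_apply, eval_sizeV, Expr.eval_add, Expr.eval_var,
    Expr.eval_read, Expr.eval_mul, hρ, h3, h2 inSize (by decide),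
    h2 inBag (by decide), h2 arrOrd (by decide)] at hor' ⊢
  have hi' : i < σ inSize 1 := hi
  by_cases hbag : σ inBag (σ arrOrd i * σ inSize 0 + u) = 0
  · rw [if_pos hbag]
    rcases hor' with h | ⟨rfl, h⟩
    · exact h
    · exact absurd hbag h
  · rw [if_neg hbag]
    by_cases huv : v = u
    · subst huv; simp [hbag, hi']
    · simp only [huv, and_false, if_false]
      rcases hor' with h | ⟨h, _⟩
      · exact h
      · exact absurd h.symm huv

theorem run_counts (σ : Memory) (i : ℕ) :
    counts.run σ arrCount i = if i < σ inSize 1 then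
      2 ^ ((Finset.range (σ inSize 0)).filter fun v => σ arrMem (i * σ inSize 0 + v) ≠ 0).card
      else σ arrCount i := by
  refine run_loop (Inv := fun k τ => τ arrCount i = if i < k then
      2 ^ ((Finset.range (σ inSize 0)).filter fun v => σ arrMem (i * σ inSize 0 + v) ≠ 0).card
      else σ arrCount i) (by simp [Memory.write]) fun k hk τ hτ hframe ih => ?_
  have h1 : ∀ D, D ∉ [arrCount, cntI, cntV] → τ D = σ D := fun D hD =>
    hframe D (by simp [writes, forV] at hD ⊢; tauto)
  set ρ := (Prog.assign arrCount (var cntI) 1).run τ with hρ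
  have hρf : ∀ D, D ≠ arrCount → ρ D = τ D := fun D hD =>
    run_frame (by simpa [writes] using hD) τ
  rw [write_of_ne (by decide)]
  have key := run_loop (A := cntV) (B := inSize) (e := 0) (σ := ρ)
    (p := .when (.read arrMem (var cntI * sizeV + var cntV))
      (.assign arrCount (var cntI) (.read arrCount (var cntI) + .read arrCount (var cntI))))
    (Inv := fun m π => π arrCount i = if i = k then
      2 ^ ((Finset.range m).filter fun v => σ arrMem (i * σ inSize 0 + v) ≠ 0).card
      else τ arrCount i) ?_ ?_
  · refine key.trans ?_
    have : ρ inSize ((0 : Expr).eval ρ) = σ inSize 0 := by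
      rw [hρf _ (by decide), h1 _ (by decide)]; rfl
    rw [this, ih]
    by_cases hik : i = k
    · simp [hik]
    · have : i < k + 1 ↔ i < k := by omega
      simp [hik, this]
  · by_cases hik : i = k <;> simp [hρ, hτ, hik]
  · intro m hm π hπ hframe' ih'
    have h2 : ∀ D, D ∉ [arrCount, cntI, cntV] → π D = σ D := fun D hD => by
      rw [hframe' D (by simp [writes] at hD ⊢; tauto), hρf D (by simp at hD; tauto), h1 D hD]
    have h3 : π cntI 0 = k := by rw [hframe' _ (by decide), hρf _ (by decide), hτ]
    rw [write_of_ne (by decide), Finset.range_add_one, Finset.filter_insert]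
    simp only [run_when_apply, run_assign_apply, eval_sizeV, Expr.eval_add, Expr.eval_var,
    Expr.eval_read, Expr.eval_mul, hπ, h3, h2 inSize (by decide), h2 arrMem (by decide)]
    by_cases hik : i = k
    · subst hik
      by_cases hmem : σ arrMem (i * σ inSize 0 + m) = 0
      · simp [hmem, ih']
      · rw [if_neg hmem, if_pos rfl, if_pos hmem, Finset.card_insert_of_notMem (by simp)]
        simp [ih', pow_succ, mul_two]
    · simp [hik, ih']

/-- The condition `leaving` for the pair `(u, v)` in round `i`. -/
def Leaves (σ : Memory) (i u v : ℕ) : Prop :=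
  σ arrVis v = 0 ∧ (i = 0 ∨ σ arrVis u ≠ 0 ∧ σ inTree (u * σ inSize 1 + v) ≠ 0)

theorem eval_leaving (σ : Memory) :
    leaving.eval σ ≠ 0 ↔ Leaves σ (σ cntI 0) (σ cntU 0) (σ cntV 0) := by
  simp only [leaving, Leaves, Expr.eval_mul, Expr.eval_sub, Expr.eval_one, Expr.eval_read,
    Expr.eval_var, Expr.eval_add, Expr.eval_isEq, Expr.eval_zero, eval_sizeT]
  by_cases h1 : σ cntI 0 = 0 <;> by_cases h2 : σ arrVis (σ cntV 0) = 0 <;> simp [h1, h2] <;> omega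

/-- The last suitable pair survives. Every stored pair is suitable, as the search changes none of
the arrays on which the condition depends. -/
theorem run_search (σ : Memory) (h : ∃ u < σ inSize 1, ∃ v < σ inSize 1, Leaves σ (σ cntI 0) u v) :
    search.run σ varS 0 < σ inSize 1 ∧ search.run σ varT 0 < σ inSize 1 ∧
      Leaves σ (σ cntI 0) (search.run σ varS 0) (search.run σ varT 0) := by
  set P : Memory → Prop := fun τ => τ varS 0 < σ inSize 1 ∧ τ varT 0 < σ inSize 1 ∧
    Leaves σ (σ cntI 0) (τ varS 0) (τ varT 0) with hP
  refine run_loop_attain P (fun u => ∃ v < σ inSize 1, Leaves σ (σ cntI 0) u v)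
    (fun τ k hτ => by simpa [hP] using hτ) (fun u hu τ hτ hframe hor => ?_) (.inr h)
  have h1 : ∀ D, D ∉ [varS, varT, cntU, cntV] → τ D = σ D := fun D hD =>
    hframe D (by simp [writes, forT] at hD ⊢; tauto)
  refine run_loop_attain P (fun v => Leaves σ (σ cntI 0) u v)
    (fun τ k hτ => by simpa [hP] using hτ) (fun v hv ρ hρ hframe' hor' => ?_)
    (hor.imp id fun ⟨v, hv, h⟩ => ⟨v, by simpa [h1] using hv, h⟩)
  have h2 : ∀ D, D ∉ [varS, varT, cntU, cntV] → ρ D = σ D := fun D hD => by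
    rw [hframe' D (by simp [writes] at hD ⊢; tauto), h1 D hD]
  have h3 : ρ cntU 0 = u := by rw [hframe' _ (by decide), hτ]
  have hu' : u < σ inSize 1 := hu
  have hv' : v < σ inSize 1 := by simpa [h1] using hv
  have h4 : leaving.eval ρ ≠ 0 ↔ Leaves σ (σ cntI 0) u v := by
    rw [eval_leaving, h3, hρ]
    simp [Leaves, h2]
  by_cases hl : Leaves σ (σ cntI 0) u v
  · have := h4.2 hl
    simp [hP, this, h3, hρ, hu', hv', hl]
  · have h5 : leaving.eval ρ = 0 := by simpa [hl] using h4
    have h6 := hor'.resolve_right hl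
    simpa [hP, h5] using h6

/-- The first `k` nodes of an ordering of the tree whose adjacency matrix is in the memory. -/
structure Ordered (σ τ : Memory) (k : ℕ) : Prop where
  ord_lt : ∀ i < k, τ arrOrd i < σ inSize 1
  pos : ∀ i < k, τ arrPos (τ arrOrd i) = i
  vis : ∀ t, τ arrVis t ≠ 0 ↔ ∃ i < k, τ arrOrd i = t
  par : ∀ i, 0 < i → i < k → τ arrPar i < i ∧
    σ inTree (τ arrOrd (τ arrPar i) * σ inSize 1 + τ arrOrd i) ≠ 0

/-- The visited nodes are the images of `k` positions, too few to cover all nodes. -/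
theorem Ordered.exists_not_visited {σ τ : Memory} {k : ℕ} (h : Ordered σ τ k)
    (hk : k < σ inSize 1) : ∃ t < σ inSize 1, τ arrVis t = 0 := by
  by_contra! hall
  have hsub : Finset.range (σ inSize 1) ⊆ (Finset.range k).image (τ arrOrd) := by
    intro t ht
    obtain ⟨i, hi, rfl⟩ := (h.vis t).1 (hall t (Finset.mem_range.1 ht))
    exact Finset.mem_image_of_mem _ (Finset.mem_range.2 hi)
  have h1 := (Finset.card_le_card hsub).trans Finset.card_image_le
  simp only [Finset.card_range] at h1
  omega

/-- Every proper nonempty set of nodes is left by an edge. -/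
def Linked (σ : Memory) : Prop :=
  ∀ S : Set ℕ, (∃ s < σ inSize 1, s ∈ S) → (∃ t < σ inSize 1, t ∉ S) →
    ∃ s < σ inSize 1, ∃ t < σ inSize 1, s ∈ S ∧ t ∉ S ∧ σ inTree (s * σ inSize 1 + t) ≠ 0

theorem run_order (σ : Memory) (hvis : ∀ t, σ arrVis t = 0) (hlinked : Linked σ) :
    Ordered σ (order.run σ) (σ inSize 1) ∧ order.run σ arrPar 0 = σ inSize 1 := by
  set body := search ;;
    .assign arrOrd (var cntI) (var varT) ;;
    .assign arrPar (var cntI) (.read arrPos (var varS)) ;;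
    .assign arrPos (var varT) (var cntI) ;;
    .assign arrVis (var varT) 1 with hbody
  have key := run_loop (A := cntI) (B := inSize) (e := 1) (p := body) (σ := σ)
    (Inv := fun k τ => Ordered σ τ k) ?_ ?_
  · set τ := (Prog.loop cntI inSize 1 body).run σ with hτ
    have h1 : order.run σ = (Prog.assign arrPar 0 sizeT).run τ := rfl
    have h2 : τ inSize = σ inSize := run_frame (by decide) σ
    rw [h1]
    refine ⟨?_, by simp [h2]⟩
    refine ⟨fun i hi => by simpa using key.ord_lt i hi, fun i hi => by simpa using key.pos i hi,
      fun t => by simpa using key.vis t, fun i hi0 hi => ?_⟩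
    -- The first round starts from an arbitrary pair, so the parent of position 0 was meaningless.
    -- Setting it to the dummy node at the end is harmless, since `Ordered.par` concerns later
    -- positions only.
    simpa [hi0.ne'] using key.par i hi0 hi
  · exact ⟨by simp, by simp, by simp [hvis], by simp⟩
  · intro k hk τ hτ hframe ih
    have hk : k < σ inSize 1 := hk
    have h1 : ∀ D ∈ [inSize, inTree], τ D = σ D := fun D hD => by
      simp only [List.mem_cons, List.not_mem_nil, or_false] at hD
      rcases hD with rfl | rfl <;> exact hframe _ (by decide)
    have hsize : τ inSize = σ inSize := h1 _ (by decide)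
    have htree : τ inTree = σ inTree := h1 _ (by decide)
    obtain ⟨t₀, ht₀, hvis₀⟩ := ih.exists_not_visited hk
    have hex : ∃ u < τ inSize 1, ∃ v < τ inSize 1, Leaves τ (τ cntI 0) u v := by
      rw [hsize, hτ]
      -- In round 0 any pair with an unvisited second node is accepted. Later, `Linked` applied to
      -- the visited set supplies an edge that leaves it.
      rcases Nat.eq_zero_or_pos k with rfl | hk0
      · exact ⟨t₀, ht₀, t₀, ht₀, hvis₀, .inl rfl⟩
      · obtain ⟨u, hu, v, hv, huS, hvS, huv⟩ := hlinked {t | τ arrVis t ≠ 0}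
          ⟨τ arrOrd 0, ih.ord_lt 0 hk0, (ih.vis _).2 ⟨0, hk0, rfl⟩⟩ ⟨t₀, ht₀, by simpa using hvis₀⟩
        refine ⟨u, hu, v, hv, by simpa using hvS, .inr ⟨huS, ?_⟩⟩
        rw [hsize, htree]; exact huv
    obtain ⟨hs, ht, hvt, hst⟩ := run_search τ hex
    set ρ := search.run τ with hρ
    have h2 : ∀ D, D ∉ [varS, varT, cntU, cntV] → ρ D = τ D := fun D hD =>
      run_frame (by simp [search, writes, forT] at hD ⊢; tauto) τ
    rw [hsize] at hs ht
    rw [hsize, htree, hτ] at hst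
    have hord : ∀ i, ((body.run τ).write cntI 0 (k + 1)) arrOrd i =
        if i = k then ρ varT 0 else τ arrOrd i := by
      intro i; simp [hbody, ← hρ, h2, hτ]
    have hpar : ∀ i, ((body.run τ).write cntI 0 (k + 1)) arrPar i =
        if i = k then τ arrPos (ρ varS 0) else τ arrPar i := by
      intro i; simp [hbody, ← hρ, h2, hτ]
    have hpos : ∀ t, ((body.run τ).write cntI 0 (k + 1)) arrPos t =
        if t = ρ varT 0 then k else τ arrPos t := by
      intro i; simp [hbody, ← hρ, h2, hτ]
    have hvis' : ∀ t, ((body.run τ).write cntI 0 (k + 1)) arrVis t =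
        if t = ρ varT 0 then 1 else τ arrVis t := by
      intro i; simp [hbody, ← hρ, h2, hτ]
    have hnew : ∀ i < k, τ arrOrd i ≠ ρ varT 0 := fun i hi h =>
      (ih.vis _).2 ⟨i, hi, h⟩ hvt
    constructor
    · intro i hi
      rw [hord]
      split_ifs with h
      · exact ht
      · exact ih.ord_lt i (by omega)
    · intro i hi
      rw [hpos, hord]
      by_cases h : i = k
      · simp [h]
      · rw [if_neg h, if_neg (hnew i (by omega)), ih.pos i (by omega)]
    · intro t
      rw [hvis']
      constructor
      · intro h
        by_cases htT : t = ρ varT 0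
        · exact ⟨k, by omega, by rw [hord, if_pos rfl, htT]⟩
        · rw [if_neg htT] at h
          obtain ⟨i, hi, hit⟩ := (ih.vis t).1 h
          exact ⟨i, by omega, by rw [hord, if_neg hi.ne, hit]⟩
      · rintro ⟨i, hi, hit⟩
        rw [hord] at hit
        split_ifs at hit with h
        · simp [hit]
        · split_ifs
          · simp
          · exact (ih.vis t).2 ⟨i, by omega, hit⟩
    · intro i hi0 hi
      rw [hpar, hord, hord]
      by_cases h : i = k
      · subst h
        obtain ⟨hvs, hadj⟩ := hst.resolve_left hi0.ne'
        obtain ⟨j, hj, hjs⟩ := (ih.vis _).1 hvs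
        -- The array `arrPos` inverts the order on visited nodes, so the recorded parent is the
        -- earlier position of the visited end of the edge.
        have h3 : τ arrPos (ρ varS 0) = j := by rw [← hjs, ih.pos j hj]
        rw [if_pos rfl, if_pos rfl, h3, if_neg hj.ne, hjs]
        exact ⟨hj, hadj⟩
      · obtain ⟨h3, h4⟩ := ih.par i hi0 (by omega)
        have h5 : τ arrPar i ≠ k := by omega
        rw [if_neg h, if_neg h, if_neg h5]
        exact ⟨h3, h4⟩

end Prog

/-! ### Enumeration of the subsets of a bag -/

/-- The digits of `a`, distributed over the positions `v < n` with `x v`, and the remaining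
digits of `a`. -/
def spread (x : ℕ → Bool) (a : ℕ) : ℕ → ℕ × ℕ
  | 0 => (0, a)
  | n + 1 => if x n then
      ((spread x a n).1 + if (spread x a n).2 % 2 = 0 then 0 else 2 ^ n, (spread x a n).2 / 2)
    else spread x a n

/-- Writing the value as a mask makes its binary digits accessible: a step at position `n` leaves
the lower digits alone and sets a new one only if `x n` holds. -/
theorem spread_fst_eq_mask (x : ℕ → Bool) (a n : ℕ) :
    ∃ f : ℕ → Bool, (∀ v, f v = true → x v = true) ∧ (spread x a n).1 = mask f n := by
  induction n with
  | zero => exact ⟨fun _ => false, by simp, rfl⟩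
  | succ n ih =>
    obtain ⟨f, hf, h⟩ := ih
    have mask_congr : ∀ g : ℕ → Bool, (∀ v < n, g v = f v) → mask g n = mask f n := by
      intro g hg
      refine Nat.eq_of_testBit_eq fun v => ?_
      rw [testBit_mask, testBit_mask]
      by_cases hv : v < n
      · simp [hv, hg v hv]
      · simp [hv]
    refine ⟨fun v => if v = n then x n && decide ((spread x a n).2 % 2 ≠ 0) else f v,
      fun v hv => ?_, ?_⟩
    · simp only at hv
      split_ifs at hv with h
      · subst h; simp_all
      · exact hf v hv
    · rw [mask, mask_congr _ fun v hv => by simp [hv.ne], ← h, spread]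
      by_cases hx : x n = true <;> by_cases h2 : (spread x a n).2 % 2 = 0 <;> simp [hx, h2]

theorem spread_fst_and (x : ℕ → Bool) (a n : ℕ) :
    (spread x a n).1 &&& mask x n = (spread x a n).1 := by
  obtain ⟨f, hf, h⟩ := spread_fst_eq_mask x a n
  refine Nat.eq_of_testBit_eq fun v => ?_
  rw [h, Nat.testBit_and, testBit_mask, testBit_mask]
  have := hf v
  revert this
  cases f v <;> cases x v <;> simp

/-- The number `a` lists the digits of `A` at the positions of the bag. The higher digits `h` must
pass through unchanged for the induction to work, since the digit for the next position is taken
from them. -/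
theorem exists_spread (x : ℕ → Bool) (n : ℕ) : ∀ A, A &&& mask x n = A →
    ∃ a < 2 ^ ((Finset.range n).filter fun v => x v = true).card,
      ∀ h, spread x (a + 2 ^ ((Finset.range n).filter fun v => x v = true).card * h) n =
        (A, h) := by
  induction n with
  | zero =>
    intro A hA
    simp only [mask, Nat.and_zero] at hA
    exact ⟨0, by simp, fun h => by simp [spread, ← hA]⟩
  | succ n ih =>
    intro A hA
    have hlt : A < 2 ^ (n + 1) := lt_two_pow_of_and_eq (mask_lt x (n + 1)) hA
    obtain ⟨a, ha, hspread⟩ := ih (mask A.testBit n) (by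
      refine Nat.eq_of_testBit_eq fun v => ?_
      have h1 := congrArg (·.testBit v) hA
      simp only [Nat.testBit_and, testBit_mask] at h1 ⊢
      by_cases hv : v < n
      · have hv' : v < n + 1 := by omega
        simp only [hv, hv', decide_true, Bool.true_and] at h1 ⊢
        exact h1
      · simp [hv])
    have hAeq : A = mask A.testBit n + if A.testBit n then 2 ^ n else 0 := eq_mask hlt
    by_cases hx : x n = true
    · rw [Finset.range_add_one, Finset.filter_insert, if_pos hx,
        Finset.card_insert_of_notMem (by simp)]
      set c := ((Finset.range n).filter fun v => x v = true).card
      -- With `c` bag positions below `n`, the digit of `A` at `n` becomes digit number `c` of the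
      -- code.
      refine ⟨a + 2 ^ c * (if A.testBit n then 1 else 0), ?_, fun h => ?_⟩
      · rw [pow_succ]; split_ifs <;> omega
      · have h1 : a + 2 ^ c * (if A.testBit n then 1 else 0) + 2 ^ (c + 1) * h =
            a + 2 ^ c * ((if A.testBit n then 1 else 0) + 2 * h) := by ring
        rw [h1, spread, if_pos hx, hspread]
        conv_rhs => rw [hAeq]
        cases A.testBit n
        · simp
        · have h2 : (1 + 2 * h) % 2 ≠ 0 := by omega
          have h3 : (1 + 2 * h) / 2 = h := by omega
          simp [h3]
    · rw [Finset.range_add_one, Finset.filter_insert, if_neg hx]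
      refine ⟨a, ha, fun h => ?_⟩
      rw [spread, if_neg hx, hspread]
      have h1 := congrArg (·.testBit n) hA
      simp only [Nat.testBit_and, testBit_mask, hx, Bool.and_false] at h1
      conv_rhs => rw [hAeq]
      simp [← h1]

namespace Prog

/-! ### The data of the dynamic programming -/

/-- The bag at position `i` as a set of vertices. -/
def bagMask (μ : Memory) (i : ℕ) : ℕ :=
  mask (fun v => decide (μ arrMem (i * μ inSize 0 + v) ≠ 0)) (μ inSize 0)

/-- The weight of the edges at `v` that cross the cut `S`. -/
def cross (μ : Memory) (S v : ℕ) : ℕ :=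
  ∑ u ∈ Finset.range (μ inSize 0),
    if S.testBit u = S.testBit v then 0 else μ inWt (v * μ inSize 0 + u)

/-- The weighted degree of `v`. -/
def degree (μ : Memory) (v : ℕ) : ℕ :=
  ∑ u ∈ Finset.range (μ inSize 0), μ inWt (v * μ inSize 0 + u)

/-- The cost of the cut `S` at `v`. -/
def vertexCost (μ : Memory) (S v : ℕ) : ℕ :=
  cross μ S v + if 2 * cross μ S v < degree μ v then μ arrPen 0 else 0

/-- The cost of the cut `S` at the vertices that belong to the position `i`, plus one. -/
def nodeCost (μ : Memory) (i S : ℕ) : ℕ :=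
  1 + ∑ v ∈ Finset.range (μ inSize 0), if μ arrOwn v = i then vertexCost μ S v else 0

/-- The column `i` of a table. -/
def column (μ : Memory) (A : ℕ) (i K : ℕ) : ℕ :=
  μ A (K * μ inSize 1 + i)

/-- The results of the preparation are unchanged. -/
def Agree (μ τ : Memory) : Prop :=
  ∀ D < 16, D ≠ outSide → τ D = μ D

theorem Agree.run {μ τ : Memory} (h : Agree μ τ) {p : Prog}
    (hp : ∀ D ∈ p.writes, 16 ≤ D ∨ D = outSide) : Agree μ (p.run τ) := fun D hD hne => by
  rw [run_frame (fun hmem => ?_), h D hD hne]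
  rcases hp D hmem with h | h
  · omega
  · exact hne h

theorem Agree.of_frame {μ τ ρ : Memory} (h : Agree μ τ) {l : List ℕ}
    (hρ : ∀ D, D ∉ l → ρ D = τ D) (hl : ∀ D ∈ l, 16 ≤ D ∨ D = outSide) : Agree μ ρ :=
  fun D hD hne => by
    rw [hρ D (fun hmem => ?_), h D hD hne]
    rcases hl D hmem with h | h
    · omega
    · exact hne h

/-- The powers of two are available. -/
def HasPowers (μ : Memory) : Prop :=
  ∀ v ≤ μ inSize 0, μ arrPow v = 2 ^ v

/-- For q = ⌊m / 2^v⌋ the expression is q − 2⌊q / 2⌋, the parity of q, with the power of two read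
from the table. -/
theorem eval_digit {σ : Memory} (m : Expr) {v : Expr} (h : σ arrPow (v.eval σ) = 2 ^ v.eval σ) :
    (digit m v).eval σ = ((m.eval σ).testBit (v.eval σ)).toNat := by
  simp only [digit, Expr.eval_sub, Expr.eval_mul, Expr.eval_div, Expr.eval_read, Expr.eval_two, h]
  rw [Nat.toNat_testBit]
  omega

theorem testBit_bagMask {μ : Memory} {i v : ℕ} :
    (bagMask μ i).testBit v =
      (decide (v < μ inSize 0) && decide (μ arrMem (i * μ inSize 0 + v) ≠ 0)) :=
  testBit_mask _ _ _

/-- The condition is tested while `cntV` and `varKey` change; its meaning is therefore required in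
all memories that differ from `τ` only there. -/
theorem run_collect {c : Expr} {τ : Memory} (f : ℕ → Bool) (hP : HasPowers τ)
    (hc : ∀ k < τ inSize 0, ∀ ρ : Memory, ρ cntV 0 = k →
      (∀ D, D ∉ [cntV, varKey] → ρ D = τ D) → (c.eval ρ ≠ 0 ↔ f k = true)) :
    (collect c).run τ varKey 0 = mask f (τ inSize 0) := by
  set σ := (Prog.assign varKey 0 0).run τ with hσ
  have h0 : ∀ D, D ≠ varKey → σ D = τ D := fun D hD => run_frame (by simpa [writes] using hD) τ
  have hsize : σ inSize ((0 : Expr).eval σ) = τ inSize 0 := by rw [h0 _ (by decide)]; rfl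
  have key := run_loop (A := cntV) (B := inSize) (e := 0) (σ := σ)
    (p := .when c (.assign varKey 0 (var varKey + .read arrPow (var cntV))))
    (Inv := fun k ρ => ρ varKey 0 = mask f k) ?_ ?_
  · rw [hsize] at key; exact key
  · simp [hσ, mask]
  · intro k hk ρ hρ hframe ih
    rw [hsize] at hk
    have h1 : ∀ D, D ∉ [cntV, varKey] → ρ D = τ D := fun D hD => by
      rw [hframe D (by simp [writes] at hD ⊢; tauto), h0 D (by simp at hD; tauto)]
    have h2 := hc k hk ρ hρ h1
    have h3 : ρ arrPow k = 2 ^ k := by rw [h1 _ (by decide)]; exact hP k hk.le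
    by_cases h4 : f k = true
    · have h5 := h2.2 h4
      simp [mask, h4, h5, hρ, h3, ih]
    · have h5 : c.eval ρ = 0 := by simpa [h4] using h2
      simp [mask, h4, h5, ih]

theorem Agree.hasPowers {μ τ : Memory} (h : Agree μ τ) (hP : HasPowers μ) : HasPowers τ := by
  intro v hv
  rw [h _ (by decide) (by decide)] at hv ⊢
  exact hP v hv

theorem run_collect_inBagOf {μ τ : Memory} (h : Agree μ τ) (hP : HasPowers μ) {p : Expr}
    (hp : ∀ D ∈ p.arrays, D ∉ [cntV, varKey]) :
    (collect (inBagOf p)).run τ varKey 0 = τ varA 0 &&& bagMask μ (p.eval τ) := by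
  have hsize : τ inSize = μ inSize := h _ (by decide) (by decide)
  rw [run_collect (fun v => (τ varA 0).testBit v &&
    decide (μ arrMem (p.eval τ * μ inSize 0 + v) ≠ 0)) (h.hasPowers hP)]
  · refine Nat.eq_of_testBit_eq fun v => ?_
    rw [testBit_mask, Nat.testBit_and, testBit_bagMask, hsize, Bool.and_left_comm]
  · intro k hk ρ hρ hframe
    have h1 : p.eval ρ = p.eval τ := Expr.eval_congr fun D hD => hframe D (hp D hD)
    have h2 : ρ arrMem = μ arrMem := by rw [hframe _ (by decide), h _ (by decide) (by decide)]
    have h3 : ρ inSize = μ inSize := by rw [hframe _ (by decide), hsize]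
    have h4 : ρ varA = τ varA := hframe _ (by decide)
    have h5 : ρ arrPow ((var cntV).eval ρ) = 2 ^ (var cntV).eval ρ := by
      rw [hframe _ (by decide)]
      exact h.hasPowers hP _ (by rw [Expr.eval_var, hρ]; exact hk.le)
    simp only [inBagOf, Expr.eval_mul, eval_digit _ h5, Expr.eval_var, Expr.eval_read,
      Expr.eval_add, eval_sizeV, h1, h2, h3, h4, hρ]
    cases (τ varA 0).testBit k <;> simp

theorem run_decode {μ τ : Memory} (h : Agree μ τ) (hP : HasPowers μ) :
    decode.run τ varA 0 = (spread (fun v => decide (μ arrMem (τ varI 0 * μ inSize 0 + v) ≠ 0))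
      (τ cntA 0) (μ inSize 0)).1 := by
  set x : ℕ → Bool := fun v => decide (μ arrMem (τ varI 0 * μ inSize 0 + v) ≠ 0) with hx
  set σ := (Prog.assign varA 0 0 ;; .assign varB 0 (var cntA)).run τ with hσ
  have h0 : ∀ D, D ∉ [varA, varB] → σ D = τ D := fun D hD =>
    run_frame (by simp [writes] at hD ⊢; tauto) τ
  have hsize : σ inSize ((0 : Expr).eval σ) = μ inSize 0 := by
    rw [h0 _ (by decide), h _ (by decide) (by decide)]; rfl
  have key := run_loop (A := cntV) (B := inSize) (e := 0) (σ := σ)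
    (p := .when (.read arrMem (var varI * sizeV + var cntV))
      (.when (var varB - 2 * (var varB / 2))
        (.assign varA 0 (var varA + .read arrPow (var cntV))) ;;
      .assign varB 0 (var varB / 2)))
    (Inv := fun k ρ => ρ varA 0 = (spread x (τ cntA 0) k).1 ∧
      ρ varB 0 = (spread x (τ cntA 0) k).2) ?_ ?_
  · rw [hsize] at key; exact key.1
  · simp [hσ, spread]
  · intro k hk ρ hρ hframe ih
    rw [hsize] at hk
    have h1 : ∀ D, D ∉ [cntV, varA, varB] → ρ D = τ D := fun D hD => by
      rw [hframe D (by simp [writes] at hD ⊢; tauto), h0 D (by simp at hD ⊢; tauto)]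
    have h2 : ρ arrPow k = 2 ^ k := by
      rw [h1 _ (by decide), h _ (by decide) (by decide)]; exact hP k hk.le
    have h3 : ρ inSize = μ inSize := by rw [h1 _ (by decide), h _ (by decide) (by decide)]
    have h4 : ρ arrMem = μ arrMem := by rw [h1 _ (by decide), h _ (by decide) (by decide)]
    have h5 : ρ varI = τ varI := h1 _ (by decide)
    have h6 : ∀ y : ℕ, y - 2 * (y / 2) = 0 ↔ y % 2 = 0 := fun y => by omega
    by_cases hm : μ arrMem (τ varI 0 * μ inSize 0 + k) = 0
    · have h7 : x k = false := by simp [hx, hm]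
      simp [spread, h7, h3, h4, h5, hρ, hm, ih]
    · have h7 : x k = true := by simp [hx, hm]
      by_cases h8 : (spread x (τ cntA 0) k).2 % 2 = 0
      · simp [spread, h7, h3, h4, h5, hρ, hm, ih, h6, h8]
      · simp [spread, h7, h3, h4, h5, hρ, hm, ih, h2, h6, h8]

theorem run_crossing {μ τ : Memory} (h : Agree μ τ) (hP : HasPowers μ)
    (hv : τ cntV 0 < μ inSize 0) :
    crossing.run τ varC 0 = cross μ (τ varA 0) (τ cntV 0) ∧
      crossing.run τ varD 0 = degree μ (τ cntV 0) := by
  set σ := (Prog.assign varC 0 0 ;; .assign varD 0 0).run τ with hσ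
  have h0 : ∀ D, D ∉ [varC, varD] → σ D = τ D := fun D hD =>
    run_frame (by simp [writes] at hD ⊢; tauto) τ
  have hsize : σ inSize ((0 : Expr).eval σ) = μ inSize 0 := by
    rw [h0 _ (by decide), h _ (by decide) (by decide)]; rfl
  have h1 : ∀ ρ : Memory, (∀ D, D ∉ [cntU, varC, varD] → ρ D = σ D) →
      ∀ D, D ∉ [cntU, varC, varD] → ρ D = τ D := fun ρ hρ D hD => by
    rw [hρ D hD, h0 D (by simp at hD ⊢; tauto)]
  have h2 : ∀ ρ : Memory, (∀ D, D ∉ [cntU, varC, varD] → ρ D = τ D) → Agree μ ρ := fun ρ hρ =>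
    h.of_frame hρ (by decide)
  constructor
  · change (Prog.loop cntU inSize 0 _).run σ varC 0 = _
    refine (run_loop_sum (fun u => if (τ varA 0).testBit u = (τ varA 0).testBit (τ cntV 0) then 0
      else μ inWt (τ cntV 0 * μ inSize 0 + u)) (by decide) fun u hu ρ hρ hframe => ?_).trans
      (by simp only [hsize]; simp [hσ, cross])
    rw [hsize] at hu
    have h3 := h1 ρ fun D hD => hframe D (by simp [writes] at hD ⊢; tauto)
    have h4 := h2 ρ h3
    have h5 : ∀ D, D ∉ [cntU, varC, varD] →
        (Prog.assign varD 0 (var varD + .read inWt (var cntV * sizeV + var cntU))).run ρ D =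
          ρ D := fun D hD => run_frame (by simp [writes] at hD ⊢; tauto) ρ
    set π := (Prog.assign varD 0 (var varD + .read inWt (var cntV * sizeV + var cntU))).run ρ
      with hπ
    have h6 : ∀ D, D ∉ [cntU, varC, varD] → π D = τ D := fun D hD => by rw [h5 D hD, h3 D hD]
    have h7 := h2 π h6
    have hπu : π cntU 0 = u := by simp [hπ, hρ]
    have hπc : π varC 0 = ρ varC 0 := by simp [hπ]
    have hd : ∀ C, π C 0 < μ inSize 0 → (digit (var varA) (var C)).eval π =
        ((τ varA 0).testBit (π C 0)).toNat := fun C hC => by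
      rw [eval_digit]
      · simp [h6]
      · exact h7.hasPowers hP _ (by rw [h7 _ (by decide) (by decide)]; exact hC.le)
    have hcV : π cntV 0 = τ cntV 0 := by rw [h6 _ (by decide)]
    have hsz : π inSize = μ inSize := h7 _ (by decide) (by decide)
    have hwt : π inWt = μ inWt := h7 _ (by decide) (by decide)
    rw [run_seq, ← hπ, run_when_apply, run_assign_apply]
    simp only [Expr.eval_sub, Expr.eval_one, Expr.eval_isEq, Expr.eval_add, Expr.eval_var,
      Expr.eval_read, Expr.eval_mul, eval_sizeV, hd cntU (by rw [hπu]; exact hu),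
      hd cntV (by rw [hcV]; exact hv), hπu, hcV, hsz, hwt, hπc, Expr.eval_zero]
    cases (τ varA 0).testBit u <;> cases (τ varA 0).testBit (τ cntV 0) <;> simp
  · change (Prog.loop cntU inSize 0 _).run σ varD 0 = _
    refine (run_loop_sum (fun u => μ inWt (τ cntV 0 * μ inSize 0 + u)) (by decide)
      fun u hu ρ hρ hframe => ?_).trans (by simp only [hsize]; simp [hσ, degree])
    have h3 := h1 ρ fun D hD => hframe D (by simp [writes] at hD ⊢; tauto)
    have h4 := h2 ρ h3
    have hsz : ρ inSize = μ inSize := h4 _ (by decide) (by decide)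
    have hwt : ρ inWt = μ inWt := h4 _ (by decide) (by decide)
    have hcV : ρ cntV = τ cntV := h3 _ (by decide)
    simp [hρ, hsz, hwt, hcV]

theorem run_ownCost {μ τ : Memory} (h : Agree μ τ) (hP : HasPowers μ) :
    ownCost.run τ varVal 0 = nodeCost μ (τ varI 0) (τ varA 0) := by
  set σ := (Prog.assign varVal 0 1).run τ with hσ
  have h0 : ∀ D, D ≠ varVal → σ D = τ D := fun D hD => run_frame (by simpa [writes] using hD) τ
  have hsize : σ inSize ((0 : Expr).eval σ) = μ inSize 0 := by
    rw [h0 _ (by decide), h _ (by decide) (by decide)]; rfl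
  change (Prog.loop cntV inSize 0 _).run σ varVal 0 = _
  refine (run_loop_sum (fun v => if μ arrOwn v = τ varI 0 then vertexCost μ (τ varA 0) v else 0)
    (by decide) fun v hv ρ hρ hframe => ?_).trans (by simp only [hsize]; simp [hσ, nodeCost])
  rw [hsize] at hv
  have h1 : ∀ D, D ∉ [cntV, cntU, varC, varD, varVal] → ρ D = τ D := fun D hD => by
    rw [hframe D (by simp [writes, crossing, forV] at hD ⊢; tauto), h0 D (by simp at hD; tauto)]
  have h2 : Agree μ ρ := h.of_frame h1 (by decide)
  obtain ⟨h3, h4⟩ := run_crossing h2 hP (by rw [hρ]; exact hv)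
  set π := crossing.run ρ with hπ
  have h5 : ∀ D, D ∉ [cntU, varC, varD] → π D = ρ D := fun D hD =>
    run_frame (by simp [writes, crossing, forV] at hD ⊢; tauto) ρ
  have hown : ρ arrOwn = μ arrOwn := h2 _ (by decide) (by decide)
  have hpen : π arrPen = μ arrPen := by rw [h5 _ (by decide), h2 _ (by decide) (by decide)]
  have hI : ρ varI = τ varI := h1 _ (by decide)
  rw [hρ, h1 varA (by decide)] at h3
  rw [hρ] at h4
  have hval : π varVal = ρ varVal := h5 _ (by decide)
  rw [run_when_apply]
  simp only [Expr.eval_isEq, Expr.eval_read, Expr.eval_var, hρ, hown, hI]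
  by_cases hv' : μ arrOwn v = τ varI 0
  · simp only [hv', if_true, one_ne_zero, if_false, run_seq, ← hπ]
    by_cases hlt : 2 * cross μ (τ varA 0) v < degree μ v
    · have hlt' : cross μ (τ varA 0) v + cross μ (τ varA 0) v < degree μ v := by omega
      simp [h3, h4, hpen, hval, vertexCost, hlt, hlt']
      omega
    · have hlt' : ¬ cross μ (τ varA 0) v + cross μ (τ varA 0) v < degree μ v := by omega
      simp [h3, h4, hval, vertexCost, hlt, hlt']
  · simp [hv']

theorem run_childCost {μ τ : Memory} (h : Agree μ τ) (hP : HasPowers μ) :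
    childCost.run τ varVal 0 = τ varVal 0 + ∑ j ∈ Finset.range (μ inSize 1),
      if μ arrPar j = τ varI 0 then
        τ arrVal ((τ varA 0 &&& bagMask μ j) * μ inSize 1 + j) else 0 := by
  have hsize : τ inSize ((1 : Expr).eval τ) = μ inSize 1 := by
    rw [h _ (by decide) (by decide)]; rfl
  refine (run_loop_sum (fun j => if μ arrPar j = τ varI 0 then
    τ arrVal ((τ varA 0 &&& bagMask μ j) * μ inSize 1 + j) else 0)
    (by decide) fun j hj ρ hρ hframe => ?_).trans (by rw [hsize])
  have h1 : ∀ D, D ∉ [cntV, cntJ, varKey, varVal] → ρ D = τ D := fun D hD =>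
    hframe D (by simp [writes, collect, forV] at hD ⊢; tauto)
  have h2 : Agree μ ρ := h.of_frame h1 (by decide)
  have h3 := run_collect_inBagOf h2 hP (p := var cntJ) (by decide)
  set π := (collect (inBagOf (var cntJ))).run ρ with hπ
  have h5 : ∀ D, D ∉ [cntV, varKey] → π D = ρ D := fun D hD =>
    run_frame (by simp [writes, collect, forV] at hD ⊢; tauto) ρ
  rw [Expr.eval_var, hρ, h1 varA (by decide)] at h3
  have hpar : ρ arrPar = μ arrPar := h2 _ (by decide) (by decide)
  have hsz : π inSize = μ inSize := by rw [h5 _ (by decide), h2 _ (by decide) (by decide)]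
  have htab : π arrVal = τ arrVal := by rw [h5 _ (by decide), h1 _ (by decide)]
  have hval : π varVal = ρ varVal := h5 _ (by decide)
  have hj' : π cntJ 0 = j := by rw [h5 _ (by decide), hρ]
  have hI : ρ varI = τ varI := h1 _ (by decide)
  rw [run_when_apply]
  simp only [Expr.eval_isEq, Expr.eval_read, Expr.eval_var, hρ, hpar, hI]
  by_cases hj'' : μ arrPar j = τ varI 0
  · simp [hj'', ← hπ, h3, hsz, htab, hval, hj']
  · simp [hj'']

theorem run_update {μ τ : Memory} (h : Agree μ τ) (hP : HasPowers μ) {a : ℕ}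
    (ha : a = (τ varA 0 &&& bagMask μ (μ arrPar (τ varI 0))) * μ inSize 1 + τ varI 0) :
    (∀ j, update.run τ arrVal j =
      if j = a ∧ (τ arrVal a = 0 ∨ τ varVal 0 < τ arrVal a) then τ varVal 0 else τ arrVal j) ∧
    ∀ j, update.run τ arrChoice j =
      if j = a ∧ (τ arrVal a = 0 ∨ τ varVal 0 < τ arrVal a) then τ varA 0 else τ arrChoice j := by
  have h3 := run_collect_inBagOf h hP (p := .read arrPar (var varI)) (by decide)
  set π := (collect (inBagOf (.read arrPar (var varI)))).run τ with hπ
  have h5 : ∀ D, D ∉ [cntV, varKey] → π D = τ D := fun D hD =>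
    run_frame (by simp [writes, collect, forV] at hD ⊢; tauto) τ
  have hsz : π inSize = μ inSize := by rw [h5 _ (by decide), h _ (by decide) (by decide)]
  rw [Expr.eval_read, Expr.eval_var, h arrPar (by decide) (by decide)] at h3
  have hAddr : (var varKey * sizeT + var varI).eval π = a := by
    simp [h3, hsz, h5, ha]
  have hcond : (isEq (.read arrVal (var varKey * sizeT + var varI)) 0 +
      isLt (var varVal) (.read arrVal (var varKey * sizeT + var varI))).eval π = 0 ↔
      ¬ (τ arrVal a = 0 ∨ τ varVal 0 < τ arrVal a) := by
    rw [Expr.eval_add, Expr.eval_isEq, Expr.eval_isLt, Expr.eval_read, hAddr]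
    simp only [Expr.eval_var, Expr.eval_zero, h5 arrVal (by decide), h5 varVal (by decide)]
    split_ifs <;> simp_all
  have hAddr' : π varKey 0 * τ inSize 1 + τ varI 0 = a := by simpa [h5] using hAddr
  constructor <;> intro j
  · rw [update, run_seq, ← hπ, run_when_apply]
    by_cases hc : τ arrVal a = 0 ∨ τ varVal 0 < τ arrVal a
    · rw [if_neg (by rw [hcond]; exact not_not.2 hc)]
      simp [hAddr', hc, h5]
    · rw [if_pos (hcond.2 hc)]
      simp [hc, h5]
  · rw [update, run_seq, ← hπ, run_when_apply]
    by_cases hc : τ arrVal a = 0 ∨ τ varVal 0 < τ arrVal a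
    · rw [if_neg (by rw [hcond]; exact not_not.2 hc)]
      simp [hAddr', hc, h5]
    · rw [if_pos (hcond.2 hc)]
      simp [hc, h5]

/-! ### Correctness of the dynamic programming -/

/-- The assignment to the bag `i` with number `a`. -/
def subBag (μ : Memory) (i a : ℕ) : ℕ :=
  (spread (fun v => decide (μ arrMem (i * μ inSize 0 + v) ≠ 0)) a (μ inSize 0)).1

theorem subBag_and (μ : Memory) (i a : ℕ) : subBag μ i a &&& bagMask μ i = subBag μ i a :=
  spread_fst_and _ _ _

/-- The costs that the tables in the memory `τ` define. -/
def tableCost (μ τ : Memory) (i A : ℕ) : ℕ :=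
  joinCost (μ inSize 1) (bagMask μ) (μ arrPar) (nodeCost μ) (fun j K => τ arrVal (K * μ inSize 1 + j))
    i A

/-- The summand 1 in `nodeCost` serves this purpose: since costs are positive, the value 0 can mark
a cell that is still empty, and the tables need no initialization. -/
theorem tableCost_pos (μ τ : Memory) (i A : ℕ) : tableCost μ τ i A ≠ 0 := by
  simp only [tableCost, joinCost, nodeCost]; omega

/-- The tables in the memory `τ` agree with those in `σ` except for the column `i`. -/
def OtherColumns (μ σ τ : Memory) (i : ℕ) : Prop :=
  ∀ j < μ inSize 1, j ≠ i → ∀ K, τ arrVal (K * μ inSize 1 + j) = σ arrVal (K * μ inSize 1 + j) ∧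
    τ arrChoice (K * μ inSize 1 + j) = σ arrChoice (K * μ inSize 1 + j)

/-- The cost at `k` reads only the columns of the children of `k`. -/
theorem tableCost_congr {μ σ τ : Memory} {i k : ℕ} (h : OtherColumns μ σ τ i)
    (hi : ∀ j < μ inSize 1, μ arrPar j = k → j ≠ i) (A : ℕ) :
    tableCost μ τ k A = tableCost μ σ k A := by
  simp only [tableCost, joinCost]
  congr 1
  refine Finset.sum_congr rfl fun j hj => ?_
  rw [Finset.mem_filter, Finset.mem_range] at hj
  exact (h j hj.1 (hi j hj.1 hj.2) _).1

/-- One round of the computation of the table `i`. -/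
theorem run_round {μ τ : Memory} (h : Agree μ τ) (hP : HasPowers μ) {i a K : ℕ}
    (hi : τ varI 0 = i) (ha : τ cntA 0 = a) (hK : K = subBag μ i a &&& bagMask μ (μ arrPar i)) :
    (∀ j, (decode ;; ownCost ;; childCost ;; update).run τ arrVal j =
      if j = K * μ inSize 1 + i ∧ (τ arrVal (K * μ inSize 1 + i) = 0 ∨
          tableCost μ τ i (subBag μ i a) < τ arrVal (K * μ inSize 1 + i))
        then tableCost μ τ i (subBag μ i a) else τ arrVal j) ∧
    ∀ j, (decode ;; ownCost ;; childCost ;; update).run τ arrChoice j =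
      if j = K * μ inSize 1 + i ∧ (τ arrVal (K * μ inSize 1 + i) = 0 ∨
          tableCost μ τ i (subBag μ i a) < τ arrVal (K * μ inSize 1 + i))
        then subBag μ i a else τ arrChoice j := by
  have d := run_decode h hP
  rw [hi, ha] at d
  change _ = subBag μ i a at d
  have fd : ∀ D, D ∉ decode.writes → decode.run τ D = τ D := fun D hD => run_frame hD τ
  have gd : Agree μ (decode.run τ) := h.run (by decide)
  have o := run_ownCost gd hP
  rw [d, fd varI (by decide), hi] at o
  have fo : ∀ D, D ∉ ownCost.writes → ownCost.run (decode.run τ) D = decode.run τ D :=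
    fun D hD => run_frame hD _
  have go : Agree μ (ownCost.run (decode.run τ)) := gd.run (by decide)
  have c := run_childCost go hP
  rw [o, fo varA (by decide), d, fo varI (by decide), fd varI (by decide), hi,
    fo arrVal (by decide), fd arrVal (by decide)] at c
  set ρ := childCost.run (ownCost.run (decode.run τ)) with hρ
  have fc : ∀ D, D ∉ childCost.writes → ρ D = ownCost.run (decode.run τ) D :=
    fun D hD => run_frame hD _
  have gc : Agree μ ρ := go.run (by decide)
  have hcost : ρ varVal 0 = tableCost μ τ i (subBag μ i a) := by
    rw [c, tableCost, joinCost, Finset.sum_filter]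
  have hA : ρ varA 0 = subBag μ i a := by
    rw [fc varA (by decide), fo varA (by decide), d]
  have hI : ρ varI 0 = i := by
    rw [fc varI (by decide), fo varI (by decide), fd varI (by decide), hi]
  have hVal : ρ arrVal = τ arrVal := by
    rw [fc arrVal (by decide), fo arrVal (by decide), fd arrVal (by decide)]
  have hChoice : ρ arrChoice = τ arrChoice := by
    rw [fc arrChoice (by decide), fo arrChoice (by decide), fd arrChoice (by decide)]
  have u := run_update gc hP (a := K * μ inSize 1 + i) (by rw [hA, hI, hK])
  rw [hcost, hA, hVal, hChoice] at u
  exact u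

/-- The column `i` of the tables after `k` rounds. -/
structure Column (μ σ τ : Memory) (i k : ℕ) : Prop where
  other : OtherColumns μ σ τ i
  best : ∀ K, (τ arrVal (K * μ inSize 1 + i) = 0 ∧
      ∀ a < k, subBag μ i a &&& bagMask μ (μ arrPar i) ≠ K) ∨
    ∃ a < k, subBag μ i a &&& bagMask μ (μ arrPar i) = K ∧
      τ arrVal (K * μ inSize 1 + i) = tableCost μ σ i (subBag μ i a) ∧
      τ arrChoice (K * μ inSize 1 + i) = subBag μ i a ∧
      ∀ b < k, subBag μ i b &&& bagMask μ (μ arrPar i) = K →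
        tableCost μ σ i (subBag μ i a) ≤ tableCost μ σ i (subBag μ i b)

theorem run_table_column {μ σ : Memory} (h : Agree μ σ) (hP : HasPowers μ) {i : ℕ}
    (hi : σ varI 0 = i) (hiN : i < μ inSize 1) (hpar : μ arrPar i ≠ i)
    (h0 : ∀ K, σ arrVal (K * μ inSize 1 + i) = 0) :
    Column μ σ (table.run σ) i (μ arrCount i) := by
  have hcount : σ arrCount ((var varI).eval σ) = μ arrCount i := by
    rw [Expr.eval_var, hi, h _ (by decide) (by decide)]
  have key := run_loop (A := cntA) (B := arrCount) (e := var varI) (σ := σ)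
    (p := decode ;; ownCost ;; childCost ;; update)
    (Inv := fun k τ => Column μ σ τ i k) ?_ ?_
  · rw [hcount] at key; exact key
  · exact ⟨fun j _ _ K => by simp, fun K => .inl (by simp [h0])⟩
  · intro k hk τ hτ hframe ih
    have hA : Agree μ τ := h.of_frame hframe (by decide)
    have hI : τ varI 0 = i := by rw [hframe _ (by decide), hi]
    set K₀ := subBag μ i k &&& bagMask μ (μ arrPar i) with hK₀
    obtain ⟨h1, h2⟩ := run_round hA hP hI hτ hK₀
    set ρ := ((decode ;; ownCost ;; childCost ;; update).run τ).write cntA 0 (k + 1) with hρ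
    have h3 : ρ arrVal = (decode ;; ownCost ;; childCost ;; update).run τ arrVal :=
      write_of_ne (by decide) _ _
    have h4 : ρ arrChoice = (decode ;; ownCost ;; childCost ;; update).run τ arrChoice :=
      write_of_ne (by decide) _ _
    -- A node is not its own child, so filling its column does not alter the costs being compared.
    have hcost : tableCost μ τ i (subBag μ i k) = tableCost μ σ i (subBag μ i k) :=
      tableCost_congr ih.other (fun j hj hji hne => hpar (by rwa [hne] at hji)) _
    rw [← h3, hcost] at h1
    rw [← h4, hcost] at h2
    clear_value ρ
    clear h3 h4
    refine ⟨fun j hj hne K => ?_, fun K => ?_⟩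
    · have h5 : K * μ inSize 1 + j ≠ K₀ * μ inSize 1 + i := fun h =>
        hne ((add_mul_inj hj hiN).1 h).2
      rw [h1, h2, if_neg fun h => h5 h.1, if_neg fun h => h5 h.1]
      exact ih.other j hj hne K
    · rw [h1, h2]
      by_cases hK : K = K₀
      · subst hK
        simp only [true_and]
        right
        -- Either the key occurs for the first time and its cell is still 0, or the new assignment
        -- competes with the best one so far.
        rcases ih.best K₀ with ⟨hz, hall⟩ | ⟨a, ha, haK, hval, hchoice, hmin⟩
        · refine ⟨k, by omega, rfl, by simp [hz], by simp [hz], fun b hb hbK => ?_⟩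
          obtain rfl : b = k := by
            by_contra hbk
            exact hall b (by omega) hbK
          exact le_rfl
        · have hne : τ arrVal (K₀ * μ inSize 1 + i) ≠ 0 := by rw [hval]; exact tableCost_pos _ _ _ _
          by_cases hlt : tableCost μ σ i (subBag μ i k) < τ arrVal (K₀ * μ inSize 1 + i)
          · refine ⟨k, by omega, rfl, by simp [hlt], by simp [hlt], fun b hb hbK => ?_⟩
            rcases Nat.lt_succ_iff_lt_or_eq.1 hb with hb | rfl
            · have := hmin b hb hbK
              omega
            · exact le_rfl
          · refine ⟨a, by omega, haK, by rw [if_neg (not_or.2 ⟨hne, hlt⟩), hval],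
              by rw [if_neg (not_or.2 ⟨hne, hlt⟩), hchoice],
              fun b hb hbK => ?_⟩
            rcases Nat.lt_succ_iff_lt_or_eq.1 hb with hb | rfl
            · exact hmin b hb hbK
            · omega
      · have h5 : K * μ inSize 1 + i ≠ K₀ * μ inSize 1 + i := fun h =>
          hK ((add_mul_inj hiN hiN).1 h).1
        rw [if_neg fun h => h5 h.1, if_neg fun h => h5 h.1]
        rcases ih.best K with ⟨hz, hall⟩ | ⟨a, ha, haK, hval, hchoice, hmin⟩
        · refine .inl ⟨hz, fun a ha => ?_⟩
          rcases Nat.lt_succ_iff_lt_or_eq.1 ha with ha | rfl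
          · exact hall a ha
          · exact fun h => hK h.symm
        · refine .inr ⟨a, by omega, haK, hval, hchoice, fun b hb hbK => ?_⟩
          rcases Nat.lt_succ_iff_lt_or_eq.1 hb with hb | rfl
          · exact hmin b hb hbK
          · exact absurd hbK.symm hK

/-- The results of the preparation on which the dynamic programming relies. -/
structure Prepared (μ : Memory) : Prop where
  powers : HasPowers μ
  tree : IsJoinTree (μ inSize 1) (bagMask μ) (μ arrPar)
  count : ∀ i < μ inSize 1, μ arrCount i =
    2 ^ ((Finset.range (μ inSize 0)).filter fun v => μ arrMem (i * μ inSize 0 + v) ≠ 0).card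
  table_zero : ∀ a, μ arrVal a = 0
  out_zero : ∀ v, μ outSide v = 0

/-- The column `i` of the tables in the memory is optimal. -/
def Solved (μ τ : Memory) (i : ℕ) : Prop :=
  IsOptimal (μ inSize 1) (bagMask μ) (μ arrPar) (nodeCost μ)
    (fun j K => τ arrVal (K * μ inSize 1 + j)) (fun j K => τ arrChoice (K * μ inSize 1 + j)) i

theorem Prepared.par_ne {μ : Memory} (h : Prepared μ) {i : ℕ} (hi : i < μ inSize 1) :
    μ arrPar i ≠ i := by
  rcases Nat.eq_zero_or_pos i with rfl | h0
  · rw [h.tree.par_zero]; omega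
  · exact (h.tree.par_lt i h0 hi).ne

/-- By `exists_spread` the codes below `arrCount` reach every assignment to the bag, so the minimum
over the rounds is a minimum over all assignments. -/
theorem Column.solved {μ σ τ : Memory} (hμ : Prepared μ) {i : ℕ} (hi : i < μ inSize 1)
    (h : Column μ σ τ i (μ arrCount i)) : Solved μ τ i := by
  have hcost : ∀ A, tableCost μ τ i A = tableCost μ σ i A :=
    tableCost_congr h.other fun j hj hji hne => hμ.par_ne hj (hne ▸ hji)
  have hex : ∀ A, A &&& bagMask μ i = A → ∃ a < μ arrCount i, subBag μ i a = A := by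
    intro A hA
    obtain ⟨a, ha, hs⟩ := exists_spread _ _ A hA
    refine ⟨a, ?_, ?_⟩
    · rw [hμ.count i hi]
      simpa using ha
    · have := hs 0
      rw [mul_zero, add_zero] at this
      rw [subBag, this]
  have hbest : ∀ A, A &&& bagMask μ i = A → ∃ a < μ arrCount i,
      subBag μ i a &&& bagMask μ (μ arrPar i) = A &&& bagMask μ (μ arrPar i) ∧
      τ arrVal ((A &&& bagMask μ (μ arrPar i)) * μ inSize 1 + i) =
        tableCost μ σ i (subBag μ i a) ∧
      τ arrChoice ((A &&& bagMask μ (μ arrPar i)) * μ inSize 1 + i) = subBag μ i a ∧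
      tableCost μ σ i (subBag μ i a) ≤ tableCost μ σ i A := by
    intro A hA
    obtain ⟨b, hb, rfl⟩ := hex A hA
    rcases h.best (subBag μ i b &&& bagMask μ (μ arrPar i)) with
      ⟨_, hall⟩ | ⟨a, ha, haK, hval, hchoice, hmin⟩
    · exact absurd rfl (hall b hb)
    · exact ⟨a, ha, haK, hval, hchoice, hmin b hb rfl⟩
  constructor
  · intro A hA
    obtain ⟨a, _, _, h2, _, h4⟩ := hbest A hA
    change _ ≤ tableCost μ τ i A
    rw [hcost, h2]
    exact h4
  · intro A hA
    obtain ⟨a, _, _, _, h3, _⟩ := hbest A hA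
    simp only [h3]
    exact subBag_and μ i a
  · intro A hA
    obtain ⟨a, _, h1, _, h3, _⟩ := hbest A hA
    simp only [h3]
    exact h1
  · intro A hA
    obtain ⟨a, _, _, h2, h3, _⟩ := hbest A hA
    change _ = tableCost μ τ i (τ arrChoice _)
    rw [h3, hcost, h2]

/-- The children of `k` have larger positions than `k`, so a smaller column is neither that of `k`
nor that of a child. -/
theorem Solved.congr {μ σ τ : Memory} (hμ : Prepared μ) {i k : ℕ} (hk : k < μ inSize 1)
    (hik : i < k) (h : OtherColumns μ σ τ i) (hs : Solved μ σ k) : Solved μ τ k := by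
  have hcost : ∀ A, tableCost μ τ k A = tableCost μ σ k A := by
    refine tableCost_congr h fun j hj hjk hji => ?_
    subst hji
    rcases Nat.eq_zero_or_pos j with rfl | h0
    · rw [hμ.tree.par_zero] at hjk; omega
    · have := hμ.tree.par_lt j h0 hj; omega
  have hval := fun K => (h k hk hik.ne' K).1
  have hchoice := fun K => (h k hk hik.ne' K).2
  constructor
  · intro A hA
    change _ ≤ tableCost μ τ k A
    rw [hcost, hval]
    exact hs.le A hA
  · intro A hA
    simp only [hchoice]
    exact hs.sub A hA
  · intro A hA
    simp only [hchoice]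
    exact hs.agree A hA
  · intro A hA
    change _ = tableCost μ τ k (τ arrChoice _)
    rw [hcost, hval, hchoice]
    exact hs.eq A hA

/-- Optimality of a table is relative to the tables of the children. As positions are treated in
decreasing order, these do not change afterwards. -/
theorem run_tables {μ : Memory} (hμ : Prepared μ) : ∀ i < μ inSize 1, Solved μ (tables.run μ) i := by
  have key := run_loop (A := cntI) (B := inSize) (e := 1) (σ := μ)
    (p := .assign varI 0 (sizeT - 1 - var cntI) ;; table)
    (Inv := fun k τ => (∀ i < μ inSize 1, μ inSize 1 - k ≤ i → Solved μ τ i) ∧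
      ∀ i < μ inSize 1 - k, ∀ K, τ arrVal (K * μ inSize 1 + i) = 0) ?_ ?_
  · intro i hi
    exact key.1 i hi (by simp)
  · exact ⟨fun i _ _ => by omega, fun i _ K => by simpa using hμ.table_zero _⟩
  · intro k hk τ hτ hframe ⟨ih1, ih2⟩
    have hk : k < μ inSize 1 := hk
    have hA : Agree μ τ := fun D hD hne => hframe D (by
      intro hmem
      have : ∀ D ∈ cntI :: (Prog.assign varI 0 (sizeT - 1 - var cntI) ;; table).writes,
        16 ≤ D := by decide
      have := this D hmem
      omega)
    set σ := (Prog.assign varI 0 (sizeT - 1 - var cntI)).run τ with hσ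
    have hσA : Agree μ σ := hA.run (by decide)
    set i := μ inSize 1 - 1 - k with hi
    have hiN : i < μ inSize 1 := by omega
    have hsI : σ varI 0 = i := by simp [hσ, hτ, hA inSize (by decide) (by decide), hi]
    have hsV : σ arrVal = τ arrVal := run_frame (by decide) τ
    have hsC : σ arrChoice = τ arrChoice := run_frame (by decide) τ
    have hcol := run_table_column hσA hμ.powers hsI hiN (hμ.par_ne hiN)
      fun K => by rw [hsV]; exact ih2 i (by omega) K
    set ρ := ((Prog.assign varI 0 (sizeT - 1 - var cntI) ;; table).run τ).write cntI 0 (k + 1)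
      with hρ
    have hρV : ρ arrVal = table.run σ arrVal := write_of_ne (by decide) _ _
    have hρC : ρ arrChoice = table.run σ arrChoice := write_of_ne (by decide) _ _
    have hother : OtherColumns μ τ ρ i := fun j hj hne K => by
      rw [hρV, hρC, ← hsV, ← hsC]
      exact hcol.other j hj hne K
    refine ⟨fun j hj hle => ?_, fun j hj K => ?_⟩
    · rcases Nat.lt_or_ge i j with hij | hij
      · exact (ih1 j hj (by omega)).congr hμ hj hij hother
      · obtain rfl : j = i := by omega
        have := hcol.solved hμ hiN
        simpa only [Solved, hρV, hρC] using this
    · rw [(hother j (by omega) (by omega) K).1]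
      exact ih2 j (by omega) K

/-- The output array itself represents the assembled set. The key is collected before the inner
loop, so the marks set there do not disturb it. -/
theorem run_output {μ τ : Memory} (h : Agree μ τ) (hP : HasPowers μ)
    (hout : ∀ v, τ outSide v = 0) (v : ℕ) (hv : v < μ inSize 0) :
    output.run τ outSide v = ((assemble (bagMask μ)
      (fun j K => τ arrChoice (K * μ inSize 1 + j)) (μ inSize 1)).testBit v).toNat := by
  set R := assemble (bagMask μ) (fun j K => τ arrChoice (K * μ inSize 1 + j)) with hR
  have hsz : τ inSize = μ inSize := h _ (by decide) (by decide)
  have key := run_loop (A := cntI) (B := inSize) (e := 1) (σ := τ)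
    (p := collect (.read outSide (var cntV) * .read arrMem (var cntI * sizeV + var cntV)) ;;
      forV cntV (.when (digit (.read arrChoice (var varKey * sizeT + var cntI)) (var cntV))
        (.assign outSide (var cntV) 1)))
    (Inv := fun k ρ => ∀ v < μ inSize 0, ρ outSide v = ((R k).testBit v).toNat) ?_ ?_
  · have h1 : τ inSize ((1 : Expr).eval τ) = μ inSize 1 := by rw [hsz]; rfl
    rw [h1] at key
    exact key v hv
  · intro v hv
    simp [hR, assemble, hout]
  · intro k hk ρ hρ hframe ih v hv
    have h1 : ∀ D, D ∉ [cntI, cntV, varKey, outSide] → ρ D = τ D := fun D hD =>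
      hframe D (by simp [writes, collect, forV] at hD ⊢; tauto)
    have hρA : Agree μ ρ := h.of_frame h1 (by decide)
    set c : Expr := .read outSide (var cntV) * .read arrMem (var cntI * sizeV + var cntV) with hc
    have hkey : (collect c).run ρ varKey 0 = R k &&& bagMask μ k := by
      rw [run_collect (fun v => (R k).testBit v &&
        decide (μ arrMem (k * μ inSize 0 + v) ≠ 0)) (hρA.hasPowers hP)]
      · refine Nat.eq_of_testBit_eq fun v => ?_
        rw [testBit_mask, Nat.testBit_and, testBit_bagMask, hρA _ (by decide) (by decide),
          Bool.and_left_comm]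
      · intro u hu π hπ hframe'
        rw [hρA _ (by decide) (by decide)] at hu
        have h3 : π outSide u = ((R k).testBit u).toNat := by
          rw [hframe' _ (by decide)]; exact ih u hu
        have h4 : π arrMem = μ arrMem := by
          rw [hframe' _ (by decide), hρA _ (by decide) (by decide)]
        have h5 : π inSize = μ inSize := by
          rw [hframe' _ (by decide), hρA _ (by decide) (by decide)]
        have h6 : π cntI 0 = k := by rw [hframe' _ (by decide), hρ]
        simp only [hc, Expr.eval_mul, Expr.eval_read, Expr.eval_var, Expr.eval_add, eval_sizeV,
          hπ, h3, h4, h5, h6]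
        cases (R k).testBit u <;> simp
    set σ := (collect c).run ρ with hσ
    have h2 : ∀ D, D ∉ [cntV, varKey] → σ D = ρ D := fun D hD =>
      run_frame (by simp [writes, collect, forV] at hD ⊢; tauto) ρ
    set C := τ arrChoice ((R k &&& bagMask μ k) * μ inSize 1 + k) with hC
    have hnext : R (k + 1) = R k ||| C := rfl
    have hσsz : σ inSize ((0 : Expr).eval σ) = μ inSize 0 := by
      rw [h2 _ (by decide), hρA _ (by decide) (by decide)]; rfl
    have key' := run_loop (A := cntV) (B := inSize) (e := 0) (σ := σ)
      (p := .when (digit (.read arrChoice (var varKey * sizeT + var cntI)) (var cntV))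
        (.assign outSide (var cntV) 1))
      (Inv := fun m π => ∀ v < μ inSize 0, π outSide v =
        ((R k).testBit v || (decide (v < m) && C.testBit v)).toNat) ?_ ?_
    · rw [hσsz] at key'
      rw [write_of_ne (by decide)]
      refine (key' v hv).trans ?_
      rw [hnext, Nat.testBit_or]
      simp [hv]
    · intro v hv
      rw [write_of_ne (by decide), h2 _ (by decide), ih v hv]
      simp
    · intro m hm π hπ hframe' ih' v hv
      rw [hσsz] at hm
      have h3 : ∀ D, D ∉ [cntV, outSide] → π D = σ D := fun D hD =>
        hframe' D (by simp [writes] at hD ⊢; tauto)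
      have h4 : π varKey 0 = R k &&& bagMask μ k := by rw [h3 _ (by decide), hkey]
      have h5 : π inSize = μ inSize := by
        rw [h3 _ (by decide), h2 _ (by decide), hρA _ (by decide) (by decide)]
      have h6 : π cntI 0 = k := by rw [h3 _ (by decide), h2 _ (by decide), hρ]
      have h7 : π arrChoice = τ arrChoice := by
        rw [h3 _ (by decide), h2 _ (by decide), h1 _ (by decide)]
      have h8 : π arrPow m = 2 ^ m := by
        rw [h3 _ (by decide), h2 _ (by decide), hρA _ (by decide) (by decide)]
        exact hP m hm.le
      have h9 : (digit (.read arrChoice (var varKey * sizeT + var cntI)) (var cntV)).eval π =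
          (C.testBit m).toNat := by
        rw [eval_digit _ (by rw [Expr.eval_var, hπ]; exact h8)]
        simp only [Expr.eval_read, Expr.eval_add, Expr.eval_mul, Expr.eval_var, eval_sizeT, h4, h5,
          h6, h7, hπ, hC]
      rw [write_of_ne (by decide), run_when_apply, run_assign_apply, h9]
      simp only [Expr.eval_var, hπ, Expr.eval_one, ih' v hv]
      rcases lt_trichotomy v m with hvm | rfl | hvm
      · have hvm' : v < m + 1 := by omega
        simp [hvm, hvm', hvm.ne]
      · cases hCv : C.testBit v <;> simp
      · have hvm' : ¬ v < m + 1 := by omega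
        have hvm'' : ¬ v < m := by omega
        simp [hvm', hvm'', hvm.ne']

/-- The assignment that the dynamic programming computes has minimum total cost. -/
theorem run_solve {μ : Memory} (hμ : Prepared μ)
    (hown : ∀ i S, nodeCost μ i (S &&& bagMask μ i) = nodeCost μ i S) :
    ∃ R, (∀ v < μ inSize 0, solve.run μ outSide v = (R.testBit v).toNat) ∧
      ∀ S, ∑ i ∈ Finset.range (μ inSize 1), nodeCost μ i R ≤
        ∑ i ∈ Finset.range (μ inSize 1), nodeCost μ i S := by
  have hA : Agree μ (tables.run μ) := Agree.run (fun _ _ _ => rfl) (by decide)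
  have hout : ∀ v, tables.run μ outSide v = 0 := fun v => by
    rw [run_frame (by decide)]; exact hμ.out_zero v
  exact ⟨_, run_output hA hμ.powers hout, fun S =>
    assemble_optimal hμ.tree hown (run_tables hμ) S⟩

end Prog

/-! ### The input -/

theorem matrixCells_mul_add {a b : ℕ} (M : Fin a → Fin b → ℕ) {i j : ℕ} (hi : i < a) (hj : j < b) :
    matrixCells M (i * b + j) = M ⟨i, hi⟩ ⟨j, hj⟩ := by
  have hb : 0 < b := by omega
  have h1 : (i * b + j) / b = i := by
    rw [mul_comm, Nat.mul_add_div hb, Nat.div_eq_of_lt hj, add_zero]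
  have h2 : (i * b + j) % b = j := by
    rw [mul_comm, Nat.mul_add_mod, Nat.mod_eq_of_lt hj]
  have h3 : (i * b + j) / b < a ∧ 0 < b := ⟨by rw [h1]; exact hi, hb⟩
  rw [matrixCells, dif_pos h3]
  congr 1 <;> simp [h1, h2]

theorem matrixCells_le {a b B : ℕ} (M : Fin a → Fin b → ℕ) (hM : ∀ i j, M i j ≤ B) (k : ℕ) :
    matrixCells M k ≤ B := by
  rw [matrixCells]; split_ifs
  · exact hM _ _
  · exact Nat.zero_le _

theorem bit_ne_zero {p : Prop} : bit p ≠ 0 ↔ p := by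
  rw [bit]; split_ifs with h <;> simp [h]

theorem bit_le_one (p : Prop) : bit p ≤ 1 := by
  rw [bit]; split_ifs <;> simp

section Input

variable (I : Instance) (D : TreeDecomposition I.graph)

theorem nodes_pos : 0 < D.nodes := by
  obtain ⟨t⟩ := D.isTree.connected.nonempty
  exact t.pos

theorem input_adj {u v : ℕ} (hu : u < I.n) (hv : v < I.n) :
    inputMemory I D inAdj (u * I.n + v) ≠ 0 ↔ I.graph.Adj ⟨u, hu⟩ ⟨v, hv⟩ := by
  have : inputMemory I D inAdj (u * I.n + v) = bit (I.graph.Adj ⟨u, hu⟩ ⟨v, hv⟩) :=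
    matrixCells_mul_add (fun u v => bit (I.graph.Adj u v)) hu hv
  rw [this, bit_ne_zero]

theorem input_wt {u v : ℕ} (hu : u < I.n) (hv : v < I.n) :
    inputMemory I D inWt (u * I.n + v) = I.wt ⟨u, hu⟩ ⟨v, hv⟩ :=
  matrixCells_mul_add _ hu hv

theorem input_tree {s t : ℕ} (hs : s < D.nodes) (ht : t < D.nodes) :
    inputMemory I D inTree (s * D.nodes + t) ≠ 0 ↔ D.tree.Adj ⟨s, hs⟩ ⟨t, ht⟩ := by
  have : inputMemory I D inTree (s * D.nodes + t) = bit (D.tree.Adj ⟨s, hs⟩ ⟨t, ht⟩) :=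
    matrixCells_mul_add (fun s t => bit (D.tree.Adj s t)) hs ht
  rw [this, bit_ne_zero]

theorem input_bag {t v : ℕ} (ht : t < D.nodes) (hv : v < I.n) :
    inputMemory I D inBag (t * I.n + v) ≠ 0 ↔ (⟨v, hv⟩ : Fin I.n) ∈ D.bag ⟨t, ht⟩ := by
  have : inputMemory I D inBag (t * I.n + v) = bit ((⟨v, hv⟩ : Fin I.n) ∈ D.bag ⟨t, ht⟩) :=
    matrixCells_mul_add (fun t v => bit (v ∈ D.bag t)) ht hv
  rw [this, bit_ne_zero]

theorem wt_le_maxWeight (u v : Fin I.n) : I.wt u v ≤ I.maxWeight := by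
  classical
  rw [Instance.wt]
  split_ifs with h
  · rw [Instance.maxWeight]
    exact Finset.le_sup (f := I.weight) (SimpleGraph.mem_edgeFinset.2 h)
  · exact Nat.zero_le _

theorem sizeLe_input :
    (inputMemory I D).SizeLe (I.n + D.nodes + Nat.log 2 I.maxWeight + 1) := by
  have bits : ∀ {a b : ℕ} (p : Fin a → Fin b → Prop) (k : ℕ),
      (matrixCells (fun i j => bit (p i j)) k).size ≤
        I.n + D.nodes + Nat.log 2 I.maxWeight + 1 := fun p k => by
    refine (Nat.size_le_size (matrixCells_le _ (fun i j => bit_le_one (p i j)) k)).trans ?_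
    simp
  have self : ∀ m : ℕ, m.size ≤ m := fun m => Nat.size_le.2 Nat.lt_two_pow_self
  intro A j
  unfold inputMemory
  split
  · exact (self _).trans (by omega)
  · exact (self _).trans (by omega)
  · exact bits _ _
  · refine (Nat.size_le_size (matrixCells_le _ (wt_le_maxWeight I) _)).trans ?_
    rw [Nat.size_le]
    exact (Nat.lt_pow_succ_log_self (by norm_num) _).trans_le
      (Nat.pow_le_pow_right (by norm_num) (by omega))
  · exact bits _ _
  · exact bits _ _
  · simp

/-- A walk of the tree from a node inside the set to one outside has an edge at which it leaves the
set. -/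
theorem linked_input {σ : Memory} (hs : σ inSize = inputMemory I D inSize)
    (ht : σ inTree = inputMemory I D inTree) : Prog.Linked σ := by
  have hN : σ inSize 1 = D.nodes := by rw [hs]; rfl
  rintro S ⟨s, hsN, hsS⟩ ⟨t, htN, htS⟩
  rw [hN] at hsN htN
  obtain ⟨p⟩ := D.isTree.connected.preconnected ⟨s, hsN⟩ ⟨t, htN⟩
  obtain ⟨d, _, hd1, hd2⟩ := p.exists_boundary_dart {x | (x : ℕ) ∈ S} hsS htS
  refine ⟨d.fst, by rw [hN]; exact d.fst.isLt, d.snd, by rw [hN]; exact d.snd.isLt, hd1, hd2, ?_⟩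
  rw [hN, ht, input_tree I D d.fst.isLt d.snd.isLt]
  exact d.adj

/-- The nodes whose bags meet the closed neighbourhood of `v`. -/
def touching (v : Fin I.n) : Set (Fin D.nodes) :=
  {t | ∃ u, (u = v ∨ I.graph.Adj u v) ∧ u ∈ D.bag t}

/-- The memory after the preparation. -/
noncomputable def preparedMemory : Memory :=
  Prog.prepare.run (inputMemory I D)

/-- The node at position `i`. -/
noncomputable def nodeAt (i : ℕ) : Fin D.nodes :=
  if h : preparedMemory I D arrOrd i < D.nodes then ⟨_, h⟩ else ⟨0, nodes_pos I D⟩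

end Input

/-! ### The memory after the preparation of an input -/

namespace Prog

section Preparation

variable (I : Instance) (D : TreeDecomposition I.graph)

theorem prepared_input {A : ℕ} (hA : A < 6) : preparedMemory I D A = inputMemory I D A := by
  refine run_frame (fun h => ?_) _
  have : ∀ B ∈ prepare.writes, 6 ≤ B := by decide
  have := this A h
  omega

theorem prepared_sizeV : preparedMemory I D inSize 0 = I.n := by
  rw [prepared_input I D (by decide)]; rfl

theorem prepared_sizeT : preparedMemory I D inSize 1 = D.nodes := by
  rw [prepared_input I D (by decide)]; rfl

theorem prepared_powers : HasPowers (preparedMemory I D) := by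
  intro v hv
  rw [prepared_input I D (by decide)] at hv
  rw [← run_powers _ v hv]
  exact congrFun (run_frame (p := penalty ;; order ;; closedBags ;; owners ;; counts) (by decide)
    (powers.run (inputMemory I D))) v

theorem prepared_penalty :
    preparedMemory I D arrPen 0 = 1 + ∑ v, I.weightedDegree v ∧
      (preparedMemory I D arrEdge 0 = 0 ↔ ∀ u v, ¬ I.graph.Adj u v) := by
  obtain ⟨h1, h2⟩ := run_penalty (powers.run (inputMemory I D))
  have h3 : ∀ A < 6, powers.run (inputMemory I D) A = inputMemory I D A := fun A hA =>
    run_frame (by simp [powers, writes, forV]; omega) _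
  have h4 : ∀ A ∈ [arrPen, arrEdge], preparedMemory I D A =
      penalty.run (powers.run (inputMemory I D)) A := fun A hA =>
    run_frame (p := order ;; closedBags ;; owners ;; counts)
      (by
        have : ∀ A ∈ [arrPen, arrEdge],
          A ∉ (order ;; closedBags ;; owners ;; counts).writes := by decide
        exact this A hA) _
  have h5 : powers.run (inputMemory I D) arrEdge 0 = 0 := by
    rw [run_frame (by decide)]; rfl
  have h6 : inputMemory I D inSize 0 = I.n := rfl
  rw [h4 _ (by decide), h4 _ (by decide), h1, h2, h3 inSize (by decide), h3 inWt (by decide),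
    h3 inAdj (by decide), h5, h6]
  constructor
  · rw [Finset.sum_range]
    congr 1
    refine Finset.sum_congr rfl fun u _ => ?_
    rw [Finset.sum_range, Instance.weightedDegree]
    exact Finset.sum_congr rfl fun v _ => input_wt I D u.isLt v.isLt
  · simp only [zero_add, Finset.sum_eq_zero_iff, Finset.mem_range]
    constructor
    · intro h u v huv
      exact (input_adj I D u.isLt v.isLt).2 huv (h u u.isLt v v.isLt)
    · intro h u hu v hv
      by_contra hne
      exact h _ _ ((input_adj I D hu hv).1 hne)

theorem prepared_order :
    (∀ i < D.nodes, preparedMemory I D arrOrd i < D.nodes) ∧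
      (∀ i < D.nodes, ∀ j < D.nodes, preparedMemory I D arrOrd i = preparedMemory I D arrOrd j →
        i = j) ∧
      (∀ i, 0 < i → i < D.nodes → preparedMemory I D arrPar i < i ∧
        inputMemory I D inTree (preparedMemory I D arrOrd (preparedMemory I D arrPar i) * D.nodes +
          preparedMemory I D arrOrd i) ≠ 0) ∧
      preparedMemory I D arrPar 0 = D.nodes := by
  set σ := (powers ;; penalty).run (inputMemory I D) with hσ
  have h1 : σ inSize = inputMemory I D inSize := run_frame (by decide) _
  have h2 : σ inTree = inputMemory I D inTree := run_frame (by decide) _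
  have h3 : ∀ t, σ arrVis t = 0 := fun t => by
    rw [hσ, run_frame (by decide)]; rfl
  have h4 : ∀ A ∈ [arrOrd, arrPar], preparedMemory I D A = order.run σ A := fun A hA =>
    run_frame (p := closedBags ;; owners ;; counts)
      (by
        have : ∀ A ∈ [arrOrd, arrPar], A ∉ (closedBags ;; owners ;; counts).writes := by decide
        exact this A hA) _
  obtain ⟨h5, h6⟩ := run_order σ h3 (linked_input I D h1 h2)
  have h7 : σ inSize 1 = D.nodes := by rw [h1]; rfl
  rw [h7] at h5 h6
  rw [h4 _ (by decide), h4 _ (by decide)]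
  refine ⟨fun i hi => h7 ▸ h5.ord_lt i hi, fun i hi j hj hij => ?_, fun i hi0 hi => ?_, h6⟩
  · rw [← h5.pos i hi, ← h5.pos j hj, hij]
  · have := h5.par i hi0 hi
    rw [h7, h2] at this
    exact this

theorem nodeAt_val {i : ℕ} (hi : i < D.nodes) :
    (nodeAt I D i : ℕ) = preparedMemory I D arrOrd i := by
  rw [nodeAt, dif_pos ((prepared_order I D).1 i hi)]

theorem prepared_bag {i v : ℕ} (hi : i < D.nodes) (hv : v < I.n) :
    inputMemory I D inBag (preparedMemory I D arrOrd i * I.n + v) ≠ 0 ↔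
      (⟨v, hv⟩ : Fin I.n) ∈ D.bag (nodeAt I D i) := by
  rw [← nodeAt_val I D hi]
  exact input_bag I D (nodeAt I D i).isLt hv

theorem prepared_closedBags {i v : ℕ} (hv : v < I.n) :
    preparedMemory I D arrMem (i * I.n + v) ≠ 0 ↔
      i < D.nodes ∧ nodeAt I D i ∈ touching I D ⟨v, hv⟩ := by
  set σ := (powers ;; penalty ;; order).run (inputMemory I D) with hσ
  have h1 : ∀ A < 6, σ A = inputMemory I D A := fun A hA => by
    refine run_frame (fun h => ?_) _
    have : ∀ B ∈ (powers ;; penalty ;; order).writes, 6 ≤ B := by decide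
    have := this A h
    omega
  have h2 : preparedMemory I D arrOrd = σ arrOrd :=
    run_frame (p := closedBags ;; owners ;; counts) (by decide) _
  have h3 : preparedMemory I D arrMem = closedBags.run σ arrMem :=
    run_frame (p := owners ;; counts) (by decide) _
  have h4 : ∀ a, σ arrMem a = 0 := fun a => by
    rw [hσ, run_frame (by decide)]; rfl
  rw [h3, run_closedBags, ← h2, h1 inSize (by decide), h1 inBag (by decide),
    h1 inAdj (by decide)]
  change _ ∨ (∃ j < D.nodes, ∃ u < I.n, ∃ w < I.n, _ ∧ _ ∧ i * I.n + v = j * I.n + w) ↔ _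
  simp only [h4, ne_eq, not_true, false_or]
  constructor
  · rintro ⟨j, hj, u, hu, w, hw, hbag, hadj, heq⟩
    obtain ⟨rfl, rfl⟩ := (add_mul_inj hv hw).1 heq
    refine ⟨hj, ⟨u, hu⟩, ?_, (prepared_bag I D hj hu).1 hbag⟩
    rcases hadj with h | rfl
    · exact .inr ((input_adj I D hu hv).1 h)
    · exact .inl rfl
  · rintro ⟨hi, u, hadj, hbag⟩
    refine ⟨i, hi, u, u.isLt, v, hv, (prepared_bag I D hi u.isLt).2 hbag, ?_, rfl⟩
    rcases hadj with rfl | h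
    · exact .inr rfl
    · exact .inl ((input_adj I D u.isLt hv).2 h)

theorem prepared_owners {v : ℕ} (hv : v < I.n) :
    preparedMemory I D arrOwn v < D.nodes ∧
      (⟨v, hv⟩ : Fin I.n) ∈ D.bag (nodeAt I D (preparedMemory I D arrOwn v)) := by
  set σ := (powers ;; penalty ;; order ;; closedBags).run (inputMemory I D) with hσ
  have h1 : ∀ A < 6, σ A = inputMemory I D A := fun A hA => by
    refine run_frame (fun h => ?_) _
    have : ∀ B ∈ (powers ;; penalty ;; order ;; closedBags).writes, 6 ≤ B := by decide
    have := this A h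
    omega
  have h2 : preparedMemory I D arrOrd = σ arrOrd :=
    run_frame (p := owners ;; counts) (by decide) _
  have h3 : preparedMemory I D arrOwn = owners.run σ arrOwn :=
    run_frame (p := counts) (by decide) _
  have hT : σ inSize 1 = D.nodes := by rw [h1 _ (by decide)]; rfl
  have hV : σ inSize 0 = I.n := by rw [h1 _ (by decide)]; rfl
  obtain ⟨t, ht⟩ := D.vertex_mem ⟨v, hv⟩
  -- The order maps the positions injectively into equally many nodes, so every node has a position.
  have hsurj : ∃ i < D.nodes, preparedMemory I D arrOrd i = t := by
    have hinj : Set.InjOn (preparedMemory I D arrOrd) (Finset.range D.nodes) := fun i hi j hj h =>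
      (prepared_order I D).2.1 i (by simpa using hi) j (by simpa using hj) h
    have := Finset.surjOn_of_injOn_of_card_le (s := Finset.range D.nodes)
      (t := Finset.range D.nodes) _
      (fun i hi => by simpa using (prepared_order I D).1 i (by simpa using hi)) hinj le_rfl
    obtain ⟨i, hi, hit⟩ := this (a := (t : ℕ)) (by simp)
    exact ⟨i, by simpa using hi, hit⟩
  obtain ⟨i, hi, hit⟩ := hsurj
  have key := run_owners σ v (by rw [hV]; exact hv) ⟨i, by rw [hT]; exact hi, by
    rw [← h2, hV, h1 _ (by decide), hit]
    exact (input_bag I D t.isLt hv).2 ht⟩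
  rw [← h2, ← h3, hV, hT, h1 _ (by decide)] at key
  exact ⟨key.1, (prepared_bag I D key.1 hv).1 key.2⟩

theorem prepared_counts (i : ℕ) :
    preparedMemory I D arrCount i = if i < D.nodes then
      2 ^ ((Finset.range I.n).filter fun v =>
        preparedMemory I D arrMem (i * I.n + v) ≠ 0).card else 0 := by
  set σ := (powers ;; penalty ;; order ;; closedBags ;; owners).run (inputMemory I D) with hσ
  have h1 : σ inSize = inputMemory I D inSize := run_frame (by decide) _
  have h2 : preparedMemory I D arrMem = σ arrMem := run_frame (p := counts) (by decide) _
  have h3 : σ arrCount i = 0 := by rw [hσ, run_frame (by decide)]; rfl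
  have h4 : preparedMemory I D arrCount = counts.run σ arrCount := rfl
  rw [h4, run_counts, ← h2, h1, h3]
  rfl

theorem prepared_testBit {i v : ℕ} : (bagMask (preparedMemory I D) i).testBit v = true ↔
    ∃ hv : v < I.n, i < D.nodes ∧ nodeAt I D i ∈ touching I D ⟨v, hv⟩ := by
  rw [testBit_bagMask, prepared_sizeV, Bool.and_eq_true, decide_eq_true_iff, decide_eq_true_iff]
  constructor
  · rintro ⟨hv, h⟩
    exact ⟨hv, (prepared_closedBags I D hv).1 h⟩
  · rintro ⟨hv, h⟩
    exact ⟨hv, (prepared_closedBags I D hv).2 h⟩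

/-- The running intersection property holds because the positions whose enlarged bag contains a
vertex form a subtree. The dummy bag is empty since no row beyond the nodes is filled. -/
theorem prepared_isJoinTree :
    IsJoinTree D.nodes (bagMask (preparedMemory I D)) (preparedMemory I D arrPar) := by
  obtain ⟨hord, hinj, hpar, hroot⟩ := prepared_order I D
  refine ⟨nodes_pos I D, hroot, fun i h0 hi => (hpar i h0 hi).1, ?_, fun i hi j hj v hiv hjv => ?_⟩
  · refine Nat.eq_of_testBit_eq fun v => ?_
    rw [Nat.zero_testBit, Bool.eq_false_iff]
    intro h
    obtain ⟨_, h, _⟩ := (prepared_testBit I D).1 h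
    exact lt_irrefl _ h
  · obtain ⟨hv, _, hiC⟩ := (prepared_testBit I D).1 hiv
    obtain ⟨_, _, hjC⟩ := (prepared_testBit I D).1 hjv
    have hlt := (hpar i (by omega) hi).1
    refine (prepared_testBit I D).2 ⟨hv, by omega, ?_⟩
    refine parent_mem_of_preconnected D.isTree.isAcyclic
      (preconnected_closedNeighbourhood D ⟨v, hv⟩) (ord := nodeAt I D) (fun a ha b hb h => ?_)
      (fun a h0 ha => ⟨(hpar a h0 ha).1, ?_⟩) hi hj hiC hjC
    · refine hinj a ha b hb ?_
      rw [← nodeAt_val I D ha, ← nodeAt_val I D hb, h]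
    · obtain ⟨h1, h2⟩ := hpar a h0 ha
      rw [← nodeAt_val I D ha, ← nodeAt_val I D (h1.trans ha)] at h2
      exact (input_tree I D (Fin.isLt _) (Fin.isLt _)).1 h2

theorem prepared : Prepared (preparedMemory I D) where
  powers := prepared_powers I D
  tree := by rw [prepared_sizeT]; exact prepared_isJoinTree I D
  count i hi := by
    rw [prepared_sizeT] at hi
    rw [prepared_counts, if_pos hi, prepared_sizeV]
  table_zero a := by
    rw [preparedMemory, run_frame (by decide)]; rfl
  out_zero v := by
    rw [preparedMemory, run_frame (by decide)]; rfl

/-! ### The cost of a cut -/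

/-- The cut that is given by a number. -/
def cutOf (n S : ℕ) : Finset (Fin n) :=
  Finset.univ.filter fun v => S.testBit v = true

theorem mem_cutOf {n S : ℕ} {v : Fin n} : v ∈ cutOf n S ↔ S.testBit v = true := by
  simp [cutOf]

theorem exists_cutOf {n : ℕ} (S : Finset (Fin n)) : ∃ m, cutOf n m = S := by
  classical
  refine ⟨mask (fun v => decide (∃ h : v < n, (⟨v, h⟩ : Fin n) ∈ S)) n, ?_⟩
  ext v
  simp [mem_cutOf, testBit_mask]

theorem cross_eq (S : ℕ) (v : Fin I.n) :
    cross (preparedMemory I D) S v = I.crossingWeight (cutOf I.n S) v := by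
  rw [cross, prepared_sizeV, prepared_input I D (by decide), Finset.sum_range,
    Instance.crossingWeight_eq]
  refine Finset.sum_congr rfl fun u _ => ?_
  rw [input_wt I D v.isLt u.isLt]
  simp only [mem_cutOf]
  cases S.testBit u <;> cases S.testBit v <;> simp

theorem degree_eq (v : Fin I.n) : degree (preparedMemory I D) v = I.weightedDegree v := by
  rw [degree, prepared_sizeV, prepared_input I D (by decide), Finset.sum_range,
    Instance.weightedDegree]
  exact Finset.sum_congr rfl fun u _ => input_wt I D v.isLt u.isLt

theorem vertexCost_eq (S : ℕ) (v : Fin I.n) : vertexCost (preparedMemory I D) S v =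
    I.localCost (1 + ∑ v, I.weightedDegree v) (cutOf I.n S) v := by
  rw [vertexCost, cross_eq, degree_eq, (prepared_penalty I D).1, Instance.localCost]

/-- Every vertex is charged at one node only, its owner. The positivity terms add the constant
number of nodes, which does not affect minimizers. -/
theorem sum_nodeCost (S : ℕ) :
    ∑ i ∈ Finset.range D.nodes, nodeCost (preparedMemory I D) i S =
      D.nodes + ∑ v, I.localCost (1 + ∑ v, I.weightedDegree v) (cutOf I.n S) v := by
  simp only [nodeCost, prepared_sizeV, Finset.sum_add_distrib]
  rw [Finset.sum_comm, Finset.sum_range (n := I.n)]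
  congr 1
  · simp
  · refine Finset.sum_congr rfl fun v _ => ?_
    rw [Finset.sum_ite_eq, if_pos (Finset.mem_range.2 (prepared_owners I D v.isLt).1),
      vertexCost_eq]

/-- A vertex charged at a node lies in the original bag, so the enlarged bag contains its
neighbours, and other vertices enter its cost with weight 0. -/
theorem nodeCost_and (i S : ℕ) :
    nodeCost (preparedMemory I D) i (S &&& bagMask (preparedMemory I D) i) =
      nodeCost (preparedMemory I D) i S := by
  refine congrArg (1 + ·) (Finset.sum_congr rfl fun v hv => ?_)
  rw [Finset.mem_range, prepared_sizeV] at hv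
  split_ifs with hi
  · obtain ⟨h1, h2⟩ := prepared_owners I D hv
    rw [hi] at h1 h2
    have hbit : ∀ u (hu : u < I.n), (u = v ∨ I.graph.Adj ⟨v, hv⟩ ⟨u, hu⟩) →
        (S &&& bagMask (preparedMemory I D) i).testBit u = S.testBit u := by
      intro u hu hadj
      have : (bagMask (preparedMemory I D) i).testBit u = true :=
        (prepared_testBit I D).2 ⟨hu, h1, ⟨v, hv⟩, hadj.imp (fun h => by simp [h]) id, h2⟩
      rw [Nat.testBit_and, this, Bool.and_true]
    have hcross : cross (preparedMemory I D) (S &&& bagMask (preparedMemory I D) i) v =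
        cross (preparedMemory I D) S v := by
      simp only [cross, prepared_sizeV, prepared_input I D (A := inWt) (by decide)]
      refine Finset.sum_congr rfl fun u hu => ?_
      rw [Finset.mem_range] at hu
      by_cases hadj : I.graph.Adj ⟨v, hv⟩ ⟨u, hu⟩
      · rw [hbit u hu (.inr hadj), hbit v hv (.inl rfl)]
      · have : inputMemory I D inWt (v * I.n + u) = 0 := by
          rw [input_wt I D hv hu, Instance.wt, if_neg hadj]
        simp [this]
    simp only [vertexCost, hcross]
  · rfl

/-! ### The algorithm -/

/-- The algorithm for Min Stable Cut. -/
def algorithm : Prog :=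
  prepare ;; .when (var arrEdge) solve

theorem run_algorithm (v : ℕ) : algorithm.run (inputMemory I D) outSide v =
    if preparedMemory I D arrEdge 0 = 0 then preparedMemory I D outSide v
      else solve.run (preparedMemory I D) outSide v :=
  run_when_apply _ _ _ _ _

theorem outputs_algorithm :
    ∃ S, I.IsMinStableCut S ∧ Outputs (algorithm.run (inputMemory I D)) S := by
  by_cases hedge : ∀ u v, ¬ I.graph.Adj u v
  · have hwt : ∀ u v, I.wt u v = 0 := fun u v => by rw [Instance.wt, if_neg (hedge u v)]
    refine ⟨∅, ⟨fun v => ?_, fun S' _ => ?_⟩, fun v => ?_⟩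
    · simp [Instance.weightedDegree, hwt]
    · simp [Instance.cutWeight]
    · have : preparedMemory I D arrEdge 0 = 0 := (prepared_penalty I D).2.2 hedge
      rw [run_algorithm, if_pos this]
      simpa using (prepared I D).out_zero v
  · obtain ⟨R, hR, hmin⟩ := run_solve (prepared I D) (nodeCost_and I D)
    refine ⟨cutOf I.n R, ?_, fun v => ?_⟩
    · refine I.isMinStableCut_of_localCost (M := 1 + ∑ v, I.weightedDegree v) (by omega)
        fun S' => ?_
      obtain ⟨S, rfl⟩ := exists_cutOf S'
      have := hmin S
      rw [prepared_sizeT, sum_nodeCost, sum_nodeCost] at this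
      omega
    · have hne : preparedMemory I D arrEdge 0 ≠ 0 := fun h => hedge ((prepared_penalty I D).2.1 h)
      rw [run_algorithm, if_neg hne, hR v (by rw [prepared_sizeV]; exact v.isLt)]
      simp only [mem_cutOf]
      cases R.testBit v <;> simp

end Preparation

/-! ### The running time -/

section RunningTime

variable (I : Instance) (D : TreeDecomposition I.graph)

theorem card_bag_le (t : Fin D.nodes) : (D.bag t).card ≤ D.width + 1 := by
  have : (D.bag t).card ≤ Finset.univ.sup fun t => (D.bag t).card :=
    Finset.le_sup (f := fun t => (D.bag t).card) (Finset.mem_univ t)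
  rw [TreeDecomposition.width]
  omega

/-- The enlarged bag is covered by the closed neighbourhoods of the vertices in the bag. -/
theorem card_touching_le (t : Fin D.nodes) (A : Finset (Fin I.n))
    (hA : ∀ v ∈ A, t ∈ touching I D v) : A.card ≤ (D.width + 1) * (I.maxDegree + 1) := by
  classical
  have hsub : A ⊆ (D.bag t).biUnion fun u => insert u (I.graph.neighborFinset u) := by
    intro v hv
    obtain ⟨u, hu, hut⟩ := hA v hv
    rw [Finset.mem_biUnion]
    refine ⟨u, hut, ?_⟩
    rw [Finset.mem_insert, SimpleGraph.mem_neighborFinset]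
    exact hu.imp Eq.symm id
  refine (Finset.card_le_card hsub).trans ?_
  refine (Finset.card_biUnion_le_card_mul _ _ (I.maxDegree + 1) fun u _ => ?_).trans
    (Nat.mul_le_mul (card_bag_le I D t) le_rfl)
  refine (Finset.card_insert_le _ _).trans (Nat.succ_le_succ ?_)
  rw [SimpleGraph.card_neighborFinset_eq_degree, Instance.maxDegree]
  convert I.graph.degree_le_maxDegree u

theorem width_pos {u v : Fin I.n} (h : I.graph.Adj u v) : 0 < D.width := by
  obtain ⟨t, hu, hv⟩ := D.edge_mem u v h
  have h1 : 1 < (D.bag t).card := Finset.one_lt_card.2 ⟨u, hu, v, hv, h.ne⟩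
  have h2 := card_bag_le I D t
  omega

theorem maxDegree_pos {u v : Fin I.n} (h : I.graph.Adj u v) : 0 < I.maxDegree := by
  classical
  have h1 : 0 < I.graph.degree u := (I.graph.degree_pos_iff_exists_adj u).2 ⟨v, h⟩
  refine h1.trans_le ?_
  rw [Instance.maxDegree]
  convert I.graph.degree_le_maxDegree u

/-- An edge forces Δ ≥ 1 and tw ≥ 1, and then (tw+1)(Δ+1) ≤ 4Δ·tw. This is why the edgeless case is
treated separately. -/
theorem prepared_counts_le {u v : Fin I.n} (h : I.graph.Adj u v) (i : ℕ) :
    preparedMemory I D arrCount i ≤ 2 ^ (4 * (I.maxDegree * D.width)) := by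
  classical
  rw [prepared_counts]
  split_ifs with hi
  · refine Nat.pow_le_pow_right (by norm_num) ?_
    set A := Finset.univ.filter fun v : Fin I.n => nodeAt I D i ∈ touching I D v
    have hsub : ((Finset.range I.n).filter fun v =>
        preparedMemory I D arrMem (i * I.n + v) ≠ 0) ⊆ A.map Fin.valEmbedding := by
      intro v hv
      rw [Finset.mem_filter, Finset.mem_range] at hv
      rw [Finset.mem_map]
      exact ⟨⟨v, hv.1⟩, by simpa [A] using ((prepared_closedBags I D hv.1).1 hv.2).2, rfl⟩
    have h1 := Finset.card_le_card hsub
    rw [Finset.card_map] at h1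
    have h2 := card_touching_le I D (nodeAt I D i) A fun v hv => by simpa [A] using hv
    have h3 := width_pos I D h
    have h4 := maxDegree_pos I h
    nlinarith
  · exact Nat.zero_le _

/-- The loops of the preparation are bounded by the numbers of vertices and nodes alone. Only the
second phase, which is reached only if there is an edge, also loops over the assignments counted in
`arrCount`. -/
theorem exec_algorithm {w₁ w₂ : ℕ}
    (h₁ : prepare.work (I.n + D.nodes) ≤ w₁)
    (h₂ : solve.work (I.n + D.nodes + 2 ^ (4 * (I.maxDegree * D.width))) ≤ w₂) :
    ∃ t, Exec algorithm.toProgram (inputMemory I D) (algorithm.run (inputMemory I D)) t ∧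
      t ≤ (w₁ + testWork (var arrEdge) + w₂) * (I.n + D.nodes + Nat.log 2 I.maxWeight + 1 +
        (w₁ + testWork (var arrEdge) + w₂) + 1) := by
  set b := I.n + D.nodes + Nat.log 2 I.maxWeight + 1
  set T := testWork (var arrEdge)
  have hsize : ∀ j, inputMemory I D inSize j ≤ I.n + D.nodes := by
    intro j
    match j with
    | 0 => exact Nat.le_add_right I.n D.nodes
    | 1 => exact Nat.le_add_left D.nodes I.n
    | j + 2 => exact Nat.zero_le _
  obtain ⟨hμ, t₁, ht₁, e₁⟩ := exec_run [inSize] (I.n + D.nodes) prepare valid_prepare (by decide)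
    (by decide) (inputMemory I D) b (by simpa using hsize) (sizeLe_input I D)
  have hμ' : (preparedMemory I D).SizeLe (b + w₁) := sizeLe_mono hμ (by omega)
  have ht₁' : t₁ ≤ w₁ * (b + (w₁ + T + w₂) + 1) :=
    ht₁.trans (Nat.mul_le_mul h₁ (by omega))
  have htest : (var arrEdge).cost (preparedMemory I D) +
      ((var arrEdge).eval (preparedMemory I D)).size + 2 ≤ T * (b + (w₁ + T + w₂) + 1) :=
    (cost_test_le hμ' _).trans (Nat.mul_le_mul le_rfl (by omega))
  rw [Nat.add_mul, Nat.add_mul]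
  by_cases hedge : preparedMemory I D arrEdge 0 = 0
  · have hrun : algorithm.run (inputMemory I D) = preparedMemory I D := if_pos hedge
    rw [hrun]
    refine ⟨_, Exec.seq e₁ (Exec.ite_false hedge (Exec.skip _)), ?_⟩
    change t₁ + ((var arrEdge).cost (preparedMemory I D) +
      ((var arrEdge).eval (preparedMemory I D)).size + 1 + 1) ≤ _
    omega
  · have hrun : algorithm.run (inputMemory I D) = solve.run (preparedMemory I D) := if_neg hedge
    rw [hrun]
    obtain ⟨u, v, huv⟩ : ∃ u v, I.graph.Adj u v := by
      by_contra! h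
      exact hedge ((prepared_penalty I D).2.2 h)
    obtain ⟨_, t₂, ht₂, e₂⟩ := exec_run [inSize, arrCount]
      (I.n + D.nodes + 2 ^ (4 * (I.maxDegree * D.width))) solve valid_solve (by decide)
      (by decide) (preparedMemory I D) (b + w₁) (fun B hB j => by
        simp only [List.mem_cons, List.not_mem_nil, or_false] at hB
        rcases hB with rfl | rfl
        · rw [prepared_input I D (by decide)]
          exact (hsize j).trans (Nat.le_add_right _ _)
        · exact (prepared_counts_le I D huv j).trans (Nat.le_add_left _ _)) hμ'
    have ht₂' : t₂ ≤ w₂ * (b + (w₁ + T + w₂) + 1) :=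
      ht₂.trans (Nat.mul_le_mul h₂ (by omega))
    refine ⟨_, Exec.seq e₁ (Exec.ite_true hedge e₂), ?_⟩
    change t₁ + ((var arrEdge).cost (preparedMemory I D) +
      ((var arrEdge).eval (preparedMemory I D)).size + 1 + t₂) ≤ _
    omega

/-! ### Collecting the exponents -/

theorem le_pow_of_two_le {Z : ℕ} (hZ : 2 ≤ Z) (k : ℕ) : k ≤ Z ^ k :=
  Nat.lt_two_pow_self.le.trans (Nat.pow_le_pow_left hZ k)

theorem mul_pow_le {Z k : ℕ} (hZ : 2 ≤ Z) : k * Z ^ k ≤ Z ^ (2 * k) := by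
  rw [two_mul, pow_add]
  exact Nat.mul_le_mul (le_pow_of_two_le hZ k) le_rfl

/-- The exponential factor `F` and the polynomial quantity `Y` are merged into `Z = F * Y`, which
dominates both; a power of `Z` then splits into the two factors of the bound. -/
theorem exists_time_bound : ∃ c : ℕ, ∀ (I : Instance) (D : TreeDecomposition I.graph),
    ∃ t, Exec algorithm.toProgram (inputMemory I D) (algorithm.run (inputMemory I D)) t ∧
      t ≤ 2 ^ (c * (I.maxDegree * D.width)) *
        (I.n + D.nodes + Nat.log 2 I.maxWeight + 2) ^ c := by
  obtain ⟨c₁, hc₁⟩ := exists_work_le prepare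
  obtain ⟨c₂, hc₂⟩ := exists_work_le solve
  set T := testWork (var arrEdge)
  set m := 2 * c₁ + T + 2 * c₂
  refine ⟨4 * (2 * m + 5), fun I D => ?_⟩
  set F := 2 ^ (4 * (I.maxDegree * D.width)) with hF
  have hF1 : 1 ≤ F := Nat.one_le_two_pow
  set Y := I.n + D.nodes + Nat.log 2 I.maxWeight + 2 with hY
  set Z := F * Y with hZdef
  have hYZ : Y ≤ Z := Nat.le_mul_of_pos_left _ hF1
  have hFYZ : F + Y ≤ Z + 1 := by
    have : 1 ≤ Y := by omega
    nlinarith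
  have hZ2 : 2 ≤ Z := by omega
  have h₁ : prepare.work (I.n + D.nodes) ≤ Z ^ m :=
    calc prepare.work (I.n + D.nodes) ≤ c₁ * (I.n + D.nodes + 1) ^ c₁ := hc₁ _
      _ ≤ c₁ * Z ^ c₁ := Nat.mul_le_mul le_rfl (Nat.pow_le_pow_left (by omega) _)
      _ ≤ Z ^ (2 * c₁) := mul_pow_le hZ2
      _ ≤ Z ^ m := Nat.pow_le_pow_right (by omega) (by omega)
  have h₂ : solve.work (I.n + D.nodes + F) ≤ Z ^ m :=
    calc solve.work (I.n + D.nodes + F) ≤ c₂ * (I.n + D.nodes + F + 1) ^ c₂ := hc₂ _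
      _ ≤ c₂ * Z ^ c₂ := Nat.mul_le_mul le_rfl (Nat.pow_le_pow_left (by omega) _)
      _ ≤ Z ^ (2 * c₂) := mul_pow_le hZ2
      _ ≤ Z ^ m := Nat.pow_le_pow_right (by omega) (by omega)
  have hT : T ≤ Z ^ m :=
    (le_pow_of_two_le hZ2 T).trans (Nat.pow_le_pow_right (by omega) (by omega))
  obtain ⟨t, he, ht⟩ := exec_algorithm I D h₁ h₂
  refine ⟨t, he, ht.trans ?_⟩
  -- The total work is at most `Z ^ (m + 2)` and the lengths are at most `Z ^ (m + 3)`. Their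
  -- product has exponent 2m + 5, and the factor 4 comes from the exponent of `F`.
  have h3 : Z ^ m + T + Z ^ m ≤ Z ^ (m + 2) := by
    have : 4 * Z ^ m ≤ Z ^ (m + 2) := by
      rw [pow_add Z m 2, mul_comm]
      exact Nat.mul_le_mul le_rfl (Nat.pow_le_pow_left hZ2 2)
    omega
  have h4 : I.n + D.nodes + Nat.log 2 I.maxWeight + 1 + (Z ^ m + T + Z ^ m) + 1 ≤
      Z ^ (m + 3) := by
    have h5 : Z ≤ Z ^ (m + 2) := by
      conv_lhs => rw [← pow_one Z]
      exact Nat.pow_le_pow_right (by omega) (by omega)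
    have h6 : 2 * Z ^ (m + 2) ≤ Z ^ (m + 3) := by
      rw [pow_succ Z (m + 2), mul_comm]
      exact Nat.mul_le_mul le_rfl hZ2
    omega
  refine (Nat.mul_le_mul h3 h4).trans ?_
  rw [← pow_add, hZdef, mul_pow, hF, ← pow_mul]
  refine Nat.mul_le_mul (Nat.pow_le_pow_right (by norm_num) (le_of_eq (by ring)))
    (Nat.pow_le_pow_right (by omega) (by omega))

end RunningTime

end Prog

end MinStableCut

/-! ### The theorem -/

theorem theorem3p6 :
    ∃ p : MinStableCut.Program, MinStableCut.Solves p ∧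
      -- the bound for an arbitrary tree decomposition, whose number of nodes is part of
      -- the size of the input
      (∃ c : ℕ, ∀ (I : MinStableCut.Instance) (D : MinStableCut.TreeDecomposition I.graph)
        (σ : MinStableCut.Memory) (t : ℕ),
        MinStableCut.Exec p (MinStableCut.inputMemory I D) σ t →
          t ≤ 2 ^ (c * (I.maxDegree * D.width)) *
            (I.n + D.nodes + Nat.log 2 I.maxWeight + 2) ^ c) ∧
      -- the bound for tree decompositions with polynomially many nodes
      (∀ d : ℕ, ∃ c : ℕ, ∀ (I : MinStableCut.Instance)
        (D : MinStableCut.TreeDecomposition I.graph) (σ : MinStableCut.Memory) (t : ℕ),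
        D.nodes ≤ (I.n + 2) ^ d →
        MinStableCut.Exec p (MinStableCut.inputMemory I D) σ t →
          t ≤ 2 ^ (c * (I.maxDegree * D.width)) *
            (I.n + Nat.log 2 I.maxWeight + 2) ^ c) := by
  obtain ⟨c, hc⟩ := MinStableCut.Prog.exists_time_bound
  have bound : ∀ (I : MinStableCut.Instance) (D : MinStableCut.TreeDecomposition I.graph)
      (σ : MinStableCut.Memory) (t : ℕ),
      MinStableCut.Exec MinStableCut.Prog.algorithm.toProgram (MinStableCut.inputMemory I D) σ t →
        t ≤ 2 ^ (c * (I.maxDegree * D.width)) *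
          (I.n + D.nodes + Nat.log 2 I.maxWeight + 2) ^ c := by
    intro I D σ t h
    obtain ⟨t', h', ht'⟩ := hc I D
    -- Runs are deterministic, so the bound for the one run that was constructed holds for every
    -- run.
    rw [(h.det h').2]
    exact ht'
  refine ⟨MinStableCut.Prog.algorithm.toProgram, fun I D => ?_, ⟨c, bound⟩,
    fun d => ⟨(d + 2) * c, fun I D σ t hd h => (bound I D σ t h).trans ?_⟩⟩
  · obtain ⟨t, h, _⟩ := hc I D
    exact ⟨_, t, h, MinStableCut.Prog.outputs_algorithm I D⟩
  · rw [pow_mul _ (d + 2) c]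
    refine Nat.mul_le_mul (Nat.pow_le_pow_right (by norm_num)
      (Nat.mul_le_mul (Nat.le_mul_of_pos_left c (by omega)) le_rfl)) (Nat.pow_le_pow_left ?_ c)
    set y := I.n + Nat.log 2 I.maxWeight + 2 with hy
    -- Exponent `d + 1` instead of `d` makes the power dominate `y` even if `d = 0`; the sum of the
    -- two terms costs one more factor, whence the constant `(d + 2) * c`.
    have h1 : (I.n + 2) ^ d ≤ y ^ (d + 1) :=
      (Nat.pow_le_pow_left (by omega) d).trans (Nat.pow_le_pow_right (by omega) (by omega))
    have h2 : y ≤ y ^ (d + 1) := by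
      conv_lhs => rw [← pow_one y]
      exact Nat.pow_le_pow_right (by omega) (by omega)
    have h3 : 2 * y ^ (d + 1) ≤ y ^ (d + 2) := by
      rw [pow_succ y (d + 1), mul_comm]
      exact Nat.mul_le_mul le_rfl (by omega)
    omega
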